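/- Let $d\in\mathbb N$ and let $\omega:[0,\infty)\to[0,\infty)$ be a non-quasianalytic subadditive weight function, i.e. $\omega$ is continuous and increasing (in the wide sense), $\omega(s+t)\le\omega(s)+\omega(t)$, $\int_1^\infty\omega(t)t^{-2}\,dt<\infty$, $\log t=o(\omega(t))$ as $t\to\infty$, and $\varphi_\omega(t):=\omega(e^t)$ is convex on $\mathbb R$. Put $\omega(\zeta):=\omega(|\zeta|)$ for vectors $\zeta$ (Euclidean norm) and $\varphi_\omega^*(s):=\sup_{t\ge0}\{ts-\varphi_\omega(t)\}$. Write $\hat f(\xi)=\int_{\mathbb R^d}e^{-i\langle x,\xi\rangle}f(x)\,dx$. Let $\mathcal S_\omega(\mathbb R^d)$ be the space of all $f\in\mathcal S(\mathbb R^d)$ such that $\sup_x e^{\lambda\omega(x)}|\partial^\alpha f(x)|<\infty$ and $\sup_\xi e^{\lambda\omega(\xi)}|\partial^\alpha\hat f(\xi)|<\infty$ for all $\lambda>0$ and $\alpha\in\mathbb N_0^d$, with the topology given by these seminorms. Let $\mathcal S'_\omega(\mathbb R^d)$ be its dual with the strong topology, with the bracket $\langle u,g\rangle$ ($u\in\mathcal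 S'_\omega$, $g\in\mathcal S_\omega$) conjugate-linear in $g$; $f\in\mathcal S_\omega$ is regarded as an element of $\mathcal S'_\omega$ by $\langle f,g\rangle=\int f\bar g\,dx$. For $\varphi\in\mathcal S_\omega(\mathbb R^d)\setminus\{0\}$, $u\in\mathcal S'_\omega(\mathbb R^d)$ and $z=(x,\xi)\in\mathbb R^{2d}$ let $V_\varphi u(z)=\langle u,\Pi(z)\varphi\rangle$, where $\Pi(z)\varphi(y)=e^{i\langle y,\xi\rangle}\varphi(y-x)$. A set $\Gamma\subseteq\mathbb R^{2d}\setminus\{0\}$ is conic if $tz\in\Gamma$ for all $z\in\Gamma$, $t>0$. The $\omega$-wave front set $\mathrm{WF}'_\omega(u)$ (with window $\varphi$) is the set of all $z_0\in\mathbb R^{2d}\setminus\{0\}$ for which there is no open conic $\Gamma\subseteq\mathbb R^{2d}\setminus\{0\}$ with $z_0\in\Gamma$ and $\sup_{z\in\Gamma}e^{\lambda\omega(z)}|V_\varphi u(z)|<\infty$ for all $\lambda>0$. The conic support $\mathrm{conesupp}(a)$ of a function $a$ on $\mathbb R^{2d}$ is the set of all $z\in\mathbb R^{2d}\setminus\{0\}$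 such that for every open conic $\Gamma\subseteq\mathbb R^{2d}\setminus\{0\}$ containing $z$ the set $\overline{\mathrm{supp}(a)\cap\Gamma}$ is not compact. For $m\in\mathbb R$ let $S^m_\omega$ be the set of all $a\in C^\infty(\mathbb R^{2d})$ such that for all $\lambda,\mu>0$ there is $C_{\lambda,\mu}>0$ with $$|\partial_x^\alpha\partial_\xi^\beta a(x,\xi)|\le C_{\lambda,\mu}\,e^{\lambda\varphi^*_\omega(|\alpha|/\lambda)}\,e^{\mu\varphi^*_\omega(|\beta|/\mu)}\,e^{m\omega(\xi)}\qquad\text{for all }(x,\xi)\in\mathbb R^{2d},\ \alpha,\beta\in\mathbb N_0^d,$$ and for $f\in\mathcal S_\omega(\mathbb R^d)$ let $a(x,D)f(x)=(2\pi)^{-d}\int_{\mathbb R^d}e^{i\langle x,\xi\rangle}a(x,\xi)\hat f(\xi)\,d\xi$. **Proposition.** Let $m\in\mathbb R$ and $a\in S^m_\omega$. Then $a(x,D)$, regarded as a map from $\mathcal S_\omega(\mathbb R^d)$ to $\mathcal S'_\omega(\mathbb R^d)$ (so $\langle a(x,D)f,g\rangle=\int a(x,D)f\,\bar g\,dx$,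 an absolutely convergent integral), extends in exactly one way to a continuous linear operator $a(x,D):\mathcal S'_\omega(\mathbb R^d)\to\mathcal S'_\omega(\mathbb R^d)$, and for every $u\in\mathcal S'_\omega(\mathbb R^d)$ $$\mathrm{WF}'_\omega(a(x,D)u)\subseteq\mathrm{conesupp}(a),$$ where the wave front set may be computed with any window $\varphi\in\mathcal S_\omega(\mathbb R^d)\setminus\{0\}$. -/

import Mathlib

open MeasureTheory Set Filter
open scoped SchwartzMap NNReal

namespace OmegaWF

/-- A non-quasianalytic subadditive weight function `ω : [0,∞) → [0,∞)`.
The values of `toFun` at negative arguments are never used. -/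
structure Weight where
  toFun : ℝ → ℝ
  nonneg : ∀ t, 0 ≤ t → 0 ≤ toFun t
  cont : ContinuousOn toFun (Ici 0)
  mono : MonotoneOn toFun (Ici 0)
  subadd : ∀ s t, 0 ≤ s → 0 ≤ t → toFun (s + t) ≤ toFun s + toFun t
  nonquasianalytic : IntegrableOn (fun t => toFun t / t ^ 2) (Ioi 1)
  log_isLittleO : Real.log =o[atTop] toFun
  convex_exp : ConvexOn ℝ univ (fun t => toFun (Real.exp t))

instance : CoeFun Weight (fun _ => ℝ → ℝ) := ⟨Weight.toFun⟩

/-- The Young conjugate `φ*(s) = sup_{t ≥ 0} (t s - ω(e^t))` of `φ(t) = ω(e^t)`. -/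
noncomputable def Weight.youngConj (ω : Weight) (s : ℝ) : ℝ :=
  sSup ((fun t => t * s - ω (Real.exp t)) '' Ici 0)

/-- `ℝ^d` with its Euclidean norm; phase space `ℝ^{2d}` is `Rd d × Rd d`, with points `(x, ξ)`. -/
abbrev Rd (d : ℕ) := EuclideanSpace ℝ (Fin d)

/-- The Euclidean length of a point of phase space (the product carries the sup norm). -/
noncomputable def phaseNorm {d : ℕ} (z : Rd d × Rd d) : ℝ := Real.sqrt (‖z.1‖ ^ 2 + ‖z.2‖ ^ 2)

/-- The Fourier transform `∫ e^{-i⟨x,ξ⟩} f(x) dx`. -/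
noncomputable def ft {d : ℕ} (f : Rd d → ℂ) (ξ : Rd d) : ℂ :=
  ∫ x, Complex.exp (-(Complex.I * (inner ℝ x ξ : ℝ))) * f x

/-- `sup_x e^{l ω(x)} |∂^α f(x)| < ∞` for all `l > 0` and all multi-indices `α`; the partial
derivatives of order `n` are collected in the `n`-th Fréchet derivative, whose norm is equivalent
to the maximum of `|∂^α f|` over `|α| = n`. -/
def WDecay {d : ℕ} (ω : Weight) (f : Rd d → ℂ) : Prop :=
  ∀ (l : ℝ), 0 < l → ∀ n : ℕ,
    BddAbove (range fun x => Real.exp (l * ω ‖x‖) * ‖iteratedFDeriv ℝ n f x‖)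

/-! ### Facts needed to see that the space below is a vector space stable under shifts -/

theorem ft_eq_fourier {d : ℕ} (f : 𝓢(Rd d, ℂ)) :
    ft f = fun ξ => (FourierTransform.fourier f : 𝓢(Rd d, ℂ)) ((2 * Real.pi)⁻¹ • ξ) := by
  funext ξ
  rw [SchwartzMap.fourier_coe, Real.fourier_eq', ft]
  congr 1
  funext x
  rw [smul_eq_mul, inner_smul_right]
  congr 2
  have : (Real.pi : ℂ) ≠ 0 := by exact_mod_cast Real.pi_ne_zero
  push_cast
  field_simp

theorem ft_smooth {d : ℕ} (f : 𝓢(Rd d, ℂ)) : ContDiff ℝ (⊤ : ℕ∞) (ft f) := by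
  rw [ft_eq_fourier]
  exact ((FourierTransform.fourier f : 𝓢(Rd d, ℂ)).smooth ⊤).comp (contDiff_const_smul _)

theorem ft_add {d : ℕ} (f g : 𝓢(Rd d, ℂ)) : ft (f + g : 𝓢(Rd d, ℂ)) = ft f + ft g := by
  rw [ft_eq_fourier, ft_eq_fourier, ft_eq_fourier]
  funext ξ
  simp [FourierTransform.fourier_add]

theorem ft_smul {d : ℕ} (c : ℂ) (f : 𝓢(Rd d, ℂ)) : ft (c • f : 𝓢(Rd d, ℂ)) = c • ft f := by
  rw [ft_eq_fourier, ft_eq_fourier]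
  funext ξ
  simp [FourierTransform.fourier_smul]

theorem iteratedFDeriv_add_le {d : ℕ} {f g : Rd d → ℂ} (hf : ContDiff ℝ (⊤ : ℕ∞) f) (hg : ContDiff ℝ (⊤ : ℕ∞) g)
    (ω : Weight) (l : ℝ) (n : ℕ) (x : Rd d) :
    Real.exp (l * ω ‖x‖) * ‖iteratedFDeriv ℝ n (f + g) x‖ ≤
      Real.exp (l * ω ‖x‖) * ‖iteratedFDeriv ℝ n f x‖ +
      Real.exp (l * ω ‖x‖) * ‖iteratedFDeriv ℝ n g x‖ := by
  rw [iteratedFDeriv_add_apply (hf.of_le (by exact_mod_cast le_top)).contDiffAt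
    (hg.of_le (by exact_mod_cast le_top)).contDiffAt, ← mul_add]
  gcongr
  exact norm_add_le _ _

theorem iteratedFDeriv_smul_eq {d : ℕ} {f : Rd d → ℂ} (hf : ContDiff ℝ (⊤ : ℕ∞) f)
    (ω : Weight) (l : ℝ) (n : ℕ) (c : ℂ) (x : Rd d) :
    Real.exp (l * ω ‖x‖) * ‖iteratedFDeriv ℝ n (c • f) x‖ =
      ‖c‖ * (Real.exp (l * ω ‖x‖) * ‖iteratedFDeriv ℝ n f x‖) := by
  rw [iteratedFDeriv_const_smul_apply (hf.of_le (by exact_mod_cast le_top)).contDiffAt, norm_smul]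
  ring

theorem WDecay.add {d : ℕ} {ω : Weight} {f g : Rd d → ℂ} (hf : ContDiff ℝ (⊤ : ℕ∞) f)
    (hg : ContDiff ℝ (⊤ : ℕ∞) g) (h : WDecay ω f) (h' : WDecay ω g) : WDecay ω (f + g) := by
  intro l hl n
  obtain ⟨A, hA⟩ := h l hl n
  obtain ⟨B, hB⟩ := h' l hl n
  refine ⟨A + B, ?_⟩
  rintro _ ⟨x, rfl⟩
  exact (iteratedFDeriv_add_le hf hg ω l n x).trans
    (add_le_add (hA (mem_range_self x)) (hB (mem_range_self x)))

theorem WDecay.smul {d : ℕ} {ω : Weight} {f : Rd d → ℂ} (hf : ContDiff ℝ (⊤ : ℕ∞) f) (c : ℂ)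
    (h : WDecay ω f) : WDecay ω (c • f) := by
  intro l hl n
  obtain ⟨A, hA⟩ := h l hl n
  refine ⟨‖c‖ * A, ?_⟩
  rintro _ ⟨x, rfl⟩
  simp only [iteratedFDeriv_smul_eq hf]
  exact mul_le_mul_of_nonneg_left (hA (mem_range_self x)) (norm_nonneg _)

/-- The plane wave `y ↦ e^{i⟨y,ξ⟩}`. -/
noncomputable def wave {d : ℕ} (ξ y : Rd d) : ℂ := Complex.exp (Complex.I * (inner ℝ y ξ : ℝ))

theorem norm_wave {d : ℕ} (ξ y : Rd d) : ‖wave ξ y‖ = 1 := by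
  rw [wave, mul_comm]
  exact Complex.norm_exp_ofReal_mul_I _

theorem wave_smooth {d : ℕ} (ξ : Rd d) : ContDiff ℝ (⊤ : ℕ∞) (wave ξ) := by
  unfold wave
  exact Complex.contDiff_exp.comp (contDiff_const.mul (Complex.ofRealCLM.contDiff.comp
    (contDiff_id.inner ℝ contDiff_const)))

theorem fderiv_wave {d : ℕ} (ξ : Rd d) : ∃ L : ℂ →L[ℝ] (Rd d →L[ℝ] ℂ),
    fderiv ℝ (wave ξ) = L ∘ wave ξ := by
  let M : Rd d →L[ℝ] ℂ := Complex.ofRealCLM.comp ((innerSL ℝ) ξ)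
  refine ⟨((ContinuousLinearMap.compL ℝ (Rd d) ℂ ℂ).flip M).comp
    ((ContinuousLinearMap.mul ℝ ℂ).comp ((ContinuousLinearMap.mul ℝ ℂ) Complex.I)), ?_⟩
  funext y
  have h1 : HasFDerivAt (fun y : Rd d => Complex.I * ((inner ℝ y ξ : ℝ) : ℂ)) (Complex.I • M) y := by
    have : HasFDerivAt (fun y : Rd d => ((inner ℝ y ξ : ℝ) : ℂ)) M y := by
      have h0 : (fun y : Rd d => ((inner ℝ y ξ : ℝ) : ℂ)) = M := by
        funext y; simp [M, real_inner_comm]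
      rw [h0]
      exact M.hasFDerivAt
    exact this.const_mul Complex.I
  have h2 := h1.cexp
  have h3 : HasFDerivAt (wave ξ) _ y := h2
  rw [h3.fderiv]
  ext v
  simp [wave]
  ring

theorem wave_bound {d : ℕ} (ξ : Rd d) (n : ℕ) :
    ∃ C : ℝ, ∀ y, ‖iteratedFDeriv ℝ n (wave ξ) y‖ ≤ C := by
  induction n with
  | zero => exact ⟨1, fun y => by rw [norm_iteratedFDeriv_zero, norm_wave]⟩
  | succ n ih =>
    obtain ⟨C, hC⟩ := ih
    obtain ⟨L, hL⟩ := fderiv_wave ξ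
    refine ⟨‖L‖ * C, fun y => ?_⟩
    rw [← norm_iteratedFDeriv_fderiv, hL]
    exact (L.norm_iteratedFDeriv_comp_left (wave_smooth ξ).contDiffAt
      (by exact_mod_cast le_top)).trans (mul_le_mul_of_nonneg_left (hC y) (norm_nonneg _))

theorem wave_temperate {d : ℕ} (ξ : Rd d) : (wave ξ).HasTemperateGrowth := by
  refine ⟨wave_smooth ξ, fun n => ?_⟩
  obtain ⟨C, hC⟩ := wave_bound ξ n
  exact ⟨0, C, fun y => by simpa using hC y⟩

theorem WDecay.translate {d : ℕ} {ω : Weight} {f : Rd d → ℂ} (h : WDecay ω f) (x : Rd d) :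
    WDecay ω (fun y => f (y - x)) := by
  intro l hl n
  obtain ⟨A, hA⟩ := h l hl n
  refine ⟨Real.exp (l * ω ‖x‖) * A, ?_⟩
  rintro _ ⟨y, rfl⟩
  have h1 : ω ‖y‖ ≤ ω ‖x‖ + ω ‖y - x‖ := by
    refine le_trans (ω.mono (norm_nonneg _) (by positivity : (0 : ℝ) ≤ ‖x‖ + ‖y - x‖) ?_)
      (ω.subadd _ _ (norm_nonneg _) (norm_nonneg _))
    simpa using norm_add_le x (y - x)
  have h2 : Real.exp (l * ω ‖y‖) ≤ Real.exp (l * ω ‖x‖) * Real.exp (l * ω ‖y - x‖) := by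
    rw [← Real.exp_add, ← mul_add]
    exact Real.exp_le_exp.2 (mul_le_mul_of_nonneg_left h1 hl.le)
  have h3 := hA (mem_range_self (y - x))
  simp only [iteratedFDeriv_comp_sub]
  calc _ ≤ (Real.exp (l * ω ‖x‖) * Real.exp (l * ω ‖y - x‖)) * ‖iteratedFDeriv ℝ n f (y - x)‖ := by
        gcongr
    _ = Real.exp (l * ω ‖x‖) * (Real.exp (l * ω ‖y - x‖) * ‖iteratedFDeriv ℝ n f (y - x)‖) := by
        ring
    _ ≤ _ := mul_le_mul_of_nonneg_left h3 (Real.exp_pos _).le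

theorem WDecay.modulate {d : ℕ} {ω : Weight} {f : Rd d → ℂ} (hf : ContDiff ℝ (⊤ : ℕ∞) f)
    (h : WDecay ω f) (ξ : Rd d) : WDecay ω (fun y => wave ξ y * f y) := by
  intro l hl n
  choose A hA using fun k => h l hl k
  choose C hC using wave_bound ξ
  refine ⟨∑ i ∈ Finset.range (n + 1), (n.choose i : ℝ) * C i * A (n - i), ?_⟩
  rintro _ ⟨y, rfl⟩
  have h1 := norm_iteratedFDeriv_mul_le (n := n) (wave_smooth ξ) hf y (by exact_mod_cast le_top)
  refine (mul_le_mul_of_nonneg_left h1 (Real.exp_pos _).le).trans ?_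
  rw [Finset.mul_sum]
  refine Finset.sum_le_sum fun i _ => ?_
  have hc : 0 ≤ C i := (norm_nonneg _).trans (hC i y)
  calc _ = (n.choose i : ℝ) * ‖iteratedFDeriv ℝ i (wave ξ) y‖ *
          (Real.exp (l * ω ‖y‖) * ‖iteratedFDeriv ℝ (n - i) f y‖) := by ring
    _ ≤ _ := by
        gcongr
        · exact hC i y
        · exact hA (n - i) (mem_range_self y)

/-! ### The space `S_ω(ℝ^d)`, its topology and its dual -/

/-- The Schwartz functions `u` such that `u` and `û` have all derivatives
`O(e^{-l ω})` for every `l > 0`. -/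
noncomputable def somegaSubmodule (ω : Weight) (d : ℕ) : Submodule ℂ 𝓢(Rd d, ℂ) where
  carrier := {u | WDecay ω u ∧ WDecay ω (ft u)}
  add_mem' := fun {u v} hu hv =>
    ⟨hu.1.add (u.smooth ⊤) (v.smooth ⊤) hv.1,
      by rw [ft_add]; exact hu.2.add (ft_smooth u) (ft_smooth v) hv.2⟩
  zero_mem' := by
    have h0 : WDecay ω (0 : Rd d → ℂ) := by
      intro l _ n
      refine ⟨0, ?_⟩
      rintro _ ⟨x, rfl⟩
      simp
    have h1 : ft ((0 : 𝓢(Rd d, ℂ)) : Rd d → ℂ) = 0 := by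
      funext ξ
      simp [ft]
    exact ⟨h0, by rw [h1]; exact h0⟩
  smul_mem' := fun c u hu =>
    ⟨hu.1.smul (u.smooth ⊤) c, by rw [ft_smul]; exact hu.2.smul (ft_smooth u) c⟩

/-- The space `S_ω(ℝ^d)`, as a type of its own: it does not carry the topology of `𝓢`. -/
def Somega (ω : Weight) (d : ℕ) : Type := somegaSubmodule ω d

noncomputable instance (ω : Weight) (d : ℕ) : AddCommGroup (Somega ω d) :=
  inferInstanceAs (AddCommGroup (somegaSubmodule ω d))

noncomputable instance (ω : Weight) (d : ℕ) : Module ℂ (Somega ω d) :=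
  inferInstanceAs (Module ℂ (somegaSubmodule ω d))

/-- The inclusion of `S_ω` in the Schwartz space. -/
noncomputable def Somega.toSchwartz {ω : Weight} {d : ℕ} : Somega ω d →ₗ[ℂ] 𝓢(Rd d, ℂ) :=
  (somegaSubmodule ω d).subtype

noncomputable instance (ω : Weight) (d : ℕ) : CoeFun (Somega ω d) (fun _ => Rd d → ℂ) :=
  ⟨fun u => u.toSchwartz⟩

theorem Somega.decay {ω : Weight} {d : ℕ} (u : Somega ω d) : WDecay ω u := u.2.1

theorem Somega.decay_ft {ω : Weight} {d : ℕ} (u : Somega ω d) : WDecay ω (ft u) := u.2.2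

theorem Somega.coe_add {ω : Weight} {d : ℕ} (u v : Somega ω d) :
    ((u + v : Somega ω d) : Rd d → ℂ) = u + v := rfl

theorem Somega.coe_smul {ω : Weight} {d : ℕ} (c : ℂ) (u : Somega ω d) :
    ((c • u : Somega ω d) : Rd d → ℂ) = c • (u : Rd d → ℂ) := rfl

theorem Somega.ft_add {ω : Weight} {d : ℕ} (u v : Somega ω d) :
    ft (u + v : Somega ω d) = ft u + ft v := OmegaWF.ft_add u.toSchwartz v.toSchwartz

theorem Somega.ft_smul {ω : Weight} {d : ℕ} (c : ℂ) (u : Somega ω d) :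
    ft (c • u : Somega ω d) = c • ft u := OmegaWF.ft_smul c u.toSchwartz

/-- `sup_x e^{l ω(x)} ‖D^n f(x)‖`. -/
noncomputable def wsup {d : ℕ} (ω : Weight) (l : ℝ) (n : ℕ) (f : Rd d → ℂ) : ℝ :=
  ⨆ x, Real.exp (l * ω ‖x‖) * ‖iteratedFDeriv ℝ n f x‖

theorem wsup_add_le {d : ℕ} {ω : Weight} {l : ℝ} (hl : 0 < l) (n : ℕ) {f g : Rd d → ℂ}
    (hf : ContDiff ℝ (⊤ : ℕ∞) f) (hg : ContDiff ℝ (⊤ : ℕ∞) g) (h : WDecay ω f) (h' : WDecay ω g) :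
    wsup ω l n (f + g) ≤ wsup ω l n f + wsup ω l n g :=
  ciSup_le fun x => (iteratedFDeriv_add_le hf hg ω l n x).trans
    (add_le_add (le_ciSup (h l hl n) x) (le_ciSup (h' l hl n) x))

theorem wsup_smul {d : ℕ} (ω : Weight) (l : ℝ) (n : ℕ) (c : ℂ) {f : Rd d → ℂ}
    (hf : ContDiff ℝ (⊤ : ℕ∞) f) : wsup ω l n (c • f) = ‖c‖ * wsup ω l n f := by
  unfold wsup
  rw [Real.mul_iSup_of_nonneg (norm_nonneg c)]
  exact congrArg _ (funext fun x => iteratedFDeriv_smul_eq hf ω l n c x)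

/-- The seminorms `sup e^{l ω} |D^n u|` and `sup e^{l ω} |D^n û|`, for `l > 0` and `n ∈ ℕ`. -/
noncomputable def somegaSeminorms (ω : Weight) (d : ℕ) :
    SeminormFamily ℂ (Somega ω d) (({l : ℝ // 0 < l} × ℕ) ⊕ ({l : ℝ // 0 < l} × ℕ)) :=
  Sum.elim
    (fun i => Seminorm.of (fun u => wsup ω i.1 i.2 u)
      (fun u v => wsup_add_le i.1.2 i.2 (u.toSchwartz.smooth ⊤) (v.toSchwartz.smooth ⊤)
        u.decay v.decay)
      (fun c u => wsup_smul ω i.1 i.2 c (u.toSchwartz.smooth ⊤)))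
    (fun i => Seminorm.of (fun u => wsup ω i.1 i.2 (ft u))
      (fun u v => by
        rw [Somega.ft_add]
        exact wsup_add_le i.1.2 i.2 (ft_smooth u.toSchwartz) (ft_smooth v.toSchwartz)
          u.decay_ft v.decay_ft)
      (fun c u => by
        rw [Somega.ft_smul]
        exact wsup_smul ω i.1 i.2 c (ft_smooth u.toSchwartz)))

noncomputable instance (ω : Weight) (d : ℕ) : TopologicalSpace (Somega ω d) :=
  (somegaSeminorms ω d).moduleFilterBasis.topology

theorem somega_withSeminorms (ω : Weight) (d : ℕ) : WithSeminorms (somegaSeminorms ω d) := by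
  have : Nonempty (({l : ℝ // 0 < l} × ℕ) ⊕ ({l : ℝ // 0 < l} × ℕ)) :=
    ⟨Sum.inl (⟨1, one_pos⟩, 0)⟩
  exact ⟨rfl⟩

instance (ω : Weight) (d : ℕ) : IsTopologicalAddGroup (Somega ω d) :=
  (somega_withSeminorms ω d).topologicalAddGroup

instance (ω : Weight) (d : ℕ) : ContinuousSMul ℂ (Somega ω d) :=
  (somega_withSeminorms ω d).continuousSMul

/-- `S'_ω(ℝ^d)`, with the strong dual topology: the continuous functionals on `S_ω`, written
through the conjugate-linear bracket `φ ↦ ⟨u, φ⟩` that extends the `L²` inner product. -/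
abbrev SomegaDual (ω : Weight) (d : ℕ) := Somega ω d →L⋆[ℂ] ℂ

/-- The pairing `g ↦ ∫ f \bar g` of two elements of `S_ω`, as a conjugate-linear map in `g`. -/
noncomputable def Somega.pairing {ω : Weight} {d : ℕ} (f : Somega ω d) :
    Somega ω d →ₗ⋆[ℂ] ℂ where
  toFun g := ∫ x, f x * star (g x)
  map_add' g h := by
    have hi : ∀ g : Somega ω d, Integrable (fun x => f x * star (g x)) := fun g =>
      f.toSchwartz.integrable.mul_bdd (c := (SchwartzMap.seminorm ℂ 0 0) g.toSchwartz)
        (g.toSchwartz.continuous.star).aestronglyMeasurable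
        (Eventually.of_forall fun x => by
          rw [norm_star]; exact SchwartzMap.norm_le_seminorm ℂ g.toSchwartz x)
    rw [← integral_add (hi g) (hi h)]
    simp only [Somega.coe_add, Pi.add_apply, star_add, mul_add]
  map_smul' c g := by
    simp only [Somega.coe_smul, Pi.smul_apply, smul_eq_mul, star_mul', starRingEnd_apply]
    rw [← integral_const_mul]
    congr 1
    funext x
    ring

theorem Somega.norm_pairing_le {ω : Weight} {d : ℕ} (f g : Somega ω d) :
    ‖f.pairing g‖ ≤ (∫ x, ‖f x‖) * somegaSeminorms ω d (Sum.inl (⟨1, one_pos⟩, 0)) g := by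
  change ‖∫ x, f x * star (g x)‖ ≤ _
  rw [← integral_mul_const]
  refine norm_integral_le_of_norm_le (f.toSchwartz.integrable.norm.mul_const _)
    (Eventually.of_forall fun x => ?_)
  rw [norm_mul, norm_star]
  refine mul_le_mul_of_nonneg_left ?_ (norm_nonneg _)
  have h1 : Real.exp (1 * ω ‖x‖) * ‖iteratedFDeriv ℝ 0 g x‖ ≤
      somegaSeminorms ω d (Sum.inl (⟨1, one_pos⟩, 0)) g := le_ciSup (g.decay 1 one_pos 0) x
  rw [norm_iteratedFDeriv_zero] at h1
  have h2 : (1 : ℝ) ≤ Real.exp (1 * ω ‖x‖) :=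
    Real.one_le_exp (by simpa using ω.nonneg _ (norm_nonneg x))
  exact (le_mul_of_one_le_left (norm_nonneg _) h2).trans h1

/-- The embedding `S_ω ⊆ S'_ω`, `⟨f, g⟩ = ∫ f \bar g`. -/
noncomputable def Somega.toDual {ω : Weight} {d : ℕ} (f : Somega ω d) : SomegaDual ω d where
  toLinearMap := f.pairing
  cont := by
    refine WithSeminorms.continuous_normedSpace_rng ℂ (somega_withSeminorms ω d) f.pairing
      ⟨{Sum.inl (⟨1, one_pos⟩, 0)}, ⟨∫ x, ‖f x‖, by positivity⟩, fun g => ?_⟩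
    rw [Finset.sup_singleton]
    exact f.norm_pairing_le g

/-! ### The short-time Fourier transform and the wave front set -/

/-- The phase-space shift `Π(z)φ(y) = e^{i⟨y,ξ⟩} φ(y - x)`, `z = (x, ξ)`, on Schwartz functions. -/
noncomputable def shiftSchwartz {d : ℕ} (z : Rd d × Rd d) (φ : 𝓢(Rd d, ℂ)) : 𝓢(Rd d, ℂ) :=
  SchwartzMap.smulLeftCLM ℂ (wave z.2) (SchwartzMap.compSubConstCLM ℂ z.1 φ)

theorem shiftSchwartz_apply {d : ℕ} (z : Rd d × Rd d) (φ : 𝓢(Rd d, ℂ)) (y : Rd d) :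
    shiftSchwartz z φ y = wave z.2 y * φ (y - z.1) := by
  simp [shiftSchwartz, SchwartzMap.smulLeftCLM_apply_apply (wave_temperate z.2)]

theorem ft_shiftSchwartz {d : ℕ} (z : Rd d × Rd d) (φ : 𝓢(Rd d, ℂ)) :
    ft (shiftSchwartz z φ) =
      wave z.2 z.1 • fun η => wave (-z.1) η * ft φ (η - z.2) := by
  funext η
  simp only [ft, shiftSchwartz_apply, Pi.smul_apply, smul_eq_mul]
  rw [← integral_add_right_eq_self _ z.1, ← integral_const_mul, ← integral_const_mul]
  congr 1
  funext y
  simp only [wave, ← mul_assoc, ← Complex.exp_add, add_sub_cancel_right]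
  congr 2
  simp only [inner_add_left, inner_sub_right, inner_neg_right, real_inner_comm z.1 η]
  push_cast
  ring

/-- `Π(z)` acting on `S_ω`. -/
noncomputable def Somega.shift {ω : Weight} {d : ℕ} (z : Rd d × Rd d) (φ : Somega ω d) :
    Somega ω d :=
  ⟨shiftSchwartz z φ.toSchwartz, by
    have hs : ContDiff ℝ (⊤ : ℕ∞) fun y => φ (y - z.1) :=
      (φ.toSchwartz.smooth ⊤).comp (contDiff_id.sub contDiff_const)
    have h := (φ.decay.translate z.1).modulate hs z.2
    have he : ((shiftSchwartz z φ.toSchwartz : 𝓢(Rd d, ℂ)) : Rd d → ℂ) =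
        fun y => wave z.2 y * φ (y - z.1) := funext (shiftSchwartz_apply z φ.toSchwartz)
    exact he ▸ h, by
    have hs : ContDiff ℝ (⊤ : ℕ∞) fun η => ft φ (η - z.2) :=
      (ft_smooth φ.toSchwartz).comp (contDiff_id.sub contDiff_const)
    rw [ft_shiftSchwartz]
    exact ((φ.decay_ft.translate z.2).modulate hs (-z.1)).smul ((wave_smooth _).mul hs) _⟩

theorem Somega.shift_apply {ω : Weight} {d : ℕ} (z : Rd d × Rd d) (φ : Somega ω d) (y : Rd d) :
    φ.shift z y = wave z.2 y * φ (y - z.1) := shiftSchwartz_apply z φ.toSchwartz y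

/-- The short-time Fourier transform `V_φ u(z) = ⟨u, Π(z)φ⟩`. -/
noncomputable def stft {ω : Weight} {d : ℕ} (φ : Somega ω d) (u : SomegaDual ω d)
    (z : Rd d × Rd d) : ℂ := u (φ.shift z)

/-- `Γ` is an open conic subset of `ℝ^{2d} ∖ {0}`. -/
def IsOpenConic {d : ℕ} (Γ : Set (Rd d × Rd d)) : Prop :=
  IsOpen Γ ∧ 0 ∉ Γ ∧ ∀ z ∈ Γ, ∀ t : ℝ, 0 < t → t • z ∈ Γ

/-- The `ω`-wave front set `WF'_ω(u)`, computed with the window `φ`. -/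
def waveFrontSet {ω : Weight} {d : ℕ} (φ : Somega ω d) (u : SomegaDual ω d) :
    Set (Rd d × Rd d) :=
  {z₀ | z₀ ≠ 0 ∧ ¬ ∃ Γ, IsOpenConic Γ ∧ z₀ ∈ Γ ∧ ∀ l : ℝ, 0 < l →
    BddAbove ((fun z => Real.exp (l * ω (phaseNorm z)) * ‖stft φ u z‖) '' Γ)}

/-- The conic support of a (continuous) function on phase space. -/
def conesupp {d : ℕ} (a : Rd d × Rd d → ℂ) : Set (Rd d × Rd d) :=
  {z | z ≠ 0 ∧ ∀ Γ, IsOpenConic Γ → z ∈ Γ → ¬ IsCompact (closure (tsupport a ∩ Γ))}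

/-! ### Symbols and the Kohn–Nirenberg quantization -/

/-- The mixed partial derivative `∂_{x_{j 1}} ⋯ ∂_{x_{j p}} ∂_{ξ_{i 1}} ⋯ ∂_{ξ_{i q}} a` at `z`.
For smooth `a` it is `∂_x^α ∂_ξ^β a`, where `α` and `β` count the entries of `j` and of `i`; every
pair of multi-indices with `|α| = p` and `|β| = q` arises so. -/
noncomputable def mixedPartial {d p q : ℕ} (j : Fin p → Fin d) (i : Fin q → Fin d)
    (a : Rd d × Rd d → ℂ) (z : Rd d × Rd d) : ℂ :=
  iteratedFDeriv ℝ (p + q) a z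
    (Fin.append (fun r => (EuclideanSpace.single (j r) (1 : ℝ), (0 : Rd d)))
      (fun r => ((0 : Rd d), EuclideanSpace.single (i r) (1 : ℝ))))

/-- The symbol class `S^m_ω`. -/
def IsSymbol {d : ℕ} (ω : Weight) (m : ℝ) (a : Rd d × Rd d → ℂ) : Prop :=
  ContDiff ℝ (⊤ : ℕ∞) a ∧
  ∀ l μ : ℝ, 0 < l → 0 < μ → ∃ C : ℝ, 0 < C ∧ ∀ (x ξ : Rd d) (p q : ℕ)
    (j : Fin p → Fin d) (i : Fin q → Fin d),
    ‖mixedPartial j i a (x, ξ)‖ ≤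
      C * Real.exp (l * ω.youngConj (p / l)) * Real.exp (μ * ω.youngConj (q / μ)) *
        Real.exp (m * ω ‖ξ‖)

/-- The Kohn–Nirenberg quantization
`a(x,D)f(x) = (2π)^{-d} ∫ e^{i⟨x,ξ⟩} a(x,ξ) \hat f(ξ) dξ`. -/
noncomputable def kohnNirenberg {d : ℕ} (a : Rd d × Rd d → ℂ) (f : Rd d → ℂ) (x : Rd d) : ℂ :=
  ((2 * Real.pi : ℝ) : ℂ)⁻¹ ^ d *
    ∫ ξ, Complex.exp (Complex.I * (inner ℝ x ξ : ℝ)) * a (x, ξ) * ft f ξ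

/-- The operator `A` on `S'_ω`, continuous for the strong topology, extends `a(x,D)`: for
`f ∈ S_ω`, the distribution `A f` is the function `a(x,D)f`. -/
def ExtendsKohnNirenberg {ω : Weight} {d : ℕ} (a : Rd d × Rd d → ℂ)
    (A : SomegaDual ω d →L[ℂ] SomegaDual ω d) : Prop :=
  ∀ f g : Somega ω d, Integrable (fun x => kohnNirenberg a f x * star (g x)) ∧
    A f.toDual g = ∫ x, kohnNirenberg a f x * star (g x)

end OmegaWF

/-! Everything is transported to phase space by the Gabor transform with the Gaussian window γ.
Write V u(z) = ⟨u, Π(z)γ⟩ and let ω(z) stand for the sum of the weights of the two components of z.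
On S_ω the transform decays faster than every e^{-lω}, and each seminorm of S_ω is bounded by a
weighted L¹ norm of V g (`exists_seminorm_le_integral_gabor`). On S'_ω the transform grows at most
like some e^{kω}, and c⟨u, g⟩ = ∫ V u · conj(V g) (`SomegaDual.inversion`).

The operator is governed by its matrix ⟨a(x,D)Π(w)γ, Π(z)γ⟩. This is an oscillatory integral with a
Gaussian cutoff: the x-derivatives of a give decay in the frequency component of w - z, the
ξ-derivatives give decay in its position component. Bounds on derivatives of all orders by
e^{lφ*(n/l)} become decay e^{-lω} by a quantitative form of φ** = φ (`Weight.exists_moment_le`).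
Geometric constants Bⁿ are harmless, since subadditivity bounds ω(Dt) by a multiple of ω(t) and l is
arbitrary. The result, `IsSymbol.exists_norm_knMatrix_le`, is decay off the diagonal at every rate l
with the fixed loss e^{|m|ω(w)}.

The extension is therefore ⟨a(x,D)u, g⟩ = c⁻¹ ∫ V u(w) ⟨a(x,D)Π(w)γ, g⟩ dw. It is strongly
continuous because the packets Π(w)γ, weighted by the supremum of the pairings over a bounded set of
g, again form a bounded set. It is unique because a strongly continuous functional on S'_ω is
integration of V u against a rapidly decreasing kernel, hence a superposition of its own values on
the packets, which lie in S_ω (`eq_zero_of_forall_toDual`).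

For the wave front set, let a vanish at the large points of a cone around z₀. For z in a smaller
cone the support of a is then far from z in proportion to |z|, up to a bounded set, and the
Gaussians alone make the matrix small, with a loss that grows in w - z
(`IsSymbol.exists_norm_knMatrix_le_of_support`). The geometric mean with the off-diagonal bound
removes this loss. Another shrinking of the cone replaces γ by an arbitrary window
(`exists_norm_stft_le`). -/

namespace OmegaWF

/-! ### Elementary properties of weights -/

namespace Weight

variable (ω : Weight)

/-- The summand `ω 0` serves the case k = 0, since a weight need not vanish at the origin. -/
theorem nsmul_le (k : ℕ) {t : ℝ} (ht : 0 ≤ t) : ω (k * t) ≤ k * ω t + ω 0 := by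
  induction k with
  | zero => simp
  | succ k ih =>
    have h := ω.subadd (k * t) t (by positivity) ht
    push_cast
    rw [add_mul, one_mul]
    linarith

/-- Subadditivity forces at most linear growth; this is why a Gaussian decays faster than every
e^{-lω}. -/
theorem le_linear {t : ℝ} (ht : 0 ≤ t) : ω t ≤ (t + 2) * ω 1 := by
  have h1 : ω t ≤ ω (⌈t⌉₊ * 1) :=
    ω.mono ht (by simp) (by simpa using Nat.le_ceil t)
  have h2 := ω.nsmul_le ⌈t⌉₊ zero_le_one
  have h3 : ω 0 ≤ ω 1 := ω.mono (by simp) (by simp) zero_le_one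
  have h4 : (⌈t⌉₊ : ℝ) ≤ t + 1 := (Nat.ceil_lt_add_one ht).le
  have h5 := ω.nonneg 1 zero_le_one
  nlinarith [mul_le_mul_of_nonneg_right h4 h5]

theorem norm_add_le {E : Type*} [SeminormedAddCommGroup E] (x y : E) :
    ω ‖x + y‖ ≤ ω ‖x‖ + ω ‖y‖ :=
  (ω.mono (norm_nonneg _) (by positivity : (0 : ℝ) ≤ ‖x‖ + ‖y‖) (_root_.norm_add_le x y)).trans
    (ω.subadd _ _ (norm_nonneg _) (norm_nonneg _))

theorem continuous_norm {E : Type*} [SeminormedAddCommGroup E] :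
    Continuous fun x : E => ω ‖x‖ :=
  ω.cont.comp_continuous _root_.continuous_norm fun x => norm_nonneg x

theorem exists_log_le (s : ℝ) (hs : 0 ≤ s) :
    ∃ C : ℝ, 0 ≤ C ∧ ∀ t, 1 ≤ t → s * Real.log t ≤ ω t + C := by
  -- The constant 1/(s + 1), rather than 1/s, includes s = 0.
  have h := (ω.log_isLittleO.def (c := (s + 1)⁻¹) (by positivity))
  obtain ⟨R, hR⟩ := (h.and (eventually_ge_atTop 1)).exists_forall_of_atTop
  refine ⟨s * Real.log (max R 1), mul_nonneg hs (Real.log_nonneg (le_max_right _ _)),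
    fun t ht => ?_⟩
  have h0 := ω.nonneg t (by linarith)
  have hl := Real.log_nonneg ht
  by_cases hRt : R ≤ t
  · have h1 := (hR t hRt).1
    rw [Real.norm_of_nonneg hl, Real.norm_of_nonneg h0, inv_mul_eq_div,
      le_div_iff₀ (by positivity)] at h1
    have : 0 ≤ s * Real.log (max R 1) := mul_nonneg hs (Real.log_nonneg (le_max_right _ _))
    nlinarith
  · have : Real.log t ≤ Real.log (max R 1) :=
      Real.log_le_log (by linarith) ((not_le.1 hRt).le.trans (le_max_left _ _))
    nlinarith

theorem one_add_pow_le (N : ℕ) : ∃ C : ℝ, 0 < C ∧ ∀ t, 0 ≤ t → (1 + t) ^ N ≤ C * Real.exp (ω t) := by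
  obtain ⟨C, hC, h⟩ := ω.exists_log_le N N.cast_nonneg
  refine ⟨Real.exp (C + ω 1), Real.exp_pos _, fun t ht => ?_⟩
  have h1 := h (1 + t) (by linarith)
  have h2 := ω.subadd 1 t zero_le_one ht
  rw [← Real.exp_add, ← Real.exp_log (show 0 < 1 + t by linarith), ← Real.exp_nat_mul]
  exact Real.exp_le_exp.2 (by linarith)

/-! ### The Young conjugate and the moments `e^{l φ*(n/l)}` -/

/-- A real supremum defaults to 0 on unbounded sets, so the conjugate carries information only once
boundedness is known. It comes from log t = o(ω(t)). -/
theorem bddAbove_youngConj (s : ℝ) (hs : 0 ≤ s) :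
    BddAbove ((fun t => t * s - ω (Real.exp t)) '' Ici 0) := by
  obtain ⟨C, -, h⟩ := ω.exists_log_le s hs
  refine ⟨C, ?_⟩
  rintro _ ⟨t, ht, rfl⟩
  have := h (Real.exp t) (Real.one_le_exp ht)
  rw [Real.log_exp] at this
  simp only
  linarith

theorem le_youngConj {s t : ℝ} (hs : 0 ≤ s) (ht : 0 ≤ t) :
    t * s - ω (Real.exp t) ≤ ω.youngConj s :=
  le_csSup (ω.bddAbove_youngConj s hs) ⟨t, ht, rfl⟩

theorem youngConj_le {s C : ℝ} (h : ∀ t, 0 ≤ t → t * s - ω (Real.exp t) ≤ C) :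
    ω.youngConj s ≤ C := by
  refine csSup_le ⟨_, 0, self_mem_Ici, rfl⟩ ?_
  rintro _ ⟨t, ht, rfl⟩
  exact h t ht

theorem youngConj_mono {s s' : ℝ} (hs : 0 ≤ s) (h : s ≤ s') : ω.youngConj s ≤ ω.youngConj s' :=
  ω.youngConj_le fun t ht => (by nlinarith : _ ≤ t * s' - ω (Real.exp t)).trans
    (ω.le_youngConj (hs.trans h) ht)

/-- For competitors t and t', the larger one competes for s + s'; the value of ω at the smaller one
is dropped, being nonnegative. The resulting inequality `moment_mul_le` is what closes Leibniz sums.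
-/
theorem youngConj_add_le {s s' : ℝ} (hs : 0 ≤ s) (hs' : 0 ≤ s') :
    ω.youngConj s + ω.youngConj s' ≤ ω.youngConj (s + s') := by
  rw [← le_sub_iff_add_le]
  refine ω.youngConj_le fun t ht => ?_
  rw [le_sub_comm]
  refine ω.youngConj_le fun t' ht' => ?_
  have h0 := ω.nonneg _ (Real.exp_pos t).le
  have h0' := ω.nonneg _ (Real.exp_pos t').le
  rcases le_total t t' with h | h
  · have := ω.le_youngConj (add_nonneg hs hs') ht'
    nlinarith
  · have := ω.le_youngConj (add_nonneg hs hs') ht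
    nlinarith

/-- The numbers `e^{l φ*(n/l)} = sup_{r ≥ 1} r^n e^{-l ω(r)}`. -/
noncomputable def moment (l : ℝ) (n : ℕ) : ℝ := Real.exp (l * ω.youngConj (n / l))

variable {l : ℝ}

theorem moment_pos (l : ℝ) (n : ℕ) : 0 < ω.moment l n := Real.exp_pos _

theorem moment_mono (hl : 0 < l) {n m : ℕ} (h : n ≤ m) : ω.moment l n ≤ ω.moment l m :=
  Real.exp_le_exp.2 (mul_le_mul_of_nonneg_left (ω.youngConj_mono (by positivity)
    (by gcongr)) hl.le)

theorem moment_mul_le (hl : 0 < l) (n m : ℕ) :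
    ω.moment l n * ω.moment l m ≤ ω.moment l (n + m) := by
  rw [moment, moment, ← Real.exp_add, ← mul_add]
  refine Real.exp_le_exp.2 (mul_le_mul_of_nonneg_left ?_ hl.le)
  rw [Nat.cast_add, add_div]
  exact ω.youngConj_add_le (by positivity) (by positivity)

theorem pow_le_moment (hl : 0 < l) (n : ℕ) {r : ℝ} (hr : 1 ≤ r) :
    r ^ n ≤ ω.moment l n * Real.exp (l * ω r) := by
  have h := ω.le_youngConj (s := n / l) (by positivity) (Real.log_nonneg hr)
  have h0 : 0 < r := by linarith
  rw [Real.exp_log h0] at h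
  have h2 := mul_le_mul_of_nonneg_left h hl.le
  rw [moment, ← Real.exp_add]
  nth_rewrite 1 [← Real.exp_log h0]
  rw [← Real.exp_nat_mul]
  refine Real.exp_le_exp.2 ?_
  have : l * (Real.log r * (n / l) - ω r) = n * Real.log r - l * ω r := by field_simp
  linarith

/-- The supremum behind the moments runs over r ≥ 1 only; below 1 the bound at r = 1 serves, at the
price of e^{lω(1)}. -/
theorem pow_le_moment' (hl : 0 < l) (n : ℕ) {r : ℝ} (hr : 0 ≤ r) :
    r ^ n ≤ Real.exp (l * ω 1) * ω.moment l n * Real.exp (l * ω r) := by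
  have h1 := ω.nonneg 1 zero_le_one
  rcases le_total 1 r with h | h
  · refine (ω.pow_le_moment hl n h).trans ?_
    rw [mul_assoc]
    exact le_mul_of_one_le_left (mul_pos (ω.moment_pos _ _) (Real.exp_pos _)).le
      (Real.one_le_exp (by positivity))
  · have h2 := ω.pow_le_moment hl n le_rfl
    have h3 : 1 ≤ Real.exp (l * ω r) := Real.one_le_exp (mul_nonneg hl.le (ω.nonneg r hr))
    calc r ^ n ≤ 1 ^ n := by gcongr
      _ ≤ _ := h2
      _ = Real.exp (l * ω 1) * ω.moment l n := mul_comm _ _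
      _ ≤ _ := le_mul_of_one_le_right (mul_pos (Real.exp_pos _) (ω.moment_pos _ _)).le h3

/-- A quantitative form of the biconjugate theorem `φ** = φ`. -/
theorem exists_moment_le (hl : 0 < l) {T : ℝ} (hT : 1 ≤ T) :
    ∃ n : ℕ, ω.moment l n ≤ Real.exp l * T ^ (n + 1) * Real.exp (-(l * ω T)) := by
  have hT0 : 0 < T := by linarith
  set t₀ := Real.log T with ht₀
  have ht₀0 : 0 ≤ t₀ := Real.log_nonneg hT
  set f : ℝ → ℝ := fun t => ω (Real.exp t) with hf
  have hfc : Continuous f := ω.cont.comp_continuous Real.continuous_exp fun x => (Real.exp_pos x).le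
  -- An affine minorant of φ that passes 1 below φ(t₀) replaces a tangent. The slack 1 is the origin
  -- of the factor e^l.
  obtain ⟨s, c, h1, h2⟩ := ω.convex_exp.exists_affine_le_of_lt_real (x := t₀) (a := f t₀ - 1)
    (mem_univ _) (by simp [hf]) isClosed_univ (hfc.lowerSemicontinuous.lowerSemicontinuousOn _)
  have h2' : s * t₀ + c = f t₀ - 1 := by simpa using h2
  have h1' : ∀ t, s * t + c ≤ f t := fun t => h1 t (mem_univ t)
  have hfT : f t₀ = ω T := by simp [hf, ht₀, Real.exp_log hT0]
  have hs : ∀ t, t * s - f t ≤ t₀ * s - f t₀ + 1 := fun t => by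
    have := h1' t; nlinarith
  -- The extremal exponent would be l times the slope. Rounding it down to an integer costs one more
  -- power of T.
  set n := ⌊l * max s 0⌋₊ with hn
  refine ⟨n, ?_⟩
  have hn1 : (n : ℝ) ≤ l * max s 0 := Nat.floor_le (by positivity)
  have hn2 : l * max s 0 < n + 1 := Nat.lt_floor_add_one _
  have h3 : ω.youngConj (n / l) ≤ t₀ * max s 0 - f t₀ + 1 := by
    refine (ω.youngConj_mono (by positivity) ((div_le_iff₀' hl).2 hn1)).trans
      (ω.youngConj_le fun t ht => ?_)
    rcases le_total s 0 with h | h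
    · rw [max_eq_right h]
      have h5 := h1' 0
      have h6 : f 0 ≤ f t := ω.mono (Real.exp_pos _).le (Real.exp_pos _).le (by gcongr)
      have h7 : s * t₀ ≤ 0 := mul_nonpos_of_nonpos_of_nonneg h ht₀0
      have : c ≤ f 0 := by linarith
      change t * 0 - f t ≤ _
      linarith
    · rw [max_eq_left h]
      exact hs t
  rw [moment, ← Real.exp_log hT0, ← Real.exp_nat_mul, ← Real.exp_add, ← Real.exp_add]
  refine Real.exp_le_exp.2 ?_
  have h4 := mul_le_mul_of_nonneg_left h3 hl.le
  rw [← ht₀, Real.exp_log hT0, ← hfT]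
  push_cast
  nlinarith [mul_le_mul_of_nonneg_right hn2.le ht₀0]

/-- Choosing the n of `exists_moment_le` and cancelling T^n leaves a single factor T. Through this
lemma bounds on derivatives of all orders become weighted decay of a Fourier transform. -/
theorem le_exp_neg_of_forall_moment (hl : 0 < l) {T F K : ℝ} (hT : 1 ≤ T) (hK : 0 ≤ K)
    (h : ∀ n : ℕ, T ^ n * F ≤ K * ω.moment l n) :
    F ≤ K * Real.exp l * T * Real.exp (-(l * ω T)) := by
  obtain ⟨n, hn⟩ := ω.exists_moment_le hl hT
  have hT0 : 0 < T ^ n := by positivity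
  refine le_of_mul_le_mul_left ((h n).trans ((mul_le_mul_of_nonneg_left hn hK).trans_eq ?_)) hT0
  ring

end Weight

end OmegaWF

namespace OmegaWF

/-! ### The Gaussian and its derivatives -/

theorem iteratedDeriv_cexp_mul_ofReal (c : ℂ) (n : ℕ) :
    iteratedDeriv n (fun t : ℝ => Complex.exp (c * t)) = fun t : ℝ => c ^ n * Complex.exp (c * t) := by
  induction n with
  | zero => simp
  | succ n ih =>
    rw [iteratedDeriv_succ, ih]
    funext t
    have h : HasDerivAt (fun t : ℝ => Complex.exp (c * t)) (Complex.exp (c * t) * (c * 1)) t :=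
      ((hasDerivAt_id _).ofReal_comp.const_mul c).cexp
    rw [(h.const_mul (c ^ n)).deriv]
    ring

theorem contDiff_cexp_mul_ofReal (c : ℂ) :
    ContDiff ℝ (⊤ : ℕ∞) fun t : ℝ => Complex.exp (c * t) :=
  Complex.contDiff_exp.comp (contDiff_const.mul Complex.ofRealCLM.contDiff)

theorem norm_iteratedFDeriv_cexp_inner_le {d : ℕ} (c : ℂ) (v y : Rd d) (n : ℕ) :
    ‖iteratedFDeriv ℝ n (fun y : Rd d => Complex.exp (c * (inner ℝ v y : ℝ))) y‖ ≤
      (‖c‖ * ‖v‖) ^ n * ‖Complex.exp (c * (inner ℝ v y : ℝ))‖ := by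
  have h := (innerSL ℝ v).iteratedFDeriv_comp_right (contDiff_cexp_mul_ofReal c) y (i := n)
    (by exact_mod_cast le_top)
  change ‖iteratedFDeriv ℝ n ((fun t : ℝ => Complex.exp (c * t)) ∘ (innerSL ℝ v)) y‖ ≤ _
  rw [h]
  refine (ContinuousMultilinearMap.norm_compContinuousLinearMap_le _ _).trans ?_
  rw [norm_iteratedFDeriv_eq_norm_iteratedDeriv, iteratedDeriv_cexp_mul_ofReal]
  simp only [innerSL_apply_norm, Finset.prod_const, Finset.card_univ, Fintype.card_fin,
    innerSL_apply_apply, norm_mul, norm_pow]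
  rw [mul_pow]
  exact le_of_eq (by ring)

theorem norm_iteratedFDeriv_wave_le {d : ℕ} (ξ y : Rd d) (n : ℕ) :
    ‖iteratedFDeriv ℝ n (wave ξ) y‖ ≤ ‖ξ‖ ^ n := by
  have h := norm_iteratedFDeriv_cexp_inner_le Complex.I ξ y n
  have e : (fun y : Rd d => Complex.exp (Complex.I * (inner ℝ ξ y : ℝ))) = wave ξ := by
    funext y; rw [wave, real_inner_comm]
  rw [e] at h
  have h1 : ‖Complex.exp (Complex.I * (inner ℝ ξ y : ℝ))‖ = 1 := by
    rw [mul_comm]; exact Complex.norm_exp_ofReal_mul_I _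
  simpa [h1] using h

/-- The Gaussian `e^{-|y|²/2}`. -/
noncomputable def gauss {d : ℕ} (y : Rd d) : ℂ := Complex.exp (-(1 / 2 : ℂ) * ‖y‖ ^ 2)

theorem gauss_eq_ofReal {d : ℕ} (y : Rd d) : gauss y = ((Real.exp (-(1 / 2) * ‖y‖ ^ 2) : ℝ) : ℂ) := by
  rw [gauss]; push_cast; rfl

theorem norm_gauss {d : ℕ} (y : Rd d) : ‖gauss y‖ = Real.exp (-(1 / 2) * ‖y‖ ^ 2) := by
  rw [gauss_eq_ofReal, Complex.norm_real, Real.norm_of_nonneg (Real.exp_pos _).le]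

theorem star_gauss {d : ℕ} (y : Rd d) : star (gauss y) = gauss y := by
  rw [gauss_eq_ofReal]; exact Complex.conj_ofReal _

theorem gauss_smooth {d : ℕ} : ContDiff ℝ (⊤ : ℕ∞) (gauss : Rd d → ℂ) := by
  have : (gauss : Rd d → ℂ) = fun y => Complex.exp (((-(1 / 2) * ‖y‖ ^ 2 : ℝ) : ℂ)) := by
    funext y; rw [gauss]; push_cast; rfl
  rw [this]
  exact Complex.contDiff_exp.comp (Complex.ofRealCLM.contDiff.comp
    (contDiff_const.mul (contDiff_norm_sq ℝ)))

theorem exists_exp_neg_sq_le (ω : Weight) {b : ℝ} (hb : 0 < b) (l : ℝ) :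
    ∃ C : ℝ, 0 < C ∧ ∀ t, 0 ≤ t → Real.exp (-b * t ^ 2) ≤ C * Real.exp (-(l * ω t)) := by
  set r := |l| * ω 1 with hr
  refine ⟨Real.exp (r ^ 2 / (4 * b) + 2 * r), Real.exp_pos _, fun t ht => ?_⟩
  rw [← Real.exp_add]
  refine Real.exp_le_exp.2 ?_
  have h1 := ω.le_linear ht
  have h2 : l * ω t ≤ r * (t + 2) := by
    have h3 := mul_le_mul_of_nonneg_left h1 (abs_nonneg l)
    have h4 := mul_le_mul_of_nonneg_right (le_abs_self l) (ω.nonneg t ht)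
    nlinarith
  -- Completing the square.
  have h5 : r * t - b * t ^ 2 ≤ r ^ 2 / (4 * b) := by
    rw [le_div_iff₀ (by positivity)]
    nlinarith [sq_nonneg (r - 2 * b * t)]
  linarith

theorem integrable_exp_neg_weight (ω : Weight) (d : ℕ) :
    Integrable fun x : Rd d => Real.exp (-ω ‖x‖) := by
  obtain ⟨C, hC, h⟩ := ω.one_add_pow_le (d + 1)
  have h1 : Integrable fun x : Rd d => (1 + ‖x‖) ^ (-((d + 1 : ℕ) : ℝ)) :=
    integrable_one_add_norm (by simp)
  refine (h1.const_mul C).mono' (Real.continuous_exp.comp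
    ω.continuous_norm.neg).aestronglyMeasurable (Eventually.of_forall fun x => ?_)
  have h2 := h ‖x‖ (norm_nonneg x)
  have h3 : 0 < (1 + ‖x‖) ^ (d + 1) := by positivity
  rw [Real.norm_of_nonneg (Real.exp_pos _).le, Real.rpow_neg (by positivity), Real.rpow_natCast,
    Real.exp_neg, ← div_eq_mul_inv, le_div_iff₀ h3, inv_mul_le_iff₀ (Real.exp_pos _)]
  linarith

/-- Derivatives of a Fourier transform are controlled by moments of the original function, and the
moments of a Gaussian are easy to compare with `moment`. The choice b = 2π² makes π²/b equal to 1/2.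
-/
theorem gauss_eq_fourier {d : ℕ} : ∃ (c b : ℂ), 0 < b.re ∧ b.im = 0 ∧ (gauss : Rd d → ℂ) =
    c • FourierTransform.fourier fun v : Rd d => Complex.exp (-b * ‖v‖ ^ 2) := by
  have hpi : (Real.pi : ℂ) ≠ 0 := by exact_mod_cast Real.pi_ne_zero
  have hb : 0 < (2 * Real.pi ^ 2 : ℂ).re := by
    have : (2 * Real.pi ^ 2 : ℂ) = ((2 * Real.pi ^ 2 : ℝ) : ℂ) := by push_cast; rfl
    rw [this, Complex.ofReal_re]
    positivity
  have h0 : ((Real.pi : ℂ) / (2 * Real.pi ^ 2)) ^ (Module.finrank ℝ (Rd d) / 2 : ℂ) ≠ 0 := by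
    intro h
    rw [Complex.cpow_eq_zero_iff] at h
    exact (div_ne_zero hpi (mul_ne_zero two_ne_zero (pow_ne_zero 2 hpi))) h.1
  refine ⟨(((Real.pi : ℂ) / (2 * Real.pi ^ 2)) ^ (Module.finrank ℝ (Rd d) / 2 : ℂ))⁻¹,
    2 * Real.pi ^ 2, hb, ?_, ?_⟩
  · have : (2 * Real.pi ^ 2 : ℂ) = ((2 * Real.pi ^ 2 : ℝ) : ℂ) := by push_cast; rfl
    rw [this, Complex.ofReal_im]
  · funext w
    rw [Pi.smul_apply, fourier_gaussian_innerProductSpace hb, smul_eq_mul, inv_mul_cancel_left₀ h0,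
      gauss]
    congr 1
    field_simp

/-- The k-th derivative is at most a constant times (2π)^k times moments of order up to k of another
Gaussian h. There |v|^k is at most a constant times `moment l k` times e^{lω(v)}, and h absorbs
e^{(l+1)ω(v)}, leaving an integrable factor. -/
theorem exists_norm_iteratedFDeriv_gauss_le (ω : Weight) (d : ℕ) {l : ℝ} (hl : 0 < l) :
    ∃ C : ℝ, 0 < C ∧ ∀ (k : ℕ) (y : Rd d),
      ‖iteratedFDeriv ℝ k gauss y‖ ≤ C * (4 * Real.pi) ^ k * ω.moment l k := by
  obtain ⟨c, b, hb, hbi, hg⟩ := gauss_eq_fourier (d := d)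
  set h : Rd d → ℂ := fun v => Complex.exp (-b * ‖v‖ ^ 2) with hh
  have hn : ∀ v, ‖h v‖ = Real.exp (-b.re * ‖v‖ ^ 2) := fun v => by
    rw [hh, Complex.norm_exp]
    congr 1
    have : -b * (‖v‖ : ℂ) ^ 2 = -b * ((‖v‖ ^ 2 : ℝ) : ℂ) := by push_cast; rfl
    rw [this, Complex.re_mul_ofReal, Complex.neg_re]
  have hc : Continuous h := by
    have : Continuous fun v : Rd d => (‖v‖ : ℂ) := Complex.continuous_ofReal.comp continuous_norm
    exact Complex.continuous_exp.comp (continuous_const.mul (this.pow 2))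
  obtain ⟨C₀, hC₀, h₀⟩ := exists_exp_neg_sq_le ω hb (l + 1)
  set C₁ := Real.exp (l * ω 1) * C₀ with hC₁
  have hbd : ∀ (k : ℕ) (v : Rd d), ‖v‖ ^ k * ‖iteratedFDeriv ℝ 0 h v‖ ≤
      C₁ * ω.moment l k * Real.exp (-ω ‖v‖) := fun k v => by
    rw [norm_iteratedFDeriv_zero, hn]
    calc _ ≤ (Real.exp (l * ω 1) * ω.moment l k * Real.exp (l * ω ‖v‖)) *
          (C₀ * Real.exp (-((l + 1) * ω ‖v‖))) := by
          have := ω.moment_pos l k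
          gcongr
          · exact ω.pow_le_moment' hl k (norm_nonneg v)
          · exact h₀ _ (norm_nonneg v)
      _ = C₁ * ω.moment l k * (Real.exp (l * ω ‖v‖) * Real.exp (-((l + 1) * ω ‖v‖))) := by
          rw [hC₁]; ring
      _ = _ := by rw [← Real.exp_add]; congr 2; ring
  have hi : ∀ k : ℕ, Integrable fun v => ‖v‖ ^ k * ‖iteratedFDeriv ℝ 0 h v‖ := fun k => by
    refine ((integrable_exp_neg_weight ω d).const_mul (C₁ * ω.moment l k)).mono' ?_
      (Eventually.of_forall fun v => ?_)
    · simp only [norm_iteratedFDeriv_zero]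
      exact ((continuous_norm.pow k).mul hc.norm).aestronglyMeasurable
    · rw [Real.norm_of_nonneg (by positivity)]
      exact hbd k v
  set I := ∫ v : Rd d, Real.exp (-ω ‖v‖) with hI
  have hI0 : 0 ≤ I := integral_nonneg fun v => (Real.exp_pos _).le
  have hle : ∀ k m : ℕ, m ≤ k → ∫ v, ‖v‖ ^ m * ‖iteratedFDeriv ℝ 0 h v‖ ≤ C₁ * ω.moment l k * I :=
    fun k m hm => by
      rw [hI, ← integral_const_mul]
      refine integral_mono (hi m) ((integrable_exp_neg_weight ω d).const_mul _) fun v => ?_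
      refine (hbd m v).trans ?_
      have := ω.moment_mono hl hm
      gcongr
  refine ⟨‖c‖ * C₁ * I + 1, by positivity, fun k y => ?_⟩
  have key := Real.pow_mul_norm_iteratedFDeriv_fourier_le (f := h) (K := ⊤) (N := 0)
    (contDiff_zero.2 hc) (fun k n _ hn' => by
      have : n = 0 := by simpa using hn'
      subst this; exact hi k) (k := k) (n := 0) le_top le_rfl y
  have hsm : ContDiff ℝ k (FourierTransform.fourier h) :=
    (Real.contDiff_fourier (N := ⊤) (f := h) fun n _ => by simpa using hi n).of_le
      (by exact_mod_cast le_top)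
  rw [hg, iteratedFDeriv_const_smul_apply hsm.contDiffAt, norm_smul]
  simp only [pow_zero, one_mul, mul_one, zero_add, Finset.range_one, Finset.sum_product,
    Finset.sum_singleton] at key
  have h2 : ∑ m ∈ Finset.range (k + 1), ∫ v, ‖v‖ ^ m * ‖iteratedFDeriv ℝ 0 h v‖ ≤
      2 ^ k * (C₁ * ω.moment l k * I) := by
    refine (Finset.sum_le_card_nsmul _ _ _ fun m hm => hle k m
      (Nat.lt_succ_iff.1 (Finset.mem_range.1 hm))).trans ?_
    rw [Finset.card_range, nsmul_eq_mul]
    -- The k + 1 terms of the sum are paid for by 2^k, which turns 2π into 4π.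
    have : ((k + 1 : ℕ) : ℝ) ≤ 2 ^ k := by exact_mod_cast Nat.lt_two_pow_self (n := k)
    have := ω.moment_pos l k
    gcongr
  calc _ ≤ ‖c‖ * ((2 * Real.pi) ^ k * (2 ^ k * (C₁ * ω.moment l k * I))) := by
        gcongr
        exact key.trans (mul_le_mul_of_nonneg_left h2 (by positivity))
    _ = (‖c‖ * C₁ * I) * (4 * Real.pi) ^ k * ω.moment l k := by
        have : (4 * Real.pi) ^ k = (2 * Real.pi) ^ k * 2 ^ k := by rw [← mul_pow]; congr 1; ring
        rw [this]; ring
    _ ≤ _ := by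
        have := ω.moment_pos l k
        gcongr
        linarith

/-- Decay in y comes from e^{-|s|²/2} = e^{-⟨v,s⟩} e^{|v|²/2} e^{-|s-v|²/2}, with v of length Lω(1)
in the direction of y: the first factor gives e^{-Lω(1)|y|} at s = y and its derivatives cost only
powers of |v|. The base B must not depend on l, because l is later chosen in terms of B. -/
theorem exists_norm_iteratedFDeriv_gauss_le_exp (ω : Weight) (d : ℕ) (L : ℝ) (hL : 0 ≤ L) :
    ∃ B : ℝ, 1 ≤ B ∧ ∀ l : ℝ, 0 < l → ∃ C : ℝ, 0 < C ∧ ∀ (k : ℕ) (y : Rd d),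
      ‖iteratedFDeriv ℝ k gauss y‖ ≤ C * B ^ k * ω.moment l k * Real.exp (-(L * ω ‖y‖)) := by
  set r := L * ω 1 with hr
  have hr0 : 0 ≤ r := mul_nonneg hL (ω.nonneg 1 zero_le_one)
  refine ⟨r + 4 * Real.pi, by linarith [Real.pi_gt_three], fun l hl => ?_⟩
  obtain ⟨C, hC, h⟩ := exists_norm_iteratedFDeriv_gauss_le ω d hl
  refine ⟨Real.exp (r ^ 2 / 2 + 2 * r) * C, by positivity, fun k y => ?_⟩
  obtain ⟨v, hv, hvy⟩ : ∃ v : Rd d, ‖v‖ ≤ r ∧ inner ℝ v y = r * ‖y‖ := by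
    rcases eq_or_ne y 0 with rfl | hy
    · exact ⟨0, by simpa using hr0, by simp⟩
    · have hy' : ‖y‖ ≠ 0 := by simpa using hy
      refine ⟨(r / ‖y‖) • y, ?_, ?_⟩
      · rw [norm_smul, Real.norm_of_nonneg (by positivity)]
        field_simp; rfl
      · rw [real_inner_smul_left, real_inner_self_eq_norm_sq]
        field_simp
  have hg : (gauss : Rd d → ℂ) = fun s => (Complex.exp ((-1 : ℂ) * (inner ℝ v s : ℝ))) *
      ((Complex.exp ((‖v‖ ^ 2 / 2 : ℝ) : ℂ)) • gauss (s - v)) := by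
    funext s
    rw [smul_eq_mul, gauss, gauss, ← Complex.exp_add, ← Complex.exp_add]
    congr 1
    have h1 : ((‖s - v‖ : ℂ)) ^ 2 = ((‖s‖ ^ 2 - 2 * inner ℝ v s + ‖v‖ ^ 2 : ℝ) : ℂ) := by
      rw [real_inner_comm, ← norm_sub_sq_real]; push_cast; rfl
    rw [h1]
    push_cast
    ring
  have hs1 : ContDiff ℝ (⊤ : ℕ∞) fun s : Rd d => Complex.exp ((-1 : ℂ) * (inner ℝ v s : ℝ)) :=
    (contDiff_cexp_mul_ofReal (-1)).comp (innerSL ℝ v).contDiff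
  have hs2 : ContDiff ℝ (⊤ : ℕ∞) fun s : Rd d => gauss (s - v) :=
    gauss_smooth.comp (contDiff_id.sub contDiff_const)
  have h1 := norm_iteratedFDeriv_mul_le (n := k) hs1
    (hs2.const_smul (Complex.exp ((‖v‖ ^ 2 / 2 : ℝ) : ℂ))) y (by exact_mod_cast le_top)
  rw [← hg] at h1
  refine h1.trans ?_
  have hm := ω.moment_pos l k
  have hterm : ∀ i ∈ Finset.range (k + 1), (k.choose i : ℝ) *
      ‖iteratedFDeriv ℝ i (fun s : Rd d => Complex.exp ((-1 : ℂ) * (inner ℝ v s : ℝ))) y‖ *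
      ‖iteratedFDeriv ℝ (k - i) (fun s => (Complex.exp ((‖v‖ ^ 2 / 2 : ℝ) : ℂ)) • gauss (s - v)) y‖
      ≤ (Real.exp (r ^ 2 / 2) * C * ω.moment l k * Real.exp (-(r * ‖y‖))) *
        (r ^ i * (4 * Real.pi) ^ (k - i) * (k.choose i : ℝ)) := by
    intro i hi
    have e1 : ‖iteratedFDeriv ℝ i (fun s : Rd d => Complex.exp ((-1 : ℂ) * (inner ℝ v s : ℝ))) y‖ ≤
        r ^ i * Real.exp (-(r * ‖y‖)) := by
      refine (norm_iteratedFDeriv_cexp_inner_le _ v y i).trans ?_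
      have : ‖Complex.exp ((-1 : ℂ) * (inner ℝ v y : ℝ))‖ = Real.exp (-(r * ‖y‖)) := by
        rw [Complex.norm_exp, hvy]; simp
      rw [this]
      gcongr
      simpa using hv
    have e2 : ‖iteratedFDeriv ℝ (k - i) (fun s => (Complex.exp ((‖v‖ ^ 2 / 2 : ℝ) : ℂ)) •
        gauss (s - v)) y‖ ≤ Real.exp (r ^ 2 / 2) * (C * (4 * Real.pi) ^ (k - i) * ω.moment l k) := by
      have := iteratedFDeriv_const_smul_apply (𝕜 := ℝ) (i := k - i) (x := y)
        (a := Complex.exp ((‖v‖ ^ 2 / 2 : ℝ) : ℂ))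
        (hs2.of_le (m := ((k - i : ℕ) : ℕ∞)) (by exact_mod_cast le_top)).contDiffAt
      change ‖iteratedFDeriv ℝ (k - i) (Complex.exp ((‖v‖ ^ 2 / 2 : ℝ) : ℂ) •
        fun s : Rd d => gauss (s - v)) y‖ ≤ _
      rw [this, norm_smul, iteratedFDeriv_comp_sub, ← Complex.ofReal_exp, Complex.norm_real,
        Real.norm_of_nonneg (Real.exp_pos _).le]
      gcongr
      exact (h _ _).trans (mul_le_mul_of_nonneg_left (ω.moment_mono hl (Nat.sub_le k i))
        (by positivity))
    calc _ ≤ (k.choose i : ℝ) * (r ^ i * Real.exp (-(r * ‖y‖))) *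
          (Real.exp (r ^ 2 / 2) * (C * (4 * Real.pi) ^ (k - i) * ω.moment l k)) := by gcongr
      _ = _ := by ring
  refine (Finset.sum_le_sum hterm).trans ?_
  rw [← Finset.mul_sum, ← add_pow]
  have h5 : Real.exp (-(r * ‖y‖)) ≤ Real.exp (2 * r) * Real.exp (-(L * ω ‖y‖)) := by
    rw [← Real.exp_add]
    refine Real.exp_le_exp.2 ?_
    have := mul_le_mul_of_nonneg_left (ω.le_linear (norm_nonneg y)) hL
    nlinarith
  calc _ ≤ (Real.exp (r ^ 2 / 2) * C * ω.moment l k * (Real.exp (2 * r) *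
        Real.exp (-(L * ω ‖y‖)))) * (r + 4 * Real.pi) ^ k := by gcongr
    _ = _ := by rw [Real.exp_add]; ring

end OmegaWF

namespace OmegaWF

/-! ### Derivatives of symbols and oscillatory integrals -/

/-- Expanding every argument in the standard basis gives dⁿ terms. Symbol estimates concern
coordinate directions only; the factor dⁿ is later absorbed by a dilation of the weight. -/
theorem norm_multilinear_le_of_basis {d n : ℕ}
    (L : ContinuousMultilinearMap ℝ (fun _ : Fin n => Rd d) ℂ) {A : ℝ} (hA : 0 ≤ A)
    (h : ∀ j : Fin n → Fin d, ‖L fun r => EuclideanSpace.single (j r) (1 : ℝ)‖ ≤ A) :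
    ‖L‖ ≤ (d : ℝ) ^ n * A := by
  refine ContinuousMultilinearMap.opNorm_le_bound (by positivity) fun v => ?_
  have hv : v = fun r => ∑ i, v r i • EuclideanSpace.single i (1 : ℝ) := by
    funext r
    ext k
    simp [Finset.sum_apply, Pi.single_apply]
  conv_lhs => rw [hv]
  rw [L.map_sum]
  refine (norm_sum_le _ _).trans ?_
  have hterm : ∀ j ∈ (Finset.univ : Finset (Fin n → Fin d)),
      ‖L fun r => v r (j r) • EuclideanSpace.single (j r) (1 : ℝ)‖ ≤ (∏ r, ‖v r‖) * A := by
    intro j _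
    rw [L.map_smul_univ (fun r => v r (j r)) fun r => EuclideanSpace.single (j r) (1 : ℝ),
      norm_smul, norm_prod]
    have : ∀ r, ‖v r (j r)‖ ≤ ‖v r‖ := fun r => PiLp.norm_apply_le (v r) (j r)
    exact mul_le_mul (Finset.prod_le_prod (fun r _ => norm_nonneg _) fun r _ => this r) (h j)
      (norm_nonneg _) (by positivity)
  refine (Finset.sum_le_card_nsmul _ _ _ hterm).trans (le_of_eq ?_)
  simp
  ring

theorem mixedPartial_zero_right {d n : ℕ} (j : Fin n → Fin d) (i : Fin 0 → Fin d)
    (a : Rd d × Rd d → ℂ) (z : Rd d × Rd d) :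
    mixedPartial j i a z = iteratedFDeriv ℝ n a z
      fun r => (EuclideanSpace.single (j r) (1 : ℝ), (0 : Rd d)) := by
  unfold mixedPartial
  congr 1
  funext r
  exact Fin.append_left _ _ r

theorem iteratedFDeriv_congr_order {E : Type*} [NormedAddCommGroup E] [NormedSpace ℝ E]
    (f : E → ℂ) (x : E) {n N : ℕ} (h : N = n) (v : Fin N → E) :
    iteratedFDeriv ℝ N f x v = iteratedFDeriv ℝ n f x fun r => v (Fin.cast h.symm r) := by
  subst h
  rfl

theorem mixedPartial_zero_left {d n : ℕ} (j : Fin 0 → Fin d) (i : Fin n → Fin d)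
    (a : Rd d × Rd d → ℂ) (z : Rd d × Rd d) :
    mixedPartial j i a z = iteratedFDeriv ℝ n a z
      fun r => ((0 : Rd d), EuclideanSpace.single (i r) (1 : ℝ)) := by
  unfold mixedPartial
  rw [iteratedFDeriv_congr_order a z (Nat.zero_add n)]
  congr 1
  funext r
  have : Fin.cast (Nat.zero_add n).symm r = Fin.natAdd 0 r := by ext; simp
  rw [this]
  exact Fin.append_right _ _ r

theorem iteratedFDeriv_comp_affine {E F : Type*} [NormedAddCommGroup E] [NormedSpace ℝ E]
    [NormedAddCommGroup F] [NormedSpace ℝ F] {a : F → ℂ} (ha : ContDiff ℝ (⊤ : ℕ∞) a) (g : E →L[ℝ] F)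
    (c : F) (n : ℕ) (x : E) (v : Fin n → E) :
    iteratedFDeriv ℝ n (fun s => a (g s + c)) x v =
      iteratedFDeriv ℝ n a (g x + c) fun r => g (v r) := by
  have h := g.iteratedFDeriv_comp_right (f := fun y => a (y + c))
    (ha.comp (contDiff_id.add contDiff_const)) x (i := n) (by exact_mod_cast le_top)
  have h' : (fun s => a (g s + c)) = (fun y => a (y + c)) ∘ g := rfl
  rw [h', h, ContinuousMultilinearMap.compContinuousLinearMap_apply, iteratedFDeriv_comp_add_right]

/-- Only pure x-derivatives and pure ξ-derivatives are ever needed; the moment of order zero in the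
other variable goes into the constant. With |m| in place of m, the growth factor is monotone in the
weight and can be moved between points. -/
theorem IsSymbol.exists_bound {d : ℕ} {ω : Weight} {m : ℝ} {a : Rd d × Rd d → ℂ}
    (ha : IsSymbol ω m a) {l : ℝ} (hl : 0 < l) : ∃ C : ℝ, 0 < C ∧ ∀ (x ξ : Rd d) (n : ℕ),
      ‖iteratedFDeriv ℝ n (fun s => a (s, ξ)) x‖ ≤
        C * Real.exp (|m| * ω ‖ξ‖) * (d : ℝ) ^ n * ω.moment l n ∧
      ‖iteratedFDeriv ℝ n (fun η => a (x, η)) ξ‖ ≤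
        C * Real.exp (|m| * ω ‖ξ‖) * (d : ℝ) ^ n * ω.moment l n := by
  obtain ⟨C, hC, h⟩ := ha.2 l l hl hl
  have hm0 := ω.moment_pos l 0
  refine ⟨C * ω.moment l 0, by positivity, fun x ξ n => ?_⟩
  have hmn := ω.moment_pos l n
  have hle : Real.exp (m * ω ‖ξ‖) ≤ Real.exp (|m| * ω ‖ξ‖) :=
    Real.exp_le_exp.2 (mul_le_mul_of_nonneg_right (le_abs_self m) (ω.nonneg _ (norm_nonneg _)))
  have hfin : (d : ℝ) ^ n * (C * ω.moment l n * ω.moment l 0 * Real.exp (|m| * ω ‖ξ‖)) =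
      C * ω.moment l 0 * Real.exp (|m| * ω ‖ξ‖) * (d : ℝ) ^ n * ω.moment l n := by ring
  rw [← hfin]
  constructor
  · refine norm_multilinear_le_of_basis _ (by positivity) fun j => ?_
    have e := iteratedFDeriv_comp_affine ha.1 (ContinuousLinearMap.inl ℝ (Rd d) (Rd d)) (0, ξ) n x
      fun r => EuclideanSpace.single (j r) (1 : ℝ)
    simp only [ContinuousLinearMap.inl_apply, Prod.mk_add_mk, add_zero, zero_add] at e
    rw [e, ← mixedPartial_zero_right j (fun r => r.elim0)]
    refine (h x ξ n 0 j fun r => r.elim0).trans ?_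
    unfold Weight.moment
    gcongr
  · refine norm_multilinear_le_of_basis _ (by positivity) fun j => ?_
    have e := iteratedFDeriv_comp_affine ha.1 (ContinuousLinearMap.inr ℝ (Rd d) (Rd d)) (x, 0) n ξ
      fun r => EuclideanSpace.single (j r) (1 : ℝ)
    simp only [ContinuousLinearMap.inr_apply, Prod.mk_add_mk, add_zero, zero_add] at e
    rw [e, ← mixedPartial_zero_left (fun r => r.elim0) j]
    refine (h x ξ 0 n (fun r => r.elim0) j).trans ?_
    rw [mul_right_comm C]
    unfold Weight.moment
    gcongr

theorem IsSymbol.norm_le {d : ℕ} {ω : Weight} {m : ℝ} {a : Rd d × Rd d → ℂ}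
    (ha : IsSymbol ω m a) : ∃ C : ℝ, 0 < C ∧ ∀ x ξ : Rd d,
      ‖a (x, ξ)‖ ≤ C * Real.exp (|m| * ω ‖ξ‖) := by
  obtain ⟨C, hC, h⟩ := ha.exists_bound one_pos
  refine ⟨C * ω.moment 1 0, mul_pos hC (ω.moment_pos _ _), fun x ξ => ?_⟩
  have := (h x ξ 0).1
  rw [norm_iteratedFDeriv_zero, pow_zero, mul_one] at this
  linarith

theorem ft_eq_fourier_apply {d : ℕ} (f : Rd d → ℂ) (ξ : Rd d) :
    ft f ξ = FourierTransform.fourier f ((2 * Real.pi)⁻¹ • ξ) := by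
  rw [Real.fourier_eq', ft]
  congr 1
  funext x
  rw [smul_eq_mul, inner_smul_right]
  congr 2
  have : (Real.pi : ℂ) ≠ 0 := by exact_mod_cast Real.pi_ne_zero
  push_cast
  field_simp

theorem Weight.le_mul_ceil (ω : Weight) {D T : ℝ} (hT : 0 ≤ T) :
    ω (D * T) ≤ ⌈D⌉₊ * ω T + ω 0 ∨ D < 0 := by
  by_cases hD : D < 0
  · exact Or.inr hD
  · left
    refine (ω.mono (mul_nonneg (not_lt.1 hD) hT) (by positivity : (0 : ℝ) ≤ ⌈D⌉₊ * T) ?_).trans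
      (ω.nsmul_le _ hT)
    gcongr
    exact Nat.le_ceil D

/-- A bounded family of ultradifferentiable amplitudes, localized by a Gaussian, has a rapidly
decaying Fourier transform. -/
theorem exists_ft_mul_gauss_le (ω : Weight) (d : ℕ) {M : ℝ} (hM : 0 ≤ M) {l' : ℝ} (hl' : 0 < l') :
    ∃ l : ℝ, 0 < l ∧ ∃ K : ℝ, 0 < K ∧ ∀ (b : Rd d → ℂ) (A : ℝ), 0 ≤ A →
      ContDiff ℝ (⊤ : ℕ∞) b →
      (∀ n s, ‖iteratedFDeriv ℝ n b s‖ ≤ A * Real.exp (M * ω ‖s‖) * (d : ℝ) ^ n * ω.moment l n) →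
      ∀ c ζ : Rd d, ‖ft (fun s => b s * gauss (s - c)) ζ‖ ≤
        K * A * Real.exp (M * ω ‖c‖) * Real.exp (-(l' * ω ‖ζ‖)) := by
  -- Of the decay M + 1, the part M moves the growth of the amplitude from s to c, and the part 1 is
  -- left for integration.
  obtain ⟨B, hB, hgauss⟩ := exists_norm_iteratedFDeriv_gauss_le_exp ω d (M + 1) (by linarith)
  -- D collects everything that grows geometrically in n: d from the amplitude and B from the
  -- Gaussian through the Leibniz rule, 2π from the normalization, a 2 from the Fourier estimate and
  -- a 2 from its n + 1 summands.
  set D : ℝ := 8 * Real.pi * (d + B) with hD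
  have hdB : 1 ≤ (d : ℝ) + B := by have : (0 : ℝ) ≤ d := d.cast_nonneg; linarith
  have hD1 : 1 ≤ D := by nlinarith [Real.pi_gt_three]
  have hD0 : 0 < D := by linarith
  -- The factor ⌈D⌉ compensates the dilation by D. The extra 1 absorbs the surplus factor T, which
  -- is at most a constant times e^{ω(T)}.
  set l : ℝ := l' * ⌈D⌉₊ + 1 with hl
  have hl0 : 0 < l := by positivity
  obtain ⟨C, hC, hg⟩ := hgauss l hl0
  obtain ⟨C₁, hC₁, h₁⟩ := ω.one_add_pow_le 1
  set I := ∫ v : Rd d, Real.exp (-ω ‖v‖) with hI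
  have hI0 : 0 ≤ I := integral_nonneg fun v => (Real.exp_pos _).le
  set K₀ := C * (I + 1) with hK₀
  have hm0 := ω.moment_pos l 0
  have hK₀0 : 0 < K₀ := by positivity
  refine ⟨l, hl0, K₀ * Real.exp l * C₁ * Real.exp (l' * ω 0) +
    K₀ * ω.moment l 0 * Real.exp (l' * ω D), by positivity, fun b A hA hb hbd c ζ => ?_⟩
  set F : Rd d → ℂ := fun s => b s * gauss (s - c) with hF
  have hgc : ContDiff ℝ (⊤ : ℕ∞) fun s : Rd d => gauss (s - c) :=
    gauss_smooth.comp (contDiff_id.sub contDiff_const)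
  have hFs : ContDiff ℝ (⊤ : ℕ∞) F := hb.mul hgc
  set P := A * Real.exp (M * ω ‖c‖) with hP
  have hP0 : 0 ≤ P := by positivity
  have hFn : ∀ n s, ‖iteratedFDeriv ℝ n F s‖ ≤
      P * C * (d + B) ^ n * ω.moment l n * Real.exp (-ω ‖s - c‖) := by
    intro n s
    refine (norm_iteratedFDeriv_mul_le hb hgc s (n := n) (by exact_mod_cast le_top)).trans ?_
    have hexp : Real.exp (M * ω ‖s‖) * Real.exp (-((M + 1) * ω ‖s - c‖)) ≤
        Real.exp (M * ω ‖c‖) * Real.exp (-ω ‖s - c‖) := by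
      rw [← Real.exp_add, ← Real.exp_add]
      refine Real.exp_le_exp.2 ?_
      have := ω.norm_add_le c (s - c)
      rw [add_sub_cancel] at this
      nlinarith
    have hterm : ∀ i ∈ Finset.range (n + 1), (n.choose i : ℝ) * ‖iteratedFDeriv ℝ i b s‖ *
        ‖iteratedFDeriv ℝ (n - i) (fun s => gauss (s - c)) s‖ ≤
        (P * C * ω.moment l n * Real.exp (-ω ‖s - c‖)) *
          ((d : ℝ) ^ i * B ^ (n - i) * (n.choose i : ℝ)) := by
      intro i hi
      have hin : i + (n - i) = n := by have := Finset.mem_range.1 hi; omega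
      have hmm := ω.moment_mul_le hl0 i (n - i)
      rw [hin] at hmm
      rw [iteratedFDeriv_comp_sub]
      have := ω.moment_pos l i
      have := ω.moment_pos l (n - i)
      calc _ ≤ (n.choose i : ℝ) * (A * Real.exp (M * ω ‖s‖) * (d : ℝ) ^ i * ω.moment l i) *
            (C * B ^ (n - i) * ω.moment l (n - i) * Real.exp (-((M + 1) * ω ‖s - c‖))) := by
            gcongr
            · exact hbd i s
            · exact hg (n - i) (s - c)
        _ = (A * C * ((d : ℝ) ^ i * B ^ (n - i) * (n.choose i : ℝ))) *
            ((ω.moment l i * ω.moment l (n - i)) *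
              (Real.exp (M * ω ‖s‖) * Real.exp (-((M + 1) * ω ‖s - c‖)))) := by ring
        _ ≤ (A * C * ((d : ℝ) ^ i * B ^ (n - i) * (n.choose i : ℝ))) *
            (ω.moment l n * (Real.exp (M * ω ‖c‖) * Real.exp (-ω ‖s - c‖))) := by
            have := ω.moment_pos l n
            gcongr
        _ = _ := by rw [hP]; ring
    refine (Finset.sum_le_sum hterm).trans (le_of_eq ?_)
    rw [← Finset.mul_sum, ← add_pow]
    ring
  have hint : Integrable fun s : Rd d => Real.exp (-ω ‖s - c‖) :=
    (integrable_exp_neg_weight ω d).comp_sub_right c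
  have hint' : ∫ s : Rd d, Real.exp (-ω ‖s - c‖) = I :=
    integral_sub_right_eq_self (fun s : Rd d => Real.exp (-ω ‖s‖)) c
  have hFi : ∀ n, Integrable fun s => ‖iteratedFDeriv ℝ n F s‖ := fun n =>
    (hint.const_mul (P * C * (d + B) ^ n * ω.moment l n)).mono'
      (hFs.continuous_iteratedFDeriv (by exact_mod_cast le_top)).norm.aestronglyMeasurable
      (Eventually.of_forall fun s => by rw [norm_norm]; exact hFn n s)
  have hFI : ∀ n k : ℕ, k ≤ n → ∫ s, ‖iteratedFDeriv ℝ k F s‖ ≤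
      P * C * (d + B) ^ n * ω.moment l n * I := by
    intro n k hk
    rw [← hint', ← integral_const_mul]
    refine integral_mono (hFi k) (hint.const_mul _) fun s => (hFn k s).trans ?_
    have := ω.moment_mono hl0 hk
    have := ω.moment_pos l k
    gcongr
  have key : ∀ n : ℕ, (‖ζ‖ / D) ^ n * ‖ft F ζ‖ ≤ (K₀ * P) * ω.moment l n := by
    intro n
    have h := Real.pow_mul_norm_iteratedFDeriv_fourier_le (f := F) (K := 0) (N := ⊤) hFs
      (fun k n hk _ => by
        have : k = 0 := by simpa using hk
        subst this
        simpa using hFi n) (k := 0) (n := n) le_rfl le_top ((2 * Real.pi)⁻¹ • ζ)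
    rw [norm_iteratedFDeriv_zero, ← ft_eq_fourier_apply, norm_smul] at h
    simp only [pow_zero, one_mul, zero_add, Finset.range_one, Finset.sum_product,
      Finset.sum_singleton, Nat.cast_zero, mul_zero] at h
    have h2 : ∑ k ∈ Finset.range (n + 1), ∫ s, ‖iteratedFDeriv ℝ k F s‖ ≤
        2 ^ n * (P * C * (d + B) ^ n * ω.moment l n * I) := by
      refine (Finset.sum_le_card_nsmul _ _ _ fun m hm => hFI n m
        (Nat.lt_succ_iff.1 (Finset.mem_range.1 hm))).trans ?_
      rw [Finset.card_range, nsmul_eq_mul]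
      have : ((n + 1 : ℕ) : ℝ) ≤ 2 ^ n := by exact_mod_cast Nat.lt_two_pow_self (n := n)
      have := ω.moment_pos l n
      gcongr
    have h3 := h.trans (mul_le_mul_of_nonneg_left h2 (by positivity))
    rw [Real.norm_of_nonneg (by positivity), inv_mul_eq_div, div_pow, div_mul_eq_mul_div,
      div_le_iff₀ (by positivity)] at h3
    rw [div_pow, div_mul_eq_mul_div, div_le_iff₀ (by positivity)]
    refine h3.trans ?_
    have e : D ^ n = 2 ^ n * 2 ^ n * (d + B) ^ n * (2 * Real.pi) ^ n := by
      rw [← mul_pow, ← mul_pow, ← mul_pow, hD]; congr 1; ring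
    rw [e, hK₀]
    have := ω.moment_pos l n
    have : P * C * (d + B) ^ n * ω.moment l n * I ≤ P * C * (d + B) ^ n * ω.moment l n * (I + 1) := by
      gcongr; linarith
    calc _ ≤ 2 ^ n * (2 ^ n * (P * C * (d + B) ^ n * ω.moment l n * (I + 1))) * (2 * Real.pi) ^ n := by
          gcongr
      _ = _ := by ring
  have hω0 := ω.nonneg 0 le_rfl
  -- The moment argument needs |ζ|/D ≥ 1; on the remaining ball the case n = 0 suffices.
  rcases le_total D ‖ζ‖ with h | h
  · have hT : 1 ≤ ‖ζ‖ / D := by rwa [le_div_iff₀ hD0, one_mul]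
    have h4 := ω.le_exp_neg_of_forall_moment hl0 hT (by positivity) key
    set T := ‖ζ‖ / D with hTdef
    have h5 : T ≤ C₁ * Real.exp (ω T) := by
      have := h₁ T (by linarith)
      rw [pow_one] at this
      linarith
    have h6 : ω ‖ζ‖ ≤ ⌈D⌉₊ * ω T + ω 0 := by
      have := (ω.le_mul_ceil (D := D) (T := T) (by linarith)).resolve_right (by linarith)
      rwa [hTdef, mul_div_cancel₀ _ hD0.ne'] at this
    have h7 : Real.exp (ω T) * Real.exp (-(l * ω T)) ≤
        Real.exp (l' * ω 0) * Real.exp (-(l' * ω ‖ζ‖)) := by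
      rw [← Real.exp_add, ← Real.exp_add]
      refine Real.exp_le_exp.2 ?_
      have := mul_le_mul_of_nonneg_left h6 hl'.le
      rw [hl]
      nlinarith
    calc ‖ft F ζ‖ ≤ K₀ * P * Real.exp l * T * Real.exp (-(l * ω T)) := h4
      _ ≤ K₀ * P * Real.exp l * (C₁ * Real.exp (ω T)) * Real.exp (-(l * ω T)) := by gcongr
      _ = K₀ * P * Real.exp l * C₁ * (Real.exp (ω T) * Real.exp (-(l * ω T))) := by ring
      _ ≤ K₀ * P * Real.exp l * C₁ * (Real.exp (l' * ω 0) * Real.exp (-(l' * ω ‖ζ‖))) := by gcongr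
      _ = (K₀ * Real.exp l * C₁ * Real.exp (l' * ω 0)) * P * Real.exp (-(l' * ω ‖ζ‖)) := by ring
      _ ≤ (K₀ * Real.exp l * C₁ * Real.exp (l' * ω 0) + K₀ * ω.moment l 0 * Real.exp (l' * ω D)) *
          P * Real.exp (-(l' * ω ‖ζ‖)) := by
          gcongr
          exact le_add_of_nonneg_right (by positivity)
      _ = _ := by rw [hP]; ring
  · have h4 := key 0
    rw [pow_zero, one_mul] at h4
    have h5 : 1 ≤ Real.exp (l' * ω D) * Real.exp (-(l' * ω ‖ζ‖)) := by
      rw [← Real.exp_add]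
      refine Real.one_le_exp ?_
      have := mul_le_mul_of_nonneg_left (ω.mono (norm_nonneg ζ) hD0.le h) hl'.le
      linarith
    calc ‖ft F ζ‖ ≤ K₀ * P * ω.moment l 0 := h4
      _ ≤ K₀ * P * ω.moment l 0 * (Real.exp (l' * ω D) * Real.exp (-(l' * ω ‖ζ‖))) :=
          le_mul_of_one_le_right (by positivity) h5
      _ = (K₀ * ω.moment l 0 * Real.exp (l' * ω D)) * P * Real.exp (-(l' * ω ‖ζ‖)) := by ring
      _ ≤ (K₀ * Real.exp l * C₁ * Real.exp (l' * ω 0) + K₀ * ω.moment l 0 * Real.exp (l' * ω D)) *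
          P * Real.exp (-(l' * ω ‖ζ‖)) := by
          gcongr
          exact le_add_of_nonneg_left (by positivity)
      _ = _ := by rw [hP]; ring

end OmegaWF

namespace OmegaWF

/-! ### The weight on phase space -/

/-- The weight `ω(x) + ω(ξ)` on phase space, equivalent to `ω(|(x, ξ)|)`. -/
noncomputable def Weight.phase (ω : Weight) {d : ℕ} (z : Rd d × Rd d) : ℝ := ω ‖z.1‖ + ω ‖z.2‖

section Phase

variable (ω : Weight) {d : ℕ}

theorem Weight.phase_nonneg (z : Rd d × Rd d) : 0 ≤ ω.phase z :=
  add_nonneg (ω.nonneg _ (norm_nonneg _)) (ω.nonneg _ (norm_nonneg _))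

theorem Weight.phase_add_le (z w : Rd d × Rd d) : ω.phase (z + w) ≤ ω.phase z + ω.phase w := by
  have h1 := ω.norm_add_le z.1 w.1
  have h2 := ω.norm_add_le z.2 w.2
  simp only [Weight.phase, Prod.fst_add, Prod.snd_add]
  linarith

theorem Weight.phase_neg (z : Rd d × Rd d) : ω.phase (-z) = ω.phase z := by
  simp [Weight.phase]

theorem Weight.phase_sub_comm (z w : Rd d × Rd d) : ω.phase (z - w) = ω.phase (w - z) := by
  rw [← ω.phase_neg, neg_sub]

theorem Weight.phase_le_sub_add (z w : Rd d × Rd d) : ω.phase z ≤ ω.phase (z - w) + ω.phase w := by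
  simpa using ω.phase_add_le (z - w) w

theorem Weight.continuous_phase : Continuous (ω.phase : Rd d × Rd d → ℝ) :=
  (ω.continuous_norm.comp continuous_fst).add (ω.continuous_norm.comp continuous_snd)

theorem Weight.phaseNorm_le_phase (z : Rd d × Rd d) : ω (phaseNorm z) ≤ ω.phase z := by
  refine (ω.mono (Real.sqrt_nonneg _) (by positivity : (0 : ℝ) ≤ ‖z.1‖ + ‖z.2‖) ?_).trans
    (ω.subadd _ _ (norm_nonneg _) (norm_nonneg _))
  refine Real.sqrt_le_iff.2 ⟨by positivity, ?_⟩
  nlinarith [norm_nonneg z.1, norm_nonneg z.2]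

theorem Weight.phase_le_norm (z : Rd d × Rd d) : ω.phase z ≤ 2 * ω ‖z‖ := by
  have h1 := ω.mono (norm_nonneg _) (norm_nonneg z) (norm_fst_le z)
  have h2 := ω.mono (norm_nonneg _) (norm_nonneg z) (norm_snd_le z)
  simp only [Weight.phase]
  linarith

theorem Weight.norm_le_phase (z : Rd d × Rd d) : ω ‖z‖ ≤ ω.phase z := by
  have h1 := ω.nonneg _ (norm_nonneg z.1)
  have h2 := ω.nonneg _ (norm_nonneg z.2)
  rw [Prod.norm_def, Weight.phase]
  rcases max_cases ‖z.1‖ ‖z.2‖ with h | h <;> rw [h.1] <;> linarith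

theorem Weight.integrable_exp_neg_phase (d : ℕ) :
    Integrable fun z : Rd d × Rd d => Real.exp (-ω.phase z) := by
  have h := (integrable_exp_neg_weight ω d).mul_prod (integrable_exp_neg_weight ω d)
  refine h.congr (Eventually.of_forall fun z => ?_)
  simp only [Weight.phase]
  rw [← Real.exp_add]
  congr 1
  ring

end Phase

/-! ### Gaussian wave packets -/

theorem ft_gauss (d : ℕ) : ∃ κ : ℂ, κ ≠ 0 ∧ ∀ ξ : Rd d, ft gauss ξ = κ * gauss ξ := by
  have hb : 0 < (1 / 2 : ℂ).re := by norm_num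
  have hpi : (Real.pi : ℂ) ≠ 0 := by exact_mod_cast Real.pi_ne_zero
  refine ⟨((Real.pi : ℂ) / (1 / 2)) ^ (Module.finrank ℝ (Rd d) / 2 : ℂ), ?_, fun ξ => ?_⟩
  · intro h
    rw [Complex.cpow_eq_zero_iff] at h
    exact (div_ne_zero hpi (by norm_num)) h.1
  · rw [ft_eq_fourier_apply]
    refine (fourier_gaussian_innerProductSpace hb _).trans ?_
    rw [norm_smul, Real.norm_of_nonneg (by positivity), gauss]
    congr 2
    push_cast
    field_simp

theorem wdecay_gauss (ω : Weight) (d : ℕ) : WDecay ω (gauss : Rd d → ℂ) := by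
  intro l hl n
  obtain ⟨B, hB, h⟩ := exists_norm_iteratedFDeriv_gauss_le_exp ω d l hl.le
  obtain ⟨C, hC, h⟩ := h 1 one_pos
  refine ⟨C * B ^ n * ω.moment 1 n, ?_⟩
  rintro _ ⟨y, rfl⟩
  simp only
  rw [mul_comm, ← le_div_iff₀ (Real.exp_pos _), div_eq_mul_inv, ← Real.exp_neg]
  exact h n y

/-- The Gaussian as a Schwartz function. -/
noncomputable def gaussSchwartz (ω : Weight) (d : ℕ) : 𝓢(Rd d, ℂ) where
  toFun := gauss
  smooth' := gauss_smooth
  decay' := fun k n => by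
    obtain ⟨C, hC, h⟩ := ω.one_add_pow_le k
    obtain ⟨A, hA⟩ := wdecay_gauss ω d 1 one_pos n
    refine ⟨C * A, fun x => ?_⟩
    have h1 := hA (mem_range_self x)
    have h2 := h ‖x‖ (norm_nonneg x)
    simp only [one_mul] at h1
    calc _ ≤ (C * Real.exp (ω ‖x‖)) * ‖iteratedFDeriv ℝ n gauss x‖ := by
          gcongr
          exact (pow_le_pow_left₀ (norm_nonneg x) (by linarith [norm_nonneg x]) k).trans h2
      _ ≤ _ := by rw [mul_assoc]; gcongr

/-- The Gaussian as an element of `S_ω`. -/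
noncomputable def gaussS (ω : Weight) (d : ℕ) : Somega ω d :=
  ⟨gaussSchwartz ω d, wdecay_gauss ω d, by
    obtain ⟨κ, -, hκ⟩ := ft_gauss d
    have : ft (gaussSchwartz ω d) = κ • (gauss : Rd d → ℂ) := funext hκ
    rw [this]
    exact (wdecay_gauss ω d).smul gauss_smooth κ⟩

/-- The Gaussian wave packet `Π(z)e^{-|·|²/2}`. -/
noncomputable def packet {d : ℕ} (z : Rd d × Rd d) (y : Rd d) : ℂ := wave z.2 y * gauss (y - z.1)

theorem gaussS_shift_coe (ω : Weight) {d : ℕ} (z : Rd d × Rd d) :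
    ((gaussS ω d).shift z : Rd d → ℂ) = packet z :=
  funext fun y => Somega.shift_apply z _ y

theorem norm_packet {d : ℕ} (z : Rd d × Rd d) (y : Rd d) : ‖packet z y‖ = ‖gauss (y - z.1)‖ := by
  rw [packet, norm_mul, norm_wave, one_mul]

theorem norm_gauss_le_one {d : ℕ} (y : Rd d) : ‖gauss y‖ ≤ 1 := by
  rw [norm_gauss]
  exact Real.exp_le_one_iff.2 (by nlinarith [norm_nonneg y])

theorem continuous_wave {d : ℕ} : Continuous fun p : Rd d × Rd d => wave p.1 p.2 :=
  Complex.continuous_exp.comp (continuous_const.mul (Complex.continuous_ofReal.comp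
    (continuous_snd.inner continuous_fst)))

theorem continuous_gauss {d : ℕ} : Continuous (gauss : Rd d → ℂ) := gauss_smooth.continuous

theorem continuous_packet {d : ℕ} :
    Continuous fun p : (Rd d × Rd d) × Rd d => packet p.1 p.2 :=
  (continuous_wave.comp (continuous_fst.snd.prodMk continuous_snd)).mul
    (continuous_gauss.comp (continuous_snd.sub continuous_fst.fst))

theorem exists_norm_gauss_le (ω : Weight) (d : ℕ) (l : ℝ) :
    ∃ C : ℝ, 0 < C ∧ ∀ y : Rd d, ‖gauss y‖ ≤ C * Real.exp (-(l * ω ‖y‖)) := by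
  obtain ⟨C, hC, h⟩ := exists_exp_neg_sq_le ω (b := 1 / 2) (by norm_num) l
  exact ⟨C, hC, fun y => by rw [norm_gauss]; exact h _ (norm_nonneg y)⟩

theorem integrable_gauss (d : ℕ) : Integrable (gauss : Rd d → ℂ) := by
  have h : Integrable fun v : Rd d => Complex.exp (-(1 / 2 : ℂ) * ‖v‖ ^ 2) := by
    simpa using GaussianFourier.integrable_cexp_neg_mul_sq_norm_add (V := Rd d) (b := 1 / 2)
      (by norm_num) 0 0
  exact h

/-- Up to a phase and a constant, the Fourier transform turns phase space by a right angle, (x, ξ) ↦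
(ξ, -x). Estimates in position thus carry over to frequency. -/
theorem ft_packet (ω : Weight) {d : ℕ} : ∃ κ : ℂ, κ ≠ 0 ∧ ∀ (z : Rd d × Rd d) (η : Rd d),
    ft (packet z) η = κ * wave z.2 z.1 * packet (z.2, -z.1) η := by
  obtain ⟨κ, h0, hκ⟩ := ft_gauss d
  refine ⟨κ, h0, fun z η => ?_⟩
  have h := congrFun (ft_shiftSchwartz z (gaussSchwartz ω d)) η
  have e : ((shiftSchwartz z (gaussSchwartz ω d) : 𝓢(Rd d, ℂ)) : Rd d → ℂ) = packet z :=
    funext fun y => shiftSchwartz_apply z _ y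
  rw [e] at h
  rw [h]
  change wave z.2 z.1 * (wave (-z.1) η * ft gauss (η - z.2)) = _
  rw [hκ, packet]
  ring

/-! ### The Gabor transform with a Gaussian window -/

/-- The transform `∫ h(y) \overline{Π(z)e^{-|·|²/2}(y)} dy`. -/
noncomputable def gabor {d : ℕ} (h : Rd d → ℂ) (z : Rd d × Rd d) : ℂ :=
  ∫ y, h y * star (packet z y)

theorem star_wave {d : ℕ} (ξ y : Rd d) :
    star (wave ξ y) = Complex.exp (-(Complex.I * (inner ℝ y ξ : ℝ))) := by
  rw [wave, ← starRingEnd_apply, ← Complex.exp_conj]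
  simp

theorem star_wave_eq_neg {d : ℕ} (ξ y : Rd d) : star (wave ξ y) = wave (-ξ) y := by
  rw [star_wave, wave, inner_neg_right]
  push_cast
  congr 1
  ring

theorem wave_neg_right {d : ℕ} (ξ y : Rd d) : wave ξ (-y) = wave (-ξ) y := by
  rw [wave, wave, inner_neg_right, inner_neg_left]

theorem wave_add_left {d : ℕ} (ξ η y : Rd d) : wave (ξ + η) y = wave ξ y * wave η y := by
  rw [wave, wave, wave, ← Complex.exp_add, inner_add_right]
  push_cast
  congr 1
  ring

theorem wave_add_right {d : ℕ} (ξ y y' : Rd d) : wave ξ (y + y') = wave ξ y * wave ξ y' := by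
  rw [wave, wave, wave, ← Complex.exp_add, inner_add_left]
  push_cast
  congr 1
  ring

theorem wave_comm {d : ℕ} (ξ y : Rd d) : wave ξ y = wave y ξ := by
  rw [wave, wave, real_inner_comm]

theorem ft_eq_integral_wave {d : ℕ} (f : Rd d → ℂ) (ξ : Rd d) :
    ft f ξ = ∫ y, star (wave ξ y) * f y := by
  simp only [star_wave]
  rfl

theorem gabor_eq_ft {d : ℕ} (h : Rd d → ℂ) (z : Rd d × Rd d) :
    gabor h z = ft (fun y => h y * gauss (y - z.1)) z.2 := by
  rw [gabor, ft_eq_integral_wave]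
  congr 1
  funext y
  rw [packet, star_mul', star_gauss]
  ring

theorem continuous_gabor {d : ℕ} {h : Rd d → ℂ} (hh : Integrable h) : Continuous (gabor h) := by
  refine continuous_of_dominated (bound := fun y => ‖h y‖) (fun z => ?_) (fun z => ?_) hh.norm ?_
  · exact hh.aestronglyMeasurable.mul (continuous_packet.comp
      (continuous_const.prodMk continuous_id)).star.aestronglyMeasurable
  · refine Eventually.of_forall fun y => ?_
    rw [norm_mul, norm_star, norm_packet]
    exact mul_le_of_le_one_right (norm_nonneg _) (norm_gauss_le_one _)
  · exact Eventually.of_forall fun y => continuous_const.mul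
      (continuous_packet.comp (continuous_id.prodMk continuous_const)).star

theorem exists_norm_gabor_le_fst (ω : Weight) (d : ℕ) {l : ℝ} (hl : 0 ≤ l) :
    ∃ C : ℝ, 0 < C ∧ ∀ (g : Rd d → ℂ) (P : ℝ), 0 ≤ P →
      (∀ y, ‖g y‖ ≤ P * Real.exp (-(l * ω ‖y‖))) →
      ∀ z, ‖gabor g z‖ ≤ C * P * Real.exp (-(l * ω ‖z.1‖)) := by
  obtain ⟨C, hC, h⟩ := exists_norm_gauss_le ω d (l + 1)
  set I := ∫ v : Rd d, Real.exp (-ω ‖v‖) with hI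
  have hI0 : 0 ≤ I := integral_nonneg fun v => (Real.exp_pos _).le
  refine ⟨C * (I + 1), by positivity, fun g P hP hg z => ?_⟩
  have hint : Integrable fun s : Rd d => Real.exp (-ω ‖s - z.1‖) :=
    (integrable_exp_neg_weight ω d).comp_sub_right z.1
  have hint' : ∫ s : Rd d, Real.exp (-ω ‖s - z.1‖) = I :=
    integral_sub_right_eq_self (fun s : Rd d => Real.exp (-ω ‖s‖)) z.1
  have hb : ∀ y, ‖g y * star (packet z y)‖ ≤
      C * P * Real.exp (-(l * ω ‖z.1‖)) * Real.exp (-ω ‖y - z.1‖) := fun y => by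
    rw [norm_mul, norm_star, norm_packet]
    have he : Real.exp (-(l * ω ‖y‖)) * Real.exp (-((l + 1) * ω ‖y - z.1‖)) ≤
        Real.exp (-(l * ω ‖z.1‖)) * Real.exp (-ω ‖y - z.1‖) := by
      rw [← Real.exp_add, ← Real.exp_add]
      refine Real.exp_le_exp.2 ?_
      have := ω.norm_add_le y (z.1 - y)
      rw [add_sub_cancel, norm_sub_rev] at this
      nlinarith
    calc _ ≤ (P * Real.exp (-(l * ω ‖y‖))) * (C * Real.exp (-((l + 1) * ω ‖y - z.1‖))) := by
          gcongr
          · exact hg y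
          · exact h _
      _ = C * P * (Real.exp (-(l * ω ‖y‖)) * Real.exp (-((l + 1) * ω ‖y - z.1‖))) := by ring
      _ ≤ C * P * (Real.exp (-(l * ω ‖z.1‖)) * Real.exp (-ω ‖y - z.1‖)) := by gcongr
      _ = _ := by ring
  refine (norm_integral_le_of_norm_le (hint.const_mul _) (Eventually.of_forall hb)).trans ?_
  rw [integral_const_mul, hint']
  calc _ ≤ C * P * Real.exp (-(l * ω ‖z.1‖)) * (I + 1) := by gcongr; linarith
    _ = _ := by ring

/-- A Parseval identity obtained by writing the Gaussian cutoff as a Fourier integral and applying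
Fubini, so that integrability of g is enough. -/
theorem gabor_eq_integral_ft (d : ℕ) : ∃ κ : ℂ, ∀ (g : Rd d → ℂ), Integrable g →
    ∀ z, gabor g z = κ * ∫ η, gauss (η - z.2) * wave z.1 (η - z.2) * ft g η := by
  obtain ⟨κ, h0, hκ⟩ := ft_gauss d
  refine ⟨κ⁻¹, fun g hg z => ?_⟩
  rw [← integral_add_right_eq_self _ z.2]
  have hint : Integrable (Function.uncurry fun y η : Rd d =>
      g y * gauss η * (star (wave z.2 y) * star (wave η (y - z.1)))) := by
    have h1 : Integrable (fun p : Rd d × Rd d => g p.1 * gauss p.2) := hg.mul_prod (integrable_gauss d)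
    refine h1.mul_bdd (c := 1) ?_ (Eventually.of_forall fun p => ?_)
    · exact ((continuous_wave.comp (continuous_const.prodMk continuous_fst)).star.mul
        (continuous_wave.comp (continuous_snd.prodMk
          (continuous_fst.sub continuous_const))).star).aestronglyMeasurable
    · simp [norm_wave]
  have e1 : gabor g z = κ⁻¹ * ∫ y, ∫ η, g y * gauss η *
      (star (wave z.2 y) * star (wave η (y - z.1))) := by
    rw [gabor, ← integral_const_mul]
    congr 1
    funext y
    have : gauss (y - z.1) = κ⁻¹ * ∫ η, star (wave (y - z.1) η) * gauss η := by
      rw [← ft_eq_integral_wave, hκ, inv_mul_cancel_left₀ h0]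
    rw [packet, star_mul', star_gauss, this, ← integral_const_mul, ← integral_const_mul,
      ← integral_const_mul, ← integral_const_mul]
    congr 1
    funext η
    rw [wave_comm η]
    ring
  rw [e1, integral_integral_swap hint]
  congr 1
  congr 1
  funext η
  rw [ft_eq_integral_wave, ← integral_const_mul]
  congr 1
  funext y
  have h1 : star (wave η (y - z.1)) = star (wave η y) * wave z.1 η := by
    rw [sub_eq_add_neg, wave_add_right, star_mul', wave_neg_right, star_wave_eq_neg (-η), neg_neg,
      wave_comm η z.1]
  rw [h1, add_sub_cancel_right, wave_add_left, star_mul']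
  ring

end OmegaWF

/-! ### Decay of the Gabor transform on S_ω -/

namespace OmegaWF

/-- Up to a constant and a phase, the transform of g at (x, ξ) is that of ĝ at (ξ, -x), so the
position estimate applies to ĝ. -/
theorem exists_norm_gabor_le_snd (ω : Weight) (d : ℕ) {l : ℝ} (hl : 0 ≤ l) :
    ∃ C : ℝ, 0 < C ∧ ∀ (g : Rd d → ℂ) (P : ℝ), Integrable g → 0 ≤ P →
      (∀ η, ‖ft g η‖ ≤ P * Real.exp (-(l * ω ‖η‖))) →
      ∀ z, ‖gabor g z‖ ≤ C * P * Real.exp (-(l * ω ‖z.2‖)) := by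
  obtain ⟨C, hC, h⟩ := exists_norm_gabor_le_fst ω d hl
  obtain ⟨κ, hκ⟩ := gabor_eq_integral_ft d
  refine ⟨C * (‖κ‖ + 1), by positivity, fun g P hg hP hft z => ?_⟩
  have h1 := h (ft g) P hP hft (z.2, -z.1)
  have e : gabor g z = κ * star (wave z.1 z.2) * gabor (ft g) (z.2, -z.1) := by
    rw [hκ g hg, mul_assoc, gabor]
    congr 1
    rw [← integral_const_mul]
    congr 1
    funext η
    rw [packet, star_mul', star_gauss, star_wave_eq_neg, star_wave_eq_neg, neg_neg, sub_eq_add_neg,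
      wave_add_right, wave_neg_right]
    ring
  rw [e, norm_mul, norm_mul, norm_star, norm_wave, mul_one]
  calc _ ≤ ‖κ‖ * (C * P * Real.exp (-(l * ω ‖z.2‖))) := by gcongr
    _ ≤ (‖κ‖ + 1) * (C * P * Real.exp (-(l * ω ‖z.2‖))) := by gcongr; linarith
    _ = _ := by ring

/-- The sum of the two seminorms of order zero with weight `e^{l ω}`. -/
noncomputable def seminormZero (ω : Weight) (d : ℕ) (l : {l : ℝ // 0 < l}) :
    Seminorm ℂ (Somega ω d) :=
  somegaSeminorms ω d (Sum.inl (l, 0)) + somegaSeminorms ω d (Sum.inr (l, 0))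

section

variable {ω : Weight} {d : ℕ}

theorem Somega.norm_iteratedFDeriv_le (g : Somega ω d) {l : ℝ} (hl : 0 < l) (n : ℕ) (y : Rd d) :
    ‖iteratedFDeriv ℝ n g y‖ ≤
      somegaSeminorms ω d (Sum.inl (⟨l, hl⟩, n)) g * Real.exp (-(l * ω ‖y‖)) := by
  have h1 : Real.exp (l * ω ‖y‖) * ‖iteratedFDeriv ℝ n g y‖ ≤
      somegaSeminorms ω d (Sum.inl (⟨l, hl⟩, n)) g := le_ciSup (g.decay l hl n) y
  rw [Real.exp_neg, ← div_eq_mul_inv, le_div_iff₀ (Real.exp_pos _)]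
  linarith

theorem Somega.norm_iteratedFDeriv_ft_le (g : Somega ω d) {l : ℝ} (hl : 0 < l) (n : ℕ) (y : Rd d) :
    ‖iteratedFDeriv ℝ n (ft g) y‖ ≤
      somegaSeminorms ω d (Sum.inr (⟨l, hl⟩, n)) g * Real.exp (-(l * ω ‖y‖)) := by
  have h1 : Real.exp (l * ω ‖y‖) * ‖iteratedFDeriv ℝ n (ft g) y‖ ≤
      somegaSeminorms ω d (Sum.inr (⟨l, hl⟩, n)) g := le_ciSup (g.decay_ft l hl n) y
  rw [Real.exp_neg, ← div_eq_mul_inv, le_div_iff₀ (Real.exp_pos _)]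
  linarith

theorem Somega.norm_le (g : Somega ω d) {l : ℝ} (hl : 0 < l) (y : Rd d) :
    ‖g y‖ ≤ seminormZero ω d ⟨l, hl⟩ g * Real.exp (-(l * ω ‖y‖)) := by
  have h := g.norm_iteratedFDeriv_le hl 0 y
  rw [norm_iteratedFDeriv_zero] at h
  refine h.trans ?_
  gcongr
  exact le_add_of_nonneg_right (apply_nonneg (somegaSeminorms ω d (Sum.inr (⟨l, hl⟩, 0))) g)

theorem Somega.norm_ft_le (g : Somega ω d) {l : ℝ} (hl : 0 < l) (y : Rd d) :
    ‖ft g y‖ ≤ seminormZero ω d ⟨l, hl⟩ g * Real.exp (-(l * ω ‖y‖)) := by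
  have h := g.norm_iteratedFDeriv_ft_le hl 0 y
  rw [norm_iteratedFDeriv_zero] at h
  refine h.trans ?_
  gcongr
  exact le_add_of_nonneg_left (apply_nonneg (somegaSeminorms ω d (Sum.inl (⟨l, hl⟩, 0))) g)

theorem Somega.integrable (g : Somega ω d) : Integrable (g : Rd d → ℂ) := g.toSchwartz.integrable

theorem Somega.continuous (g : Somega ω d) : Continuous (g : Rd d → ℂ) := g.toSchwartz.continuous

/-- The pairing of an element of `S_ω` with a wave packet decays faster than every `e^{-l ω}`. -/
theorem exists_norm_gabor_le (ω : Weight) (d : ℕ) {l : ℝ} (hl : 0 < l) :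
    ∃ C : ℝ, 0 < C ∧ ∀ (g : Somega ω d) (z : Rd d × Rd d),
      ‖gabor g z‖ ≤ C * seminormZero ω d ⟨2 * l, by positivity⟩ g * Real.exp (-(l * ω.phase z)) := by
  -- Only the larger of the two weights is used for each z; it is at least half of their sum, hence
  -- the rate 2l.
  obtain ⟨C₁, hC₁, h₁⟩ := exists_norm_gabor_le_fst ω d (l := 2 * l) (by positivity)
  obtain ⟨C₂, hC₂, h₂⟩ := exists_norm_gabor_le_snd ω d (l := 2 * l) (by positivity)
  refine ⟨C₁ + C₂, by positivity, fun g z => ?_⟩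
  set P := seminormZero ω d ⟨2 * l, by positivity⟩ g with hP
  have hP0 : 0 ≤ P := apply_nonneg _ _
  have h1 := h₁ g P hP0 (g.norm_le (by positivity)) z
  have h2 := h₂ g P g.integrable hP0 (g.norm_ft_le (by positivity)) z
  rcases le_total (ω ‖z.1‖) (ω ‖z.2‖) with h | h
  · refine h2.trans (mul_le_mul (mul_le_mul_of_nonneg_right (by linarith) hP0)
      (Real.exp_le_exp.2 ?_) (Real.exp_pos _).le (by positivity))
    simp only [Weight.phase]
    nlinarith
  · refine h1.trans (mul_le_mul (mul_le_mul_of_nonneg_right (by linarith) hP0)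
      (Real.exp_le_exp.2 ?_) (Real.exp_pos _).le (by positivity))
    simp only [Weight.phase]
    nlinarith

theorem Somega.exists_norm_gabor_le (g : Somega ω d) (l : ℝ) :
    ∃ C : ℝ, 0 < C ∧ ∀ z : Rd d × Rd d, ‖gabor g z‖ ≤ C * Real.exp (-(l * ω.phase z)) := by
  have hl : 0 < max l 1 := lt_max_of_lt_right one_pos
  obtain ⟨C, hC, h⟩ := OmegaWF.exists_norm_gabor_le ω d hl
  set P := seminormZero ω d ⟨2 * max l 1, by positivity⟩ g with hP
  have hP0 : 0 ≤ P := apply_nonneg _ _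
  refine ⟨C * P + 1, by positivity, fun z => (h g z).trans ?_⟩
  rw [← hP]
  have := ω.phase_nonneg z
  gcongr
  · linarith
  · exact le_max_left l 1

theorem Somega.continuous_gabor (g : Somega ω d) : Continuous (gabor g) :=
  OmegaWF.continuous_gabor g.integrable

theorem Somega.integrable_gabor (g : Somega ω d) : Integrable (gabor g) := by
  obtain ⟨C, hC, h⟩ := g.exists_norm_gabor_le 1
  refine ((ω.integrable_exp_neg_phase d).const_mul C).mono'
    g.continuous_gabor.aestronglyMeasurable (Eventually.of_forall fun z => ?_)
  simpa using h z

/-! ### Inversion -/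

theorem ft_inversion {f : Rd d → ℂ} (hc : Continuous f) (hf : Integrable f) (hft : Integrable (ft f))
    (y : Rd d) : ∫ ξ, ft f ξ * wave ξ y = (2 * Real.pi : ℂ) ^ d * f y := by
  have hpi : (0 : ℝ) < 2 * Real.pi := by positivity
  have e : ∀ v : Rd d, FourierTransform.fourier f v = ft f ((2 * Real.pi) • v) := fun v => by
    rw [ft_eq_fourier_apply, smul_smul, inv_mul_cancel₀ hpi.ne', one_smul]
  have hF : Integrable (FourierTransform.fourier f) := by
    have : FourierTransform.fourier f = fun v => ft f ((2 * Real.pi) • v) := funext e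
    rw [this]
    exact hft.comp_smul hpi.ne'
  have h := congrFun (hc.fourierInv_fourier_eq hf hF) y
  rw [Real.fourierInv_eq'] at h
  rw [← h]
  have h2 := Measure.integral_comp_smul (volume : Measure (Rd d))
    (fun ξ => ft f ξ * wave ξ y) (2 * Real.pi)
  have h3 : ∀ v : Rd d, Complex.exp (((2 * Real.pi * inner ℝ v y : ℝ) : ℂ) * Complex.I) •
      FourierTransform.fourier f v =
      ft f ((2 * Real.pi) • v) * wave ((2 * Real.pi) • v) y := fun v => by
    rw [e, smul_eq_mul, mul_comm, wave, real_inner_smul_right, real_inner_comm v y]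
    congr 2
    ring
  simp only [h3]
  rw [h2, finrank_euclideanSpace_fin, abs_of_pos (by positivity), Complex.real_smul]
  push_cast
  rw [mul_inv_cancel_left₀]
  exact pow_ne_zero _ (by exact_mod_cast hpi.ne')

/-- The constant `(2π)^d ∫ e^{-|y|²} dy` of the inversion formula. -/
noncomputable def gaborConst (d : ℕ) : ℝ := (2 * Real.pi) ^ d * ∫ y : Rd d, ‖gauss y‖ ^ 2

theorem integrable_norm_gauss_sq (d : ℕ) : Integrable fun y : Rd d => ‖gauss y‖ ^ 2 := by
  refine (integrable_gauss d).norm.mono' (continuous_gauss.norm.pow 2).aestronglyMeasurable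
    (Eventually.of_forall fun y => ?_)
  rw [Real.norm_of_nonneg (by positivity), sq]
  exact mul_le_of_le_one_right (norm_nonneg _) (norm_gauss_le_one y)

theorem gaborConst_pos (d : ℕ) : 0 < gaborConst d := by
  refine mul_pos (by positivity) ?_
  rw [integral_pos_iff_support_of_nonneg (fun y => by positivity) (integrable_norm_gauss_sq d)]
  have : Function.support (fun y : Rd d => ‖gauss y‖ ^ 2) = univ := by
    ext y
    simp only [Function.mem_support, mem_univ, iff_true, norm_gauss]
    positivity
  rw [this]
  exact isOpen_univ.measure_pos _ univ_nonempty

theorem gaborConst_ne_zero (d : ℕ) : (gaborConst d : ℂ) ≠ 0 := by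
  exact_mod_cast (gaborConst_pos d).ne'

theorem Somega.integrable_gabor_mul_packet (g : Somega ω d) (y : Rd d) :
    Integrable fun z => gabor g z * packet z y :=
  g.integrable_gabor.mul_bdd (c := 1) (continuous_packet.comp
    (continuous_id.prodMk continuous_const)).aestronglyMeasurable
    (Eventually.of_forall fun z => by rw [norm_packet]; exact norm_gauss_le_one _)

/-- For fixed x, the integral over ξ inverts the Fourier transform of g·γ(· - x). What remains is
g(y)γ(y - x)², whose integral over x gives the constant. -/
theorem Somega.gabor_inversion (g : Somega ω d) (y : Rd d) :
    ∫ z, gabor g z * packet z y = gaborConst d * g y := by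
  have hi := g.integrable_gabor_mul_packet y
  rw [Measure.volume_eq_prod] at hi ⊢
  rw [integral_prod _ hi]
  have h1 : ∀ x : Rd d, ∫ ξ, gabor g (x, ξ) * packet (x, ξ) y =
      (2 * Real.pi : ℂ) ^ d * g y * ((‖gauss (y - x)‖ ^ 2 : ℝ) : ℂ) := by
    intro x
    have hFc : Continuous fun s => g s * gauss (s - x) :=
      g.continuous.mul (continuous_gauss.comp (continuous_id.sub continuous_const))
    have hFi : Integrable fun s => g s * gauss (s - x) :=
      g.integrable.mul_bdd (c := 1) (continuous_gauss.comp
        (continuous_id.sub continuous_const)).aestronglyMeasurable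
        (Eventually.of_forall fun s => norm_gauss_le_one _)
    have hft : ft (fun s => g s * gauss (s - x)) = fun ξ => gabor g (x, ξ) :=
      funext fun ξ => (gabor_eq_ft g (x, ξ)).symm
    obtain ⟨C, hC, h⟩ := g.exists_norm_gabor_le 1
    have hfi : Integrable fun ξ => gabor g (x, ξ) := by
      refine ((integrable_exp_neg_weight ω d).const_mul C).mono'
        (g.continuous_gabor.comp (continuous_const.prodMk continuous_id)).aestronglyMeasurable
        (Eventually.of_forall fun ξ => (h (x, ξ)).trans ?_)
      have := ω.nonneg _ (norm_nonneg x)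
      gcongr
      simp only [Weight.phase]
      linarith
    have key := ft_inversion hFc hFi (hft ▸ hfi) y
    rw [hft] at key
    have e : ∀ ξ, gabor g (x, ξ) * packet (x, ξ) y = (gabor g (x, ξ) * wave ξ y) * gauss (y - x) :=
      fun ξ => by rw [packet]; ring
    simp only [e]
    rw [integral_mul_const, key, norm_gauss, gauss_eq_ofReal]
    push_cast
    ring
  simp only [h1]
  rw [integral_const_mul, integral_complex_ofReal,
    integral_sub_left_eq_self (fun s : Rd d => ‖gauss s‖ ^ 2) volume y, gaborConst]
  push_cast
  ring

theorem Somega.star_gabor_inversion (g : Somega ω d) (y : Rd d) :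
    ∫ z, star (gabor g z) * star (packet z y) = gaborConst d * star (g y) := by
  have h := congrArg star (g.gabor_inversion y)
  rw [star_mul', ← starRingEnd_apply, ← integral_conj, ← starRingEnd_apply,
    Complex.conj_ofReal] at h
  rw [← h]
  congr 1
  funext z
  simp

theorem exists_norm_gauss_sub_le (ω : Weight) (d : ℕ) :
    ∃ C : ℝ, 0 < C ∧ ∀ x y : Rd d, ‖gauss (y - x)‖ ≤ C * Real.exp (-ω ‖y‖) * Real.exp (ω ‖x‖) := by
  obtain ⟨C, hC, h⟩ := exists_norm_gauss_le ω d 1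
  refine ⟨C, hC, fun x y => (h _).trans ?_⟩
  rw [mul_assoc, ← Real.exp_add]
  gcongr
  have := ω.norm_add_le (y - x) x
  rw [sub_add_cancel] at this
  linarith

/-- Moyal's formula for the pairing of a bounded function with an element of `S_ω`. -/
theorem moyal_bounded {h : Rd d → ℂ} (hm : AEStronglyMeasurable h) {P : ℝ}
    (hP : ∀ y, ‖h y‖ ≤ P) (g : Somega ω d) :
    gaborConst d * ∫ y, h y * star (g y) = ∫ z, gabor h z * star (gabor g z) := by
  -- As h is merely bounded, integrability in y comes from the packet: it yields e^{-ω(y)} at the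
  -- price e^{ω(x)}, which one half of the decay e^{-2ω(z)} of the transform of g pays for.
  obtain ⟨C, hC, hgs⟩ := exists_norm_gauss_sub_le ω d
  obtain ⟨C', hC', hg⟩ := g.exists_norm_gabor_le 2
  have hint : Integrable (Function.uncurry fun (y : Rd d) (z : Rd d × Rd d) =>
      h y * (star (gabor g z) * star (packet z y))) := by
    have h0 : Integrable (fun p : Rd d × (Rd d × Rd d) =>
        (P * C * Real.exp (-ω ‖p.1‖)) * (C' * Real.exp (-ω.phase p.2))) :=
      ((integrable_exp_neg_weight ω d).const_mul (P * C)).mul_prod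
        ((ω.integrable_exp_neg_phase d).const_mul C')
    refine h0.mono' ?_ (Eventually.of_forall fun p => ?_)
    · refine hm.comp_fst.mul (Continuous.aestronglyMeasurable ?_)
      exact (g.continuous_gabor.comp continuous_snd).star.mul
        (continuous_packet.comp (continuous_snd.prodMk continuous_fst)).star
    · obtain ⟨y, z⟩ := p
      simp only [Function.uncurry_apply_pair, norm_mul, norm_star, norm_packet]
      have hP0 : 0 ≤ P := (norm_nonneg _).trans (hP y)
      calc _ ≤ P * ((C' * Real.exp (-(2 * ω.phase z))) *
            (C * Real.exp (-ω ‖y‖) * Real.exp (ω ‖z.1‖))) := by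
            gcongr
            · exact hP y
            · exact hg z
            · exact hgs z.1 y
        _ = (P * C * Real.exp (-ω ‖y‖)) * (C' *
            (Real.exp (-(2 * ω.phase z)) * Real.exp (ω ‖z.1‖))) := by ring
        _ ≤ _ := by
            rw [← Real.exp_add]
            gcongr
            have := ω.nonneg _ (norm_nonneg z.2)
            simp only [Weight.phase]
            linarith
  have e1 : ∀ y, gaborConst d * (h y * star (g y)) =
      ∫ z, h y * (star (gabor g z) * star (packet z y)) := fun y => by
    rw [integral_const_mul, g.star_gabor_inversion]
    ring
  rw [← integral_const_mul]
  simp only [e1]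
  rw [integral_integral_swap hint]
  congr 1
  funext z
  change _ = (∫ y, h y * star (packet z y)) * _
  rw [← integral_mul_const]
  congr 1
  funext y
  ring

end

end OmegaWF

namespace OmegaWF

/-! ### Derivatives of parametric integrals -/

/-- Joint smoothness makes the derivatives in y continuous in the parameter z. This supplies the
measurability needed for differentiation under the integral. -/
theorem contDiff_iteratedFDeriv_param {Z E F : Type*} [NormedAddCommGroup Z] [NormedSpace ℝ Z]
    [NormedAddCommGroup E] [NormedSpace ℝ E] [NormedAddCommGroup F] [NormedSpace ℝ F]
    {f : Z → E → F} (hf : ContDiff ℝ (⊤ : ℕ∞) (Function.uncurry f)) (n : ℕ) :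
    ContDiff ℝ (⊤ : ℕ∞) fun p : Z × E => iteratedFDeriv ℝ n (f p.1) p.2 := by
  induction n with
  | zero =>
    simp only [iteratedFDeriv_zero_eq_comp]
    exact (continuousMultilinearCurryFin0 ℝ E F).symm.contDiff.comp hf
  | succ n ih =>
    simp only [iteratedFDeriv_succ_eq_comp_left]
    refine (LinearIsometryEquiv.contDiff (𝕜 := ℝ) (E := E →L[ℝ] E [×n]→L[ℝ] F)
      (F := E [×(n + 1)]→L[ℝ] F) _).comp ?_
    refine ContDiff.fderiv (f := fun (p : Z × E) y => iteratedFDeriv ℝ n (f p.1) y) (g := Prod.snd)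
      (m := (⊤ : ℕ∞)) (n := (⊤ : ℕ∞)) ?_ contDiff_snd (by simp)
    exact ih.comp ((contDiff_fst.comp contDiff_fst).prodMk contDiff_snd)

theorem continuous_iteratedFDeriv_param {Z E F : Type*} [NormedAddCommGroup Z] [NormedSpace ℝ Z]
    [NormedAddCommGroup E] [NormedSpace ℝ E] [NormedAddCommGroup F] [NormedSpace ℝ F]
    {f : Z → E → F} (hf : ContDiff ℝ (⊤ : ℕ∞) (Function.uncurry f)) (n : ℕ) {J : Z → Z}
    (hJ : Continuous J) (y : E) : Continuous fun z => iteratedFDeriv ℝ n (f (J z)) y :=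
  (contDiff_iteratedFDeriv_param hf n).continuous.comp (hJ.prodMk continuous_const)

theorem iteratedFDeriv_integral {Z E : Type*} [MeasurableSpace Z] {μ : Measure Z}
    [NormedAddCommGroup E] [NormedSpace ℝ E] {f : Z → E → ℂ}
    (hs : ∀ z, ContDiff ℝ (⊤ : ℕ∞) (f z))
    (hm : ∀ n y, AEStronglyMeasurable (fun z => iteratedFDeriv ℝ n (f z) y) μ)
    {bound : ℕ → Z → ℝ} (hb : ∀ n, Integrable (bound n) μ)
    (h : ∀ n z y, ‖iteratedFDeriv ℝ n (f z) y‖ ≤ bound n z) (n : ℕ) :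
    iteratedFDeriv ℝ n (fun y => ∫ z, f z y ∂μ) = fun y => ∫ z, iteratedFDeriv ℝ n (f z) y ∂μ := by
  induction n with
  | zero =>
    funext y
    simp only [iteratedFDeriv_zero_eq_comp, Function.comp_apply]
    exact ((continuousMultilinearCurryFin0 ℝ E ℂ).symm.toContinuousLinearEquiv.integral_comp_comm
      fun z => f z y).symm
  | succ n ih =>
    funext y
    have hi : ∀ k y, Integrable (fun z => iteratedFDeriv ℝ k (f z) y) μ := fun k y =>
      (hb k).mono' (hm k y) (Eventually.of_forall fun z => h k z y)
    have hd : ∀ z y, HasFDerivAt (iteratedFDeriv ℝ n (f z))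
        (fderiv ℝ (iteratedFDeriv ℝ n (f z)) y) y := fun z y =>
      (((hs z).differentiable_iteratedFDeriv (m := n) (by exact_mod_cast WithTop.coe_lt_top _)) y).hasFDerivAt
    have hn : ∀ z y, fderiv ℝ (iteratedFDeriv ℝ n (f z)) y =
        continuousMultilinearCurryLeftEquiv ℝ (fun _ : Fin (n + 1) => E) ℂ
          (iteratedFDeriv ℝ (n + 1) (f z) y) := fun z y => by
      rw [iteratedFDeriv_succ_eq_comp_left, Function.comp_apply, LinearIsometryEquiv.apply_symm_apply]
    have key : HasFDerivAt (fun y => ∫ z, iteratedFDeriv ℝ n (f z) y ∂μ)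
        (∫ z, fderiv ℝ (iteratedFDeriv ℝ n (f z)) y ∂μ) y := by
      refine hasFDerivAt_integral_of_dominated_of_fderiv_le (s := univ) (bound := bound (n + 1))
        (F' := fun y z => fderiv ℝ (iteratedFDeriv ℝ n (f z)) y)
        univ_mem (Eventually.of_forall fun y => hm n y) (hi n y) ?_ ?_ (hb (n + 1)) ?_
      · simp only [hn]
        exact (LinearIsometryEquiv.continuous _).comp_aestronglyMeasurable (hm (n + 1) y)
      · refine Eventually.of_forall fun z y _ => ?_
        rw [norm_fderiv_iteratedFDeriv]
        exact h (n + 1) z y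
      · exact Eventually.of_forall fun z y _ => hd z y
    rw [iteratedFDeriv_succ_eq_comp_left, Function.comp_apply, ih, key.fderiv]
    rw [LinearIsometryEquiv.symm_apply_eq]
    simp only [hn]
    exact ContinuousLinearEquiv.integral_comp_comm (𝕜 := ℝ) (E := E [×(n + 1)]→L[ℝ] ℂ)
      (F := E →L[ℝ] E [×n]→L[ℝ] ℂ) (continuousMultilinearCurryLeftEquiv ℝ
        (fun _ : Fin (n + 1) => E) ℂ).toContinuousLinearEquiv (μ := μ)
      fun z => iteratedFDeriv ℝ (n + 1) (f z) y

/-! ### Seminorms in terms of the Gabor transform -/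

theorem contDiff_packet {d : ℕ} :
    ContDiff ℝ (⊤ : ℕ∞) (Function.uncurry (packet : Rd d × Rd d → Rd d → ℂ)) := by
  have h1 : ContDiff ℝ (⊤ : ℕ∞) fun p : (Rd d × Rd d) × Rd d => wave p.1.2 p.2 :=
    Complex.contDiff_exp.comp (contDiff_const.mul (Complex.ofRealCLM.contDiff.comp
      (contDiff_snd.inner ℝ (contDiff_snd.comp contDiff_fst))))
  exact h1.mul (gauss_smooth.comp (contDiff_snd.sub (contDiff_fst.comp contDiff_fst)))

theorem contDiff_packet_right {d : ℕ} (z : Rd d × Rd d) : ContDiff ℝ (⊤ : ℕ∞) (packet z) :=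
  (wave_smooth z.2).mul (gauss_smooth.comp (contDiff_id.sub contDiff_const))

theorem iteratedFDeriv_const_mul_apply {E : Type*} [NormedAddCommGroup E] [NormedSpace ℝ E]
    {f : E → ℂ} (hf : ContDiff ℝ (⊤ : ℕ∞) f) (c : ℂ) (n : ℕ) (y : E) :
    iteratedFDeriv ℝ n (fun y => c * f y) y = c • iteratedFDeriv ℝ n f y := by
  change iteratedFDeriv ℝ n (c • f) y = _
  exact iteratedFDeriv_const_smul_apply (hf.of_le (by exact_mod_cast le_top)).contDiffAt

variable {ω : Weight} {d : ℕ}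

/-- The derivatives of the plane wave produce a polynomial (1 + |ξ|)^n, absorbed by e^{ω(ξ)}; the
translation costs e^{lω(x)}. Together they stay below e^{(l+1)ω(z)}. -/
theorem exists_norm_iteratedFDeriv_packet_le (ω : Weight) (d : ℕ) {l : ℝ} (hl : 0 ≤ l) (n : ℕ) :
    ∃ C : ℝ, 0 < C ∧ ∀ (z : Rd d × Rd d) (y : Rd d), ‖iteratedFDeriv ℝ n (packet z) y‖ ≤
      C * Real.exp ((l + 1) * ω.phase z) * Real.exp (-(l * ω ‖y‖)) := by
  obtain ⟨B, hB, h⟩ := exists_norm_iteratedFDeriv_gauss_le_exp ω d l hl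
  obtain ⟨A, hA, h⟩ := h 1 one_pos
  obtain ⟨C, hC, hp⟩ := ω.one_add_pow_le n
  set Q := A * B ^ n * ω.moment 1 n with hQ
  have hQ0 : 0 < Q := by have := ω.moment_pos 1 n; positivity
  refine ⟨C * Q, by positivity, fun z y => ?_⟩
  have hs : ContDiff ℝ (⊤ : ℕ∞) fun y : Rd d => gauss (y - z.1) :=
    gauss_smooth.comp (contDiff_id.sub contDiff_const)
  refine (norm_iteratedFDeriv_mul_le (n := n) (wave_smooth z.2) hs y
    (by exact_mod_cast le_top)).trans ?_
  have hterm : ∀ i ∈ Finset.range (n + 1), (n.choose i : ℝ) * ‖iteratedFDeriv ℝ i (wave z.2) y‖ *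
      ‖iteratedFDeriv ℝ (n - i) (fun y => gauss (y - z.1)) y‖ ≤
      (Q * Real.exp (-(l * ω ‖y - z.1‖))) * (‖z.2‖ ^ i * 1 ^ (n - i) * (n.choose i : ℝ)) := by
    intro i hi
    rw [iteratedFDeriv_comp_sub]
    have h1 : ‖iteratedFDeriv ℝ (n - i) gauss (y - z.1)‖ ≤ Q * Real.exp (-(l * ω ‖y - z.1‖)) := by
      refine (h _ _).trans ?_
      have := ω.moment_mono one_pos (Nat.sub_le n i)
      have := ω.moment_pos 1 (n - i)
      rw [hQ]
      gcongr
      exact Nat.sub_le n i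
    calc _ ≤ (n.choose i : ℝ) * ‖z.2‖ ^ i * (Q * Real.exp (-(l * ω ‖y - z.1‖))) := by
          gcongr
          exact norm_iteratedFDeriv_wave_le _ _ _
      _ = _ := by rw [one_pow]; ring
  refine (Finset.sum_le_sum hterm).trans ?_
  rw [← Finset.mul_sum, ← add_pow, add_comm ‖z.2‖]
  calc _ ≤ (Q * Real.exp (-(l * ω ‖y - z.1‖))) * (C * Real.exp (ω ‖z.2‖)) := by
        gcongr
        exact hp _ (norm_nonneg _)
    _ = C * Q * (Real.exp (-(l * ω ‖y - z.1‖)) * Real.exp (ω ‖z.2‖)) := by ring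
    _ ≤ C * Q * (Real.exp ((l + 1) * ω.phase z) * Real.exp (-(l * ω ‖y‖))) := by
        rw [← Real.exp_add, ← Real.exp_add]
        refine mul_le_mul_of_nonneg_left (Real.exp_le_exp.2 ?_) (by positivity)
        have := ω.norm_add_le (y - z.1) z.1
        rw [sub_add_cancel] at this
        have h1 := ω.nonneg _ (norm_nonneg z.1)
        have h2 := ω.nonneg _ (norm_nonneg z.2)
        simp only [Weight.phase]
        nlinarith
    _ = _ := by ring

/-- Derivatives of a continuous superposition of wave packets. -/
theorem exists_norm_iteratedFDeriv_superposition_le (ω : Weight) (d : ℕ) {l : ℝ} (hl : 0 ≤ l)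
    (n : ℕ) : ∃ C : ℝ, 0 < C ∧ ∀ (c : Rd d × Rd d → ℂ) (J : Rd d × Rd d → Rd d × Rd d),
      Continuous c → Continuous J → (∀ z, ω.phase (J z) = ω.phase z) →
      (∀ k : ℝ, Integrable fun z => ‖c z‖ * Real.exp (k * ω.phase z)) → ∀ y : Rd d,
      ‖iteratedFDeriv ℝ n (fun y => ∫ z, c z * packet (J z) y) y‖ ≤
        C * (∫ z, ‖c z‖ * Real.exp ((l + 1) * ω.phase z)) * Real.exp (-(l * ω ‖y‖)) := by
  obtain ⟨C, hC, h⟩ := exists_norm_iteratedFDeriv_packet_le ω d hl n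
  refine ⟨C, hC, fun c J hc hJ hph hint y => ?_⟩
  choose C' hC' h' using fun n => exists_norm_iteratedFDeriv_packet_le ω d le_rfl n
  have hsm : ∀ z n y, iteratedFDeriv ℝ n (fun y => c z * packet (J z) y) y =
      c z • iteratedFDeriv ℝ n (packet (J z)) y := fun z n y =>
    iteratedFDeriv_const_mul_apply (contDiff_packet_right (J z)) (c z) n y
  have hmeas : ∀ n y, AEStronglyMeasurable
      (fun z => iteratedFDeriv ℝ n (fun y => c z * packet (J z) y) y) volume := fun n y => by
    exact (hc.smul (continuous_iteratedFDeriv_param contDiff_packet n hJ y)).aestronglyMeasurable.congr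
      (Eventually.of_forall fun z => (hsm z n y).symm)
  have hbd : ∀ n z y, ‖iteratedFDeriv ℝ n (fun y => c z * packet (J z) y) y‖ ≤
      C' n * (‖c z‖ * Real.exp (1 * ω.phase z)) := fun n z y => by
    have h1 := h' n (J z) y
    rw [hph, zero_mul, neg_zero, Real.exp_zero, mul_one, zero_add] at h1
    rw [hsm, norm_smul]
    calc _ ≤ ‖c z‖ * (C' n * Real.exp (1 * ω.phase z)) := by gcongr
      _ = _ := by ring
  have hbi : ∀ n, Integrable fun z => C' n * (‖c z‖ * Real.exp (1 * ω.phase z)) :=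
    fun n => (hint 1).const_mul (C' n)
  have hcd : ∀ z, ContDiff ℝ (⊤ : ℕ∞) fun y => c z * packet (J z) y := fun z =>
    contDiff_const.mul (contDiff_packet_right (J z))
  have hfirst := iteratedFDeriv_integral hcd hmeas hbi hbd n
  rw [hfirst]
  refine (norm_integral_le_of_norm_le (((hint (l + 1)).const_mul C).mul_const
    (Real.exp (-(l * ω ‖y‖)))) (Eventually.of_forall fun z => ?_)).trans ?_
  · rw [hsm, norm_smul]
    have h1 := h (J z) y
    rw [hph] at h1
    calc _ ≤ ‖c z‖ * (C * Real.exp ((l + 1) * ω.phase z) * Real.exp (-(l * ω ‖y‖))) := by gcongr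
      _ = _ := by ring
  · rw [integral_mul_const, integral_const_mul]

theorem Somega.integrable_gabor_mul_exp (g : Somega ω d) (k : ℝ) :
    Integrable fun z => ‖gabor g z‖ * Real.exp (k * ω.phase z) := by
  obtain ⟨C, hC, h⟩ := g.exists_norm_gabor_le (k + 1)
  refine ((ω.integrable_exp_neg_phase d).const_mul C).mono'
    (g.continuous_gabor.norm.mul (Real.continuous_exp.comp
      (continuous_const.mul ω.continuous_phase))).aestronglyMeasurable
    (Eventually.of_forall fun z => ?_)
  rw [Real.norm_of_nonneg (by positivity)]
  calc _ ≤ (C * Real.exp (-((k + 1) * ω.phase z))) * Real.exp (k * ω.phase z) := by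
        gcongr
        exact h z
    _ = _ := by
        rw [mul_assoc, ← Real.exp_add]
        congr 2
        ring

theorem Somega.eq_superposition (g : Somega ω d) :
    (g : Rd d → ℂ) = fun y => ∫ z, ((gaborConst d : ℂ)⁻¹ * gabor g z) * packet z y := by
  funext y
  simp only [mul_assoc]
  rw [integral_const_mul, g.gabor_inversion, inv_mul_cancel_left₀ (gaborConst_ne_zero d)]

theorem gabor_wave (z : Rd d × Rd d) (η : Rd d) :
    gabor (wave η) z = star (ft (packet z) η) := by
  rw [ft_eq_integral_wave, gabor, ← starRingEnd_apply, ← integral_conj]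
  congr 1
  funext y
  simp

/-- Moyal's formula for a plane wave, which is bounded though not integrable. -/
theorem Somega.ft_eq_integral (g : Somega ω d) (η : Rd d) :
    gaborConst d * ft g η = ∫ z, gabor g z * ft (packet z) η := by
  have h := moyal_bounded (h := wave η) (wave_smooth η).continuous.aestronglyMeasurable (P := 1)
    (fun y => (norm_wave η y).le) g
  have h2 := congrArg star h
  rw [star_mul', ← starRingEnd_apply (∫ y, _), ← integral_conj, ← starRingEnd_apply (∫ y, _),
    ← integral_conj, ← starRingEnd_apply (gaborConst d : ℂ), Complex.conj_ofReal] at h2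
  rw [ft_eq_integral_wave]
  refine Eq.trans ?_ (h2.trans ?_)
  · congr 2
    funext y
    simp
  · congr 1
    funext z
    rw [gabor_wave]
    simp [mul_comm]

theorem Somega.exists_ft_eq_superposition (ω : Weight) (d : ℕ) :
    ∃ κ : ℂ, ∀ g : Somega ω d, ft g = fun y =>
      ∫ z : Rd d × Rd d, (κ * gabor g z * wave z.2 z.1) * packet (z.2, -z.1) y := by
  obtain ⟨κ, -, h⟩ := ft_packet ω (d := d)
  refine ⟨(gaborConst d : ℂ)⁻¹ * κ, fun g => ?_⟩
  funext η
  have h1 := g.ft_eq_integral η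
  rw [← inv_mul_cancel_left₀ (gaborConst_ne_zero d) (ft g η), h1, ← integral_const_mul]
  congr 1
  funext z
  rw [h]
  ring

/-- Both g and ĝ are superpositions of packets with coefficients of modulus a constant times |V g|:
at the points z for g, and at the rotated points (ξ, -x), of equal weight, for ĝ. Each seminorm is
thus dominated by an integral over phase space. -/
theorem exists_seminorm_le_integral_gabor (ω : Weight) (d : ℕ)
    (i : ({l : ℝ // 0 < l} × ℕ) ⊕ ({l : ℝ // 0 < l} × ℕ)) :
    ∃ C k : ℝ, 0 < C ∧ 0 < k ∧ ∀ g : Somega ω d,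
      somegaSeminorms ω d i g ≤ C * ∫ z, ‖gabor g z‖ * Real.exp (k * ω.phase z) := by
  rcases i with ⟨⟨l, hl⟩, n⟩ | ⟨⟨l, hl⟩, n⟩
  · obtain ⟨C, hC, h⟩ := exists_norm_iteratedFDeriv_superposition_le ω d hl.le n
    refine ⟨C * ‖(gaborConst d : ℂ)⁻¹‖, l + 1,
      mul_pos hC (norm_pos_iff.2 (inv_ne_zero (gaborConst_ne_zero d))), by linarith, fun g => ?_⟩
    refine ciSup_le fun y => ?_
    have h1 := h (fun z => (gaborConst d : ℂ)⁻¹ * gabor g z) id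
      (continuous_const.mul g.continuous_gabor) continuous_id (fun z => rfl) (fun k => by
        simp only [norm_mul, mul_assoc]
        exact (g.integrable_gabor_mul_exp k).const_mul _) y
    have h2 := g.eq_superposition
    simp only [id] at h1
    rw [← h2] at h1
    simp only [norm_mul, mul_assoc] at h1
    rw [integral_const_mul, Real.exp_neg] at h1
    rw [mul_comm, ← le_div_iff₀ (Real.exp_pos _), div_eq_mul_inv]
    simpa only [mul_assoc, norm_inv] using h1
  · obtain ⟨C, hC, h⟩ := exists_norm_iteratedFDeriv_superposition_le ω d hl.le n
    obtain ⟨κ, hκ⟩ := Somega.exists_ft_eq_superposition ω d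
    refine ⟨C * (‖κ‖ + 1), l + 1, by positivity, by linarith, fun g => ?_⟩
    refine ciSup_le fun y => ?_
    have h1 := h (fun z => κ * gabor g z * wave z.2 z.1) (fun z => (z.2, -z.1))
      ((continuous_const.mul g.continuous_gabor).mul
        (continuous_wave.comp (continuous_snd.prodMk continuous_fst)))
      (continuous_snd.prodMk continuous_fst.neg)
      (fun z => by simp [Weight.phase, add_comm]) (fun k => by
        simp only [norm_mul, mul_assoc, norm_wave, one_mul]
        exact (g.integrable_gabor_mul_exp k).const_mul _) y
    rw [← hκ g] at h1
    simp only [norm_mul, mul_assoc, norm_wave, one_mul] at h1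
    rw [integral_const_mul, Real.exp_neg] at h1
    rw [mul_comm, ← le_div_iff₀ (Real.exp_pos _), div_eq_mul_inv]
    refine h1.trans ?_
    have : 0 ≤ ∫ z, ‖gabor g z‖ * Real.exp ((l + 1) * ω.phase z) :=
      integral_nonneg fun z => by positivity
    rw [← mul_assoc, ← mul_assoc]
    gcongr
    linarith

end OmegaWF

namespace OmegaWF

/-! ### Representation of functionals bounded by a Hilbert norm -/

/-- The bound lets f factor through the range of T as a bounded functional; Hahn–Banach extends it
to H and Riesz represents it. -/
theorem exists_inner_repr {V H : Type*} [AddCommGroup V] [Module ℂ V] [NormedAddCommGroup H]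
    [InnerProductSpace ℂ H] [CompleteSpace H] (T : V →ₗ[ℂ] H) (f : V →ₗ[ℂ] ℂ) (C : ℝ)
    (h : ∀ v, ‖f v‖ ≤ C * ‖T v‖) : ∃ k : H, ∀ v, f v = inner ℂ k (T v) := by
  obtain ⟨s, hs⟩ := T.rangeRestrict.exists_rightInverse_of_surjective T.range_rangeRestrict
  have hs' : ∀ r : LinearMap.range T, T (s r) = r := fun r =>
    congrArg Subtype.val (LinearMap.congr_fun hs r)
  let f₀ : LinearMap.range T →L[ℂ] ℂ := (f.comp s).mkContinuous C fun r => by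
    have := h (s r)
    rwa [hs'] at this
  have hf₀ : ∀ v, f₀ (T.rangeRestrict v) = f v := fun v => by
    have h1 : T (s (T.rangeRestrict v) - v) = 0 := by rw [map_sub, hs']; simp
    have h2 := h (s (T.rangeRestrict v) - v)
    rw [h1, norm_zero, mul_zero, map_sub, norm_le_zero_iff, sub_eq_zero] at h2
    exact h2
  obtain ⟨g, hg, -⟩ := exists_extension_norm_eq (LinearMap.range T) f₀
  refine ⟨(InnerProductSpace.toDual ℂ H).symm g, fun v => ?_⟩
  rw [InnerProductSpace.toDual_symm_apply, ← hf₀ v, ← hg]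
  rfl

theorem integral_norm_mul_le_eLpNorm {Z : Type*} [MeasurableSpace Z] {μ : Measure Z} {F : Z → ℂ}
    {E : Z → ℝ} (hF : MemLp F 2 μ) (hE : MemLp E 2 μ) :
    ∫ z, ‖F z‖ * E z ∂μ ≤ (eLpNorm E 2 μ).toReal * (eLpNorm F 2 μ).toReal := by
  have h1 := norm_inner_le_norm (𝕜 := ℝ) (hE.toLp E) (hF.norm.toLp fun z => ‖F z‖)
  rw [Lp.norm_toLp, Lp.norm_toLp, eLpNorm_norm, L2.inner_def] at h1
  have h2 : ∫ z, ‖F z‖ * E z ∂μ =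
      ∫ z, inner ℝ ((hE.toLp E : Lp ℝ 2 μ) z) ((hF.norm.toLp (fun z => ‖F z‖) : Lp ℝ 2 μ) z) ∂μ := by
    refine integral_congr_ae ?_
    filter_upwards [hE.coeFn_toLp, hF.norm.coeFn_toLp] with z h3 h4
    rw [h3, h4]
    rfl
  rw [h2]
  exact (le_abs_self _).trans h1

/-- A linear functional bounded by `∫ |Φ v| E` with `E ∈ L²` is integration of `Φ v` against an
element of `L²`. -/
theorem exists_integral_repr {V Z : Type*} [AddCommGroup V] [Module ℂ V] [MeasurableSpace Z]
    {μ : Measure Z} (Φ : V →ₗ[ℂ] (Z → ℂ)) (hΦ : ∀ v, MemLp (Φ v) 2 μ) {E : Z → ℝ}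
    (hE : MemLp E 2 μ) (f : V →ₗ[ℂ] ℂ) {C : ℝ} (hC : 0 ≤ C)
    (h : ∀ v, ‖f v‖ ≤ C * ∫ z, ‖Φ v z‖ * E z ∂μ) :
    ∃ k : Z → ℂ, StronglyMeasurable k ∧ MemLp k 2 μ ∧ ∀ v, f v = ∫ z, k z * Φ v z ∂μ := by
  let T : V →ₗ[ℂ] Lp ℂ 2 μ :=
    { toFun := fun v => (hΦ v).toLp (Φ v)
      map_add' := fun v w => by
        rw [← MemLp.toLp_add]
        congr 1
        exact map_add Φ v w
      map_smul' := fun c v => by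
        rw [RingHom.id_apply, ← MemLp.toLp_const_smul]
        congr 1
        exact map_smul Φ c v }
  obtain ⟨k, hk⟩ := exists_inner_repr T f (C * (eLpNorm E 2 μ).toReal) fun v => by
    refine (h v).trans ?_
    rw [mul_assoc]
    refine mul_le_mul_of_nonneg_left ((integral_norm_mul_le_eLpNorm (hΦ v) hE).trans_eq ?_) hC
    rw [← Lp.norm_toLp _ (hΦ v)]
    rfl
  refine ⟨fun z => star (k z), (Lp.stronglyMeasurable k).star, (Lp.memLp k).star, fun v => ?_⟩
  rw [hk, L2.inner_def]
  refine integral_congr_ae ?_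
  filter_upwards [(hΦ v).coeFn_toLp] with z h3
  change inner ℂ (k z) (((hΦ v).toLp (Φ v) : Lp ℂ 2 μ) z) = _
  rw [h3, RCLike.inner_apply, mul_comm]
  rfl

/-! ### The Gabor transform of ultradistributions -/

variable {ω : Weight} {d : ℕ}

instance isAddHaarMeasure_phase (d : ℕ) : (volume : Measure (Rd d × Rd d)).IsAddHaarMeasure :=
  inferInstanceAs ((volume : Measure (Rd d)).prod (volume : Measure (Rd d))).IsAddHaarMeasure

theorem Somega.integrable_mul_star_packet (g : Somega ω d) (z : Rd d × Rd d) :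
    Integrable fun y => g y * star (packet z y) :=
  g.integrable.mul_bdd (c := 1) (continuous_packet.comp
    (continuous_const.prodMk continuous_id)).star.aestronglyMeasurable
    (Eventually.of_forall fun y => by
      rw [norm_star]
      exact (norm_packet z y).trans_le (norm_gauss_le_one _))

/-- The Gabor transform as a linear map on `S_ω`. -/
noncomputable def gaborLinear (ω : Weight) (d : ℕ) : Somega ω d →ₗ[ℂ] (Rd d × Rd d → ℂ) where
  toFun g := gabor g
  map_add' g h := by
    funext z
    simp only [gabor, Somega.coe_add, Pi.add_apply, add_mul]
    exact integral_add (g.integrable_mul_star_packet z) (h.integrable_mul_star_packet z)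
  map_smul' c g := by
    funext z
    simp only [gabor, Somega.coe_smul, Pi.smul_apply, smul_eq_mul, mul_assoc, RingHom.id_apply]
    exact integral_const_mul _ _

/-- Covariance of the transform. The explicit phase shows joint continuity in (ζ, z), and its
modulus 1 reduces estimates to translates of the transform of φ. -/
theorem gabor_shift_eq (φ : Somega ω d) (ζ z : Rd d × Rd d) :
    gabor (φ.shift ζ) z = (wave ζ.2 ζ.1 * star (wave z.2 ζ.1)) * gabor φ (z - ζ) := by
  simp only [gabor]
  rw [← integral_add_right_eq_self _ ζ.1, ← integral_const_mul]
  congr 1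
  funext y
  simp only [packet, Somega.shift_apply, star_mul', star_wave_eq_neg, wave_add_right, Prod.snd_sub,
    Prod.fst_sub, add_sub_cancel_right, neg_sub, sub_eq_add_neg ζ.2, wave_add_left]
  have : y + ζ.1 - z.1 = y - (z.1 - ζ.1) := by abel
  rw [this]
  ring

theorem norm_gabor_shift (φ : Somega ω d) (ζ z : Rd d × Rd d) :
    ‖gabor (φ.shift ζ) z‖ = ‖gabor φ (z - ζ)‖ := by
  rw [gabor_shift_eq, norm_mul, norm_mul, norm_star, norm_wave, norm_wave, one_mul, one_mul]

theorem continuous_gabor_shift (φ : Somega ω d) :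
    Continuous fun p : (Rd d × Rd d) × (Rd d × Rd d) => gabor (φ.shift p.1) p.2 := by
  simp only [gabor_shift_eq]
  refine ((continuous_wave.comp (continuous_fst.snd.prodMk continuous_fst.fst)).mul
    (continuous_wave.comp (continuous_snd.snd.prodMk continuous_fst.fst)).star).mul ?_
  exact φ.continuous_gabor.comp (continuous_snd.sub continuous_fst)

theorem exists_finset_sup_le_integral_gabor
    (s : Finset (({l : ℝ // 0 < l} × ℕ) ⊕ ({l : ℝ // 0 < l} × ℕ))) :
    ∃ C k : ℝ, 0 < C ∧ 0 < k ∧ ∀ g : Somega ω d,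
      s.sup (somegaSeminorms ω d) g ≤ C * ∫ z, ‖gabor g z‖ * Real.exp (k * ω.phase z) := by
  choose C k hC hk h using exists_seminorm_le_integral_gabor ω d
  have hCs : 0 ≤ ∑ i ∈ s, C i := Finset.sum_nonneg fun i _ => (hC i).le
  have hks : 0 ≤ ∑ i ∈ s, k i := Finset.sum_nonneg fun i _ => (hk i).le
  -- The summands 1 keep both constants positive when s is empty.
  refine ⟨∑ i ∈ s, C i + 1, ∑ i ∈ s, k i + 1, by linarith, by linarith, fun g => ?_⟩
  set I := ∫ z, ‖gabor g z‖ * Real.exp ((∑ i ∈ s, k i + 1) * ω.phase z) with hI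
  have hI0 : 0 ≤ I := integral_nonneg fun z => by positivity
  refine Seminorm.finset_sup_apply_le (by positivity) fun i hi => (h i g).trans ?_
  have h1 : ∫ z, ‖gabor g z‖ * Real.exp (k i * ω.phase z) ≤ I := by
    refine integral_mono (g.integrable_gabor_mul_exp _) (g.integrable_gabor_mul_exp _) fun z => ?_
    have := Finset.single_le_sum (fun i _ => (hk i).le) hi
    have := ω.phase_nonneg z
    gcongr
    linarith
  have h2 := Finset.single_le_sum (fun i _ => (hC i).le) hi
  refine mul_le_mul (by linarith) h1 (integral_nonneg fun z => by positivity) (by linarith)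

theorem Somega.exists_seminorm_shift_le (φ : Somega ω d)
    (s : Finset (({l : ℝ // 0 < l} × ℕ) ⊕ ({l : ℝ // 0 < l} × ℕ))) :
    ∃ C k : ℝ, 0 < C ∧ 0 < k ∧ ∀ z : Rd d × Rd d,
      s.sup (somegaSeminorms ω d) (φ.shift z) ≤ C * Real.exp (k * ω.phase z) := by
  obtain ⟨C, k, hC, hk, h⟩ := exists_finset_sup_le_integral_gabor (ω := ω) (d := d) s
  set I := ∫ z, ‖gabor φ z‖ * Real.exp (k * ω.phase z) with hI
  have hI0 : 0 ≤ I := integral_nonneg fun z => by positivity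
  refine ⟨C * (I + 1), k, by positivity, hk, fun z => (h _).trans ?_⟩
  have h1 : ∫ w, ‖gabor (φ.shift z) w‖ * Real.exp (k * ω.phase w) ≤
      Real.exp (k * ω.phase z) * I := by
    rw [hI, ← integral_sub_right_eq_self (fun w => ‖gabor φ w‖ * Real.exp (k * ω.phase w)) z,
      ← integral_const_mul]
    refine integral_mono ((φ.shift z).integrable_gabor_mul_exp k)
      (((φ.integrable_gabor_mul_exp k).comp_sub_right z).const_mul _) fun w => ?_
    simp only [norm_gabor_shift]
    have h2 : Real.exp (k * ω.phase w) ≤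
        Real.exp (k * ω.phase z) * Real.exp (k * ω.phase (w - z)) := by
      rw [← Real.exp_add]
      have := ω.phase_le_sub_add w z
      exact Real.exp_le_exp.2 (by nlinarith)
    calc _ ≤ ‖gabor φ (w - z)‖ * (Real.exp (k * ω.phase z) * Real.exp (k * ω.phase (w - z))) := by
          gcongr
      _ = _ := by ring
  calc _ ≤ C * (Real.exp (k * ω.phase z) * (I + 1)) := by
        refine mul_le_mul_of_nonneg_left (h1.trans ?_) hC.le
        gcongr
        linarith
    _ = _ := by ring

theorem SomegaDual.exists_bound (u : SomegaDual ω d) :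
    ∃ (s : Finset (({l : ℝ // 0 < l} × ℕ) ⊕ ({l : ℝ // 0 < l} × ℕ))) (C : ℝ), 0 < C ∧
      ∀ g, ‖u g‖ ≤ C * s.sup (somegaSeminorms ω d) g := by
  have hq : Continuous ((normSeminorm ℂ ℂ).comp u.toLinearMap) := continuous_norm.comp u.continuous
  obtain ⟨s, C, hC, h⟩ := Seminorm.bound_of_continuous (somega_withSeminorms ω d) _ hq
  exact ⟨s, C, by positivity, fun g => h g⟩

theorem memLp_exp_neg_phase (ω : Weight) (d : ℕ) :
    MemLp (fun z : Rd d × Rd d => Real.exp (-ω.phase z)) 2 := by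
  have hm : AEStronglyMeasurable (fun z : Rd d × Rd d => Real.exp (-ω.phase z)) volume :=
    (Real.continuous_exp.comp ω.continuous_phase.neg).aestronglyMeasurable
  rw [memLp_two_iff_integrable_sq hm]
  refine (ω.integrable_exp_neg_phase d).mono' (hm.pow 2) (Eventually.of_forall fun z => ?_)
  have h1 : Real.exp (-ω.phase z) ≤ 1 := Real.exp_le_one_iff.2 (by linarith [ω.phase_nonneg z])
  rw [Real.norm_of_nonneg (by positivity), sq]
  exact mul_le_of_le_one_right (Real.exp_pos _).le h1

theorem memLp_two_of_le_exp_neg_phase {F : Rd d × Rd d → ℂ} (hF : AEStronglyMeasurable F volume)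
    {C : ℝ} (h : ∀ z, ‖F z‖ ≤ C * Real.exp (-ω.phase z)) : MemLp F 2 := by
  refine MemLp.of_le_mul (c := C) (memLp_exp_neg_phase ω d) hF (Eventually.of_forall fun z => ?_)
  rw [Real.norm_of_nonneg (Real.exp_pos _).le]
  exact h z

/-- Every element of `S'_ω` is an integral of Gabor transforms. -/
theorem SomegaDual.exists_repr (u : SomegaDual ω d) : ∃ (K : Rd d × Rd d → ℂ) (Λ : ℝ), 0 ≤ Λ ∧
    StronglyMeasurable K ∧ Integrable (fun z => ‖K z‖ * Real.exp (-(Λ * ω.phase z))) ∧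
    ∀ g, u g = ∫ z, K z * star (gabor g z) := by
  obtain ⟨s, C, hC, hu⟩ := u.exists_bound
  obtain ⟨C', k, hC', hk, h⟩ := exists_finset_sup_le_integral_gabor (ω := ω) (d := d) s
  -- Conjugation makes the functional linear, as the L² representation requires.
  let f : Somega ω d →ₗ[ℂ] ℂ :=
    { toFun := fun g => star (u g)
      map_add' := fun g h => by rw [map_add, star_add]
      map_smul' := fun c g => by
        rw [map_smulₛₗ, smul_eq_mul, star_mul', starRingEnd_apply, star_star]
        rfl }
  -- The bound with weight e^{kω} is split as e^{(k+1)ω} · e^{-ω}, the second factor lying in L².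
  let W : Rd d × Rd d → ℂ := fun z => ((Real.exp ((k + 1) * ω.phase z) : ℝ) : ℂ)
  have hWc : Continuous W := Complex.continuous_ofReal.comp
    (Real.continuous_exp.comp (continuous_const.mul ω.continuous_phase))
  have hWn : ∀ z, ‖W z‖ = Real.exp ((k + 1) * ω.phase z) := fun z => by
    rw [Complex.norm_real, Real.norm_of_nonneg (Real.exp_pos _).le]
  let Φ : Somega ω d →ₗ[ℂ] (Rd d × Rd d → ℂ) := (LinearMap.mulLeft ℂ W).comp (gaborLinear ω d)
  have hΦ : ∀ g z, Φ g z = W z * gabor g z := fun g z => rfl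
  have hmem : ∀ g, MemLp (Φ g) 2 := fun g => by
    obtain ⟨A, hA, hg⟩ := g.exists_norm_gabor_le (k + 2)
    refine memLp_two_of_le_exp_neg_phase (ω := ω) (C := A)
      (hWc.mul g.continuous_gabor).aestronglyMeasurable fun z => ?_
    rw [hΦ, norm_mul, hWn]
    calc _ ≤ Real.exp ((k + 1) * ω.phase z) * (A * Real.exp (-((k + 2) * ω.phase z))) := by
          gcongr
          exact hg z
      _ = A * (Real.exp ((k + 1) * ω.phase z) * Real.exp (-((k + 2) * ω.phase z))) := by ring
      _ = _ := by rw [← Real.exp_add]; congr 2; ring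
  obtain ⟨q, hqm, hq2, hq⟩ := exists_integral_repr Φ hmem (memLp_exp_neg_phase ω d) f
    (C := C * C') (by positivity) fun g => by
      change ‖star (u g)‖ ≤ _
      rw [norm_star]
      refine (hu g).trans ((mul_le_mul_of_nonneg_left (h g) hC.le).trans_eq ?_)
      rw [← mul_assoc]
      congr 2
      funext z
      rw [hΦ, norm_mul, hWn, mul_comm (Real.exp _) ‖gabor g z‖, mul_assoc, ← Real.exp_add]
      congr 2
      ring
  refine ⟨fun z => star (q z * W z), k + 2, by linarith, ?_, ?_, fun g => ?_⟩
  · exact (hqm.mul hWc.stronglyMeasurable).star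
  · have h1 : Integrable fun z => ‖q z‖ * Real.exp (-ω.phase z) :=
      hq2.norm.integrable_mul (memLp_exp_neg_phase ω d)
    refine h1.congr (Eventually.of_forall fun z => ?_)
    simp only
    rw [norm_star, norm_mul, hWn, mul_assoc, ← Real.exp_add]
    congr 2
    ring
  · have h1 : star (u g) = ∫ z, q z * Φ g z := hq g
    rw [← star_star (u g), h1, ← starRingEnd_apply, ← integral_conj]
    congr 1
    funext z
    rw [hΦ]
    simp [mul_assoc]

/-- The conjugate of Moyal's formula for the packet at ζ. -/
theorem reproducing (g : Somega ω d) (ζ : Rd d × Rd d) :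
    ∫ z, gabor ((gaussS ω d).shift z) ζ * gabor g z = gaborConst d * gabor g ζ := by
  have hc : Continuous (packet ζ) := (contDiff_packet_right ζ).continuous
  have h := moyal_bounded (h := packet ζ) hc.aestronglyMeasurable (P := 1)
    (fun y => (norm_packet ζ y).trans_le (norm_gauss_le_one _)) g
  have h2 := congrArg star h
  rw [star_mul', ← starRingEnd_apply (∫ y, _), ← integral_conj, ← starRingEnd_apply (∫ y, _),
    ← integral_conj, ← starRingEnd_apply (gaborConst d : ℂ), Complex.conj_ofReal] at h2
  refine Eq.trans ?_ (h2.symm.trans ?_)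
  · congr 1
    funext z
    rw [gaussS_shift_coe, map_mul, starRingEnd_apply, starRingEnd_apply, star_star]
    congr 1
    rw [gabor, gabor, ← starRingEnd_apply, ← integral_conj]
    congr 1
    funext y
    simp [mul_comm]
  · congr 1
    rw [gabor]
    congr 1
    funext y
    simp [mul_comm]

/-- The Gabor transform `⟨u, Π(z)e^{-|·|²/2}⟩` of an ultradistribution. -/
noncomputable def SomegaDual.gaborT (u : SomegaDual ω d) (z : Rd d × Rd d) : ℂ :=
  u ((gaussS ω d).shift z)

theorem SomegaDual.exists_norm_gaborT_le (u : SomegaDual ω d) : ∃ C k : ℝ, 0 < C ∧ 0 < k ∧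
    ∀ z, ‖u.gaborT z‖ ≤ C * Real.exp (k * ω.phase z) := by
  obtain ⟨s, C, hC, hu⟩ := u.exists_bound
  obtain ⟨C', k, hC', hk, h⟩ := (gaussS ω d).exists_seminorm_shift_le s
  refine ⟨C * C', k, by positivity, hk, fun z => (hu _).trans ?_⟩
  rw [mul_assoc]
  exact mul_le_mul_of_nonneg_left (h z) hC.le

/-- The integral representation of u exhibits the transform as a parametric integral with a
measurable kernel, so continuity of z ↦ Π(z)γ in S_ω need not be shown. -/
theorem SomegaDual.stronglyMeasurable_gaborT (u : SomegaDual ω d) :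
    StronglyMeasurable u.gaborT := by
  obtain ⟨K, Λ, -, hKm, -, hK⟩ := u.exists_repr
  have e : u.gaborT = fun z => ∫ ζ, K ζ * star (gabor ((gaussS ω d).shift z) ζ) :=
    funext fun z => hK _
  rw [e]
  refine StronglyMeasurable.integral_prod_right
    (f := fun z ζ => K ζ * star (gabor ((gaussS ω d).shift z) ζ)) ?_
  exact (hKm.comp_measurable measurable_snd).mul
    (continuous_gabor_shift (gaussS ω d)).star.stronglyMeasurable

/-- Once u is written as an integral of Gabor transforms, moving it through the integral over z is
Fubini, and the reproducing formula for g collapses the inner integral. -/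
theorem SomegaDual.inversion (u : SomegaDual ω d) (g : Somega ω d) :
    gaborConst d * u g = ∫ z, u.gaborT z * star (gabor g z) := by
  obtain ⟨K, Λ, hΛ, hKm, hKi, hK⟩ := u.exists_repr
  obtain ⟨C, hC, hg⟩ := g.exists_norm_gabor_le (Λ + 1)
  obtain ⟨C', hC', hγ⟩ := (gaussS ω d).exists_norm_gabor_le Λ
  have hint : Integrable (Function.uncurry fun (z ζ : Rd d × Rd d) =>
      K ζ * star (gabor ((gaussS ω d).shift z) ζ) * star (gabor g z)) := by
    have h0 : Integrable fun p : (Rd d × Rd d) × (Rd d × Rd d) =>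
        (C * C' * Real.exp (-ω.phase p.1)) * (‖K p.2‖ * Real.exp (-(Λ * ω.phase p.2))) :=
      ((ω.integrable_exp_neg_phase d).const_mul (C * C')).mul_prod hKi
    refine h0.mono' ?_ (Eventually.of_forall fun p => ?_)
    · exact (((hKm.comp_measurable measurable_snd).mul
        (continuous_gabor_shift (gaussS ω d)).star.stronglyMeasurable).mul
        (g.continuous_gabor.comp continuous_fst).star.stronglyMeasurable).aestronglyMeasurable
    · obtain ⟨z, ζ⟩ := p
      simp only [Function.uncurry_apply_pair, norm_mul, norm_star, norm_gabor_shift]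
      calc _ ≤ ‖K ζ‖ * (C' * Real.exp (-(Λ * ω.phase (ζ - z)))) *
            (C * Real.exp (-((Λ + 1) * ω.phase z))) := by
            gcongr
            · exact hγ _
            · exact hg z
        _ = C * C' * ‖K ζ‖ * (Real.exp (-(Λ * ω.phase (ζ - z))) *
            Real.exp (-((Λ + 1) * ω.phase z))) := by ring
        _ ≤ C * C' * ‖K ζ‖ * (Real.exp (-ω.phase z) * Real.exp (-(Λ * ω.phase ζ))) := by
            rw [← Real.exp_add, ← Real.exp_add]
            have := ω.phase_le_sub_add ζ z
            refine mul_le_mul_of_nonneg_left (Real.exp_le_exp.2 ?_) (by positivity)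
            nlinarith
        _ = _ := by ring
  have e1 : ∀ z, u.gaborT z * star (gabor g z) =
      ∫ ζ, K ζ * star (gabor ((gaussS ω d).shift z) ζ) * star (gabor g z) := fun z => by
    rw [integral_mul_const, ← hK]
    rfl
  simp only [e1]
  rw [integral_integral_swap hint, hK, ← integral_const_mul]
  congr 1
  funext ζ
  have h1 := congrArg star (reproducing g ζ)
  rw [star_mul', ← starRingEnd_apply (∫ y, _), ← integral_conj,
    ← starRingEnd_apply (gaborConst d : ℂ), Complex.conj_ofReal] at h1
  rw [mul_left_comm, ← h1, ← integral_const_mul]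
  congr 1
  funext z
  rw [map_mul, starRingEnd_apply, starRingEnd_apply]
  ring

theorem Somega.gaborT_toDual (f : Somega ω d) : f.toDual.gaborT = gabor f := by
  funext z
  change ∫ y, f y * star ((gaussS ω d).shift z y) = _
  simp only [gaussS_shift_coe]
  rfl

end OmegaWF

namespace OmegaWF

/-! ### The Gabor matrix of a pseudodifferential operator -/

variable {ω : Weight} {d : ℕ} {m : ℝ} {a : Rd d × Rd d → ℂ}

theorem exists_kohnNirenberg_packet_eq (ω : Weight) (d : ℕ) : ∃ κ : ℂ,
    ∀ (a : Rd d × Rd d → ℂ) (w : Rd d × Rd d) (x : Rd d), kohnNirenberg a (packet w) x =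
      κ * wave w.2 w.1 * ∫ ξ, wave (x - w.1) ξ * a (x, ξ) * gauss (ξ - w.2) := by
  obtain ⟨κ, -, h⟩ := ft_packet ω (d := d)
  refine ⟨((2 * Real.pi : ℝ) : ℂ)⁻¹ ^ d * κ, fun a w x => ?_⟩
  rw [kohnNirenberg, mul_assoc, mul_assoc]
  congr 1
  rw [← integral_const_mul, ← integral_const_mul]
  congr 1
  funext ξ
  rw [h, packet]
  rw [sub_eq_add_neg x, wave_add_left, wave_comm x ξ]
  change wave ξ x * _ * _ = _
  ring

theorem IsSymbol.continuous (ha : IsSymbol ω m a) : Continuous a := ha.1.continuous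

theorem continuous_knIntegrand (ha : Continuous a) : Continuous
    fun p : ((Rd d × Rd d) × Rd d) × Rd d =>
      wave (p.1.2 - p.1.1.1) p.2 * a (p.1.2, p.2) * gauss (p.2 - p.1.1.2) :=
  ((continuous_wave.comp ((continuous_fst.snd.sub continuous_fst.fst.fst).prodMk
    continuous_snd)).mul (ha.comp (continuous_fst.snd.prodMk continuous_snd))).mul
    (continuous_gauss.comp (continuous_snd.sub continuous_fst.fst.snd))

theorem stronglyMeasurable_kohnNirenberg_packet (ω : Weight) (ha : Continuous a) :
    StronglyMeasurable fun p : (Rd d × Rd d) × Rd d => kohnNirenberg a (packet p.1) p.2 := by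
  obtain ⟨κ, h⟩ := exists_kohnNirenberg_packet_eq ω d
  simp only [h]
  refine StronglyMeasurable.mul ?_ ?_
  · exact (continuous_const.mul (continuous_wave.comp
      (continuous_fst.snd.prodMk continuous_fst.fst))).stronglyMeasurable
  · exact StronglyMeasurable.integral_prod_right (f := fun (p : (Rd d × Rd d) × Rd d) ξ =>
      wave (p.2 - p.1.1) ξ * a (p.2, ξ) * gauss (ξ - p.1.2))
      (continuous_knIntegrand ha).stronglyMeasurable

theorem IsSymbol.contDiff_fst (ha : IsSymbol ω m a) (ξ : Rd d) :
    ContDiff ℝ (⊤ : ℕ∞) fun x => a (x, ξ) := ha.1.comp (contDiff_id.prodMk contDiff_const)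

theorem IsSymbol.contDiff_snd (ha : IsSymbol ω m a) (x : Rd d) :
    ContDiff ℝ (⊤ : ℕ∞) fun ξ => a (x, ξ) := ha.1.comp (contDiff_const.prodMk contDiff_id)

/-- At x the function a(x,D)Π(w)γ is, up to a phase and a constant, the Fourier transform in ξ of
a(x, ·) cut off around the frequency of w, taken at w.1 - x. The ξ-regularity of a gives the decay.
-/
theorem IsSymbol.exists_norm_kn_packet_le (ha : IsSymbol ω m a) {l : ℝ} (hl : 0 < l) :
    ∃ C : ℝ, 0 < C ∧ ∀ (w : Rd d × Rd d) (x : Rd d), ‖kohnNirenberg a (packet w) x‖ ≤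
      C * Real.exp (|m| * ω ‖w.2‖) * Real.exp (-(l * ω ‖x - w.1‖)) := by
  obtain ⟨κ, h⟩ := exists_kohnNirenberg_packet_eq ω d
  obtain ⟨l', hl', K, hK, hosc⟩ := exists_ft_mul_gauss_le ω d (abs_nonneg m) hl
  obtain ⟨A, hA, hs⟩ := ha.exists_bound hl'
  refine ⟨(‖κ‖ + 1) * (K * A), by positivity, fun w x => ?_⟩
  have h1 := hosc (fun ξ => a (x, ξ)) A hA.le (ha.contDiff_snd x) (fun n ξ => (hs x ξ n).2)
    w.2 (w.1 - x)
  have e : ∫ ξ, wave (x - w.1) ξ * a (x, ξ) * gauss (ξ - w.2) =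
      ft (fun ξ => a (x, ξ) * gauss (ξ - w.2)) (w.1 - x) := by
    rw [ft_eq_integral_wave]
    congr 1
    funext ξ
    rw [star_wave_eq_neg, neg_sub]
    ring
  rw [h, e, norm_mul, norm_mul, norm_wave, mul_one, norm_sub_rev x]
  calc _ ≤ (‖κ‖ + 1) * (K * A * Real.exp (|m| * ω ‖w.2‖) * Real.exp (-(l * ω ‖w.1 - x‖))) := by
        gcongr
        linarith
    _ = _ := by ring

/-- The matrix coefficient `⟨a(x,D)Π(w)γ, Π(z)γ⟩` with the Gaussian `γ`. -/
noncomputable def knMatrix (a : Rd d × Rd d → ℂ) (w z : Rd d × Rd d) : ℂ :=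
  gabor (kohnNirenberg a (packet w)) z

theorem integrable_exp_neg_weight_sub (ω : Weight) (c : Rd d) :
    Integrable fun x : Rd d => Real.exp (-ω ‖x - c‖) :=
  (integrable_exp_neg_weight ω d).comp_sub_right c

theorem integral_exp_neg_weight_sub (ω : Weight) (c : Rd d) :
    ∫ x : Rd d, Real.exp (-ω ‖x - c‖) = ∫ x : Rd d, Real.exp (-ω ‖x‖) :=
  integral_sub_right_eq_self (fun x : Rd d => Real.exp (-ω ‖x‖)) c

theorem IsSymbol.exists_norm_knMatrix_le_fst (ha : IsSymbol ω m a) {l : ℝ} (hl : 0 < l) :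
    ∃ C : ℝ, 0 < C ∧ ∀ w z : Rd d × Rd d, ‖knMatrix a w z‖ ≤
      C * Real.exp (|m| * ω ‖w.2‖) * Real.exp (-(l * ω ‖w.1 - z.1‖)) := by
  obtain ⟨C, hC, h⟩ := ha.exists_norm_kn_packet_le hl
  obtain ⟨C', hC', hg⟩ := exists_norm_gauss_le ω d (l + 1)
  set I := ∫ v : Rd d, Real.exp (-ω ‖v‖) with hI
  have hI0 : 0 ≤ I := integral_nonneg fun v => (Real.exp_pos _).le
  refine ⟨C * C' * (I + 1), by positivity, fun w z => ?_⟩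
  refine (norm_integral_le_of_norm_le ((integrable_exp_neg_weight_sub ω z.1).const_mul
    (C * C' * Real.exp (|m| * ω ‖w.2‖) * Real.exp (-(l * ω ‖w.1 - z.1‖))))
    (Eventually.of_forall fun x => ?_)).trans ?_
  · rw [norm_mul, norm_star, norm_packet]
    calc _ ≤ (C * Real.exp (|m| * ω ‖w.2‖) * Real.exp (-(l * ω ‖x - w.1‖))) *
          (C' * Real.exp (-((l + 1) * ω ‖x - z.1‖))) := by
          gcongr
          · exact h w x
          · exact hg _
      _ = (C * C' * Real.exp (|m| * ω ‖w.2‖)) * (Real.exp (-(l * ω ‖x - w.1‖)) *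
          Real.exp (-((l + 1) * ω ‖x - z.1‖))) := by ring
      _ ≤ (C * C' * Real.exp (|m| * ω ‖w.2‖)) * (Real.exp (-(l * ω ‖w.1 - z.1‖)) *
          Real.exp (-ω ‖x - z.1‖)) := by
          rw [← Real.exp_add, ← Real.exp_add]
          refine mul_le_mul_of_nonneg_left (Real.exp_le_exp.2 ?_) (by positivity)
          have := ω.norm_add_le (w.1 - x) (x - z.1)
          rw [sub_add_sub_cancel, norm_sub_rev w.1 x] at this
          nlinarith
      _ = _ := by ring
  · rw [integral_const_mul, integral_exp_neg_weight_sub, ← hI]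
    calc _ ≤ (C * C' * Real.exp (|m| * ω ‖w.2‖) * Real.exp (-(l * ω ‖w.1 - z.1‖))) * (I + 1) := by
          gcongr
          linarith
      _ = _ := by ring

/-- Bounds for the integrand of the matrix coefficients. -/
theorem IsSymbol.exists_norm_integrand_le (ha : IsSymbol ω m a) (l : ℝ) :
    ∃ C : ℝ, 0 < C ∧ ∀ (w z : Rd d × Rd d) (x ξ : Rd d),
      ‖wave (x - w.1) ξ * a (x, ξ) * gauss (ξ - w.2)‖ * ‖gauss (x - z.1)‖ ≤
        C * Real.exp (|m| * ω ‖w.2‖) * (Real.exp (-((l + 1) * ω ‖x - z.1‖)) *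
          Real.exp (-((l + 1) * ω ‖ξ - w.2‖))) := by
  obtain ⟨A, hA, hs⟩ := ha.norm_le
  obtain ⟨C, hC, hg⟩ := exists_norm_gauss_le ω d (l + 1)
  obtain ⟨C', hC', hg'⟩ := exists_norm_gauss_le ω d (l + 1 + |m|)
  refine ⟨A * C * C', by positivity, fun w z x ξ => ?_⟩
  rw [norm_mul, norm_mul, norm_wave, one_mul]
  calc _ ≤ (A * Real.exp (|m| * ω ‖ξ‖)) * (C' * Real.exp (-((l + 1 + |m|) * ω ‖ξ - w.2‖))) *
        (C * Real.exp (-((l + 1) * ω ‖x - z.1‖))) := by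
        gcongr
        · exact hs x ξ
        · exact hg' _
        · exact hg _
    _ = (A * C * C') * Real.exp (-((l + 1) * ω ‖x - z.1‖)) * (Real.exp (|m| * ω ‖ξ‖) *
        Real.exp (-((l + 1 + |m|) * ω ‖ξ - w.2‖))) := by ring
    _ ≤ (A * C * C') * Real.exp (-((l + 1) * ω ‖x - z.1‖)) * (Real.exp (|m| * ω ‖w.2‖) *
        Real.exp (-((l + 1) * ω ‖ξ - w.2‖))) := by
        rw [← Real.exp_add (|m| * ω ‖ξ‖), ← Real.exp_add (|m| * ω ‖w.2‖)]
        refine mul_le_mul_of_nonneg_left (Real.exp_le_exp.2 ?_) (by positivity)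
        have := ω.norm_add_le (ξ - w.2) w.2
        rw [sub_add_cancel] at this
        have := mul_le_mul_of_nonneg_left this (abs_nonneg m)
        linarith
    _ = _ := by ring

theorem exists_knMatrix_eq (ω : Weight) (d : ℕ) : ∃ κ : ℂ,
    ∀ (a : Rd d × Rd d → ℂ) (w z : Rd d × Rd d), knMatrix a w z = κ * wave w.2 w.1 *
      ∫ x, ∫ ξ, wave (x - w.1) ξ * a (x, ξ) * gauss (ξ - w.2) *
        (star (wave z.2 x) * gauss (x - z.1)) := by
  obtain ⟨κ, h⟩ := exists_kohnNirenberg_packet_eq ω d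
  refine ⟨κ, fun a w z => ?_⟩
  rw [knMatrix, gabor, ← integral_const_mul]
  congr 1
  funext x
  rw [integral_mul_const, h, packet, star_mul', star_gauss]
  ring

/-- With the x-integral innermost, it becomes the Fourier transform of a(·, ξ) cut off around z.1,
taken at z.2 - ξ. The x-regularity of a gives decay there, and the Gaussian centred at w.2 carries
it over to w.2 - z.2. -/
theorem IsSymbol.exists_norm_knMatrix_le_snd (ha : IsSymbol ω m a) {l : ℝ} (hl : 0 < l) :
    ∃ C : ℝ, 0 < C ∧ ∀ w z : Rd d × Rd d, ‖knMatrix a w z‖ ≤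
      C * Real.exp (|m| * ω ‖w.2‖) * Real.exp (-(l * ω ‖w.2 - z.2‖)) := by
  obtain ⟨κ, hκ⟩ := exists_knMatrix_eq ω d
  -- In x the amplitude has no growth, so M = 0; the growth e^{|m|ω(ξ)} belongs to the constant of
  -- the family.
  obtain ⟨l', hl', K, hK, hosc⟩ := exists_ft_mul_gauss_le ω d le_rfl hl
  obtain ⟨A, hA, hs⟩ := ha.exists_bound hl'
  obtain ⟨C', hC', hg⟩ := exists_norm_gauss_le ω d (l + 1 + |m|)
  obtain ⟨C₁, hC₁, hint₁⟩ := ha.exists_norm_integrand_le 0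
  set I := ∫ v : Rd d, Real.exp (-ω ‖v‖) with hI
  have hI0 : 0 ≤ I := integral_nonneg fun v => (Real.exp_pos _).le
  refine ⟨(‖κ‖ + 1) * (C' * K * A) * (I + 1), by positivity, fun w z => ?_⟩
  have hint : Integrable (Function.uncurry fun x ξ : Rd d =>
      wave (x - w.1) ξ * a (x, ξ) * gauss (ξ - w.2) * (star (wave z.2 x) * gauss (x - z.1))) := by
    have h0 : Integrable fun p : Rd d × Rd d => (C₁ * Real.exp (|m| * ω ‖w.2‖) *
        Real.exp (-ω ‖p.1 - z.1‖)) * Real.exp (-ω ‖p.2 - w.2‖) :=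
      ((integrable_exp_neg_weight_sub ω z.1).const_mul _).mul_prod
        (integrable_exp_neg_weight_sub ω w.2)
    refine h0.mono' ?_ (Eventually.of_forall fun p => ?_)
    · refine Continuous.aestronglyMeasurable ?_
      exact ((continuous_knIntegrand ha.continuous).comp
        ((continuous_const.prodMk continuous_fst).prodMk continuous_snd)).mul
        ((continuous_wave.comp (continuous_const.prodMk continuous_fst)).star.mul
          (continuous_gauss.comp (continuous_fst.sub continuous_const)))
    · obtain ⟨x, ξ⟩ := p
      have := hint₁ w z x ξ
      simp only [Function.uncurry_apply_pair]
      rw [norm_mul, norm_mul (star _), norm_star, norm_wave, one_mul]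
      refine this.trans (le_of_eq ?_)
      rw [zero_add, one_mul, one_mul]
      ring
  have e : ∀ ξ, ∫ x, wave (x - w.1) ξ * a (x, ξ) * gauss (ξ - w.2) *
      (star (wave z.2 x) * gauss (x - z.1)) =
      wave (-w.1) ξ * gauss (ξ - w.2) * ft (fun x => a (x, ξ) * gauss (x - z.1)) (z.2 - ξ) := by
    intro ξ
    rw [ft_eq_integral_wave, ← integral_const_mul]
    congr 1
    funext x
    rw [sub_eq_add_neg x, wave_add_left, star_wave_eq_neg, star_wave_eq_neg, neg_sub,
      sub_eq_add_neg ξ z.2, wave_add_left, wave_comm x ξ]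
    ring
  have hb : ‖∫ x, ∫ ξ, wave (x - w.1) ξ * a (x, ξ) * gauss (ξ - w.2) *
      (star (wave z.2 x) * gauss (x - z.1))‖ ≤
      (C' * K * A) * Real.exp (|m| * ω ‖w.2‖) * Real.exp (-(l * ω ‖w.2 - z.2‖)) * I := by
    rw [integral_integral_swap hint]
    simp only [e]
    refine (norm_integral_le_of_norm_le ((integrable_exp_neg_weight_sub ω w.2).const_mul
      ((C' * K * A) * Real.exp (|m| * ω ‖w.2‖) * Real.exp (-(l * ω ‖w.2 - z.2‖))))
      (Eventually.of_forall fun ξ => ?_)).trans ?_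
    · have h1 := hosc (fun x => a (x, ξ)) (A * Real.exp (|m| * ω ‖ξ‖)) (by positivity)
        (ha.contDiff_fst ξ) (fun n x => by
          rw [zero_mul, Real.exp_zero, mul_one]
          exact (hs x ξ n).1) z.1 (z.2 - ξ)
      rw [zero_mul, Real.exp_zero, mul_one] at h1
      rw [norm_mul, norm_mul, norm_wave, one_mul]
      calc _ ≤ (C' * Real.exp (-((l + 1 + |m|) * ω ‖ξ - w.2‖))) *
            (K * (A * Real.exp (|m| * ω ‖ξ‖)) * Real.exp (-(l * ω ‖z.2 - ξ‖))) := by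
            gcongr
            exact hg _
        _ = (C' * K * A) * (Real.exp (-((l + 1 + |m|) * ω ‖ξ - w.2‖)) *
            Real.exp (|m| * ω ‖ξ‖) * Real.exp (-(l * ω ‖z.2 - ξ‖))) := by ring
        _ ≤ (C' * K * A) * (Real.exp (|m| * ω ‖w.2‖) * Real.exp (-(l * ω ‖w.2 - z.2‖)) *
            Real.exp (-ω ‖ξ - w.2‖)) := by
            simp only [← Real.exp_add]
            refine mul_le_mul_of_nonneg_left (Real.exp_le_exp.2 ?_) (by positivity)
            have h2 := ω.norm_add_le (ξ - w.2) w.2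
            rw [sub_add_cancel] at h2
            have h3 := mul_le_mul_of_nonneg_left h2 (abs_nonneg m)
            have h4 := ω.norm_add_le (w.2 - ξ) (ξ - z.2)
            rw [sub_add_sub_cancel, norm_sub_rev w.2 ξ, norm_sub_rev ξ z.2] at h4
            have h5 := mul_le_mul_of_nonneg_left h4 hl.le
            linarith
        _ = _ := by ring
    · rw [integral_const_mul, integral_exp_neg_weight_sub]
  rw [hκ, norm_mul, norm_mul, norm_wave, mul_one]
  calc _ ≤ (‖κ‖ + 1) * ((C' * K * A) * Real.exp (|m| * ω ‖w.2‖) *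
        Real.exp (-(l * ω ‖w.2 - z.2‖)) * (I + 1)) := by
        gcongr
        · linarith
        · refine hb.trans ?_
          gcongr
          linarith
    _ = _ := by ring

theorem IsSymbol.exists_norm_knMatrix_le (ha : IsSymbol ω m a) {l : ℝ} (hl : 0 < l) :
    ∃ C : ℝ, 0 < C ∧ ∀ w z : Rd d × Rd d, ‖knMatrix a w z‖ ≤
      C * Real.exp (|m| * ω.phase w) * Real.exp (-(l * ω.phase (w - z))) := by
  obtain ⟨C₁, hC₁, h₁⟩ := ha.exists_norm_knMatrix_le_fst (l := 2 * l) (by positivity)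
  obtain ⟨C₂, hC₂, h₂⟩ := ha.exists_norm_knMatrix_le_snd (l := 2 * l) (by positivity)
  refine ⟨C₁ + C₂, by positivity, fun w z => ?_⟩
  have hle : Real.exp (|m| * ω ‖w.2‖) ≤ Real.exp (|m| * ω.phase w) := by
    refine Real.exp_le_exp.2 (mul_le_mul_of_nonneg_left ?_ (abs_nonneg m))
    have := ω.nonneg _ (norm_nonneg w.1)
    simp only [Weight.phase]
    linarith
  rcases le_total (ω ‖w.1 - z.1‖) (ω ‖w.2 - z.2‖) with h | h
  · refine (h₂ w z).trans (mul_le_mul (mul_le_mul (by linarith) hle (Real.exp_pos _).le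
      (by positivity)) (Real.exp_le_exp.2 ?_) (Real.exp_pos _).le (by positivity))
    simp only [Weight.phase, Prod.fst_sub, Prod.snd_sub]
    nlinarith
  · refine (h₁ w z).trans (mul_le_mul (mul_le_mul (by linarith) hle (Real.exp_pos _).le
      (by positivity)) (Real.exp_le_exp.2 ?_) (Real.exp_pos _).le (by positivity))
    simp only [Weight.phase, Prod.fst_sub, Prod.snd_sub]
    nlinarith

/-- If `a` vanishes near `z`, then the matrix coefficients `⟨a(x,D)Π(w)γ, Π(z)γ⟩` are small. -/
theorem IsSymbol.exists_norm_knMatrix_le_of_support (ha : IsSymbol ω m a) {l : ℝ} (hl : 0 ≤ l) :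
    ∃ C : ℝ, 0 < C ∧ ∀ (w z : Rd d × Rd d) (R : ℝ),
      (∀ p, a p ≠ 0 → R ≤ ω.phase (p - z)) → ‖knMatrix a w z‖ ≤
      C * Real.exp (|m| * ω.phase w) * Real.exp (l * ω.phase (w - z)) * Real.exp (-(l * R)) := by
  obtain ⟨κ, hκ⟩ := exists_knMatrix_eq ω d
  obtain ⟨C, hC, hint⟩ := ha.exists_norm_integrand_le l
  set I := ∫ v : Rd d, Real.exp (-ω ‖v‖) with hI
  have hI0 : 0 ≤ I := integral_nonneg fun v => (Real.exp_pos _).le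
  refine ⟨(‖κ‖ + 1) * (C * (I * I + 1)), by positivity, fun w z R hR => ?_⟩
  set P := C * Real.exp (|m| * ω.phase w) * Real.exp (l * ω.phase (w - z)) *
    Real.exp (-(l * R)) with hP
  have hP0 : 0 ≤ P := by positivity
  have hpt : ∀ x ξ, ‖wave (x - w.1) ξ * a (x, ξ) * gauss (ξ - w.2) *
      (star (wave z.2 x) * gauss (x - z.1))‖ ≤
      P * Real.exp (-ω ‖x - z.1‖) * Real.exp (-ω ‖ξ - w.2‖) := by
    intro x ξ
    by_cases h0 : a (x, ξ) = 0
    · rw [h0]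
      simp only [mul_zero, zero_mul, norm_zero]
      positivity
    rw [norm_mul, norm_mul (star _), norm_star, norm_wave, one_mul]
    refine (hint w z x ξ).trans ?_
    calc _ ≤ C * (Real.exp (|m| * ω.phase w) * Real.exp (l * ω.phase (w - z)) *
          Real.exp (-(l * R)) * (Real.exp (-ω ‖x - z.1‖) * Real.exp (-ω ‖ξ - w.2‖))) := by
          rw [mul_assoc]
          simp only [← Real.exp_add]
          refine mul_le_mul_of_nonneg_left (Real.exp_le_exp.2 ?_) hC.le
          have h1 := hR _ h0
          have h2 := ω.norm_add_le (ξ - w.2) (w.2 - z.2)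
          rw [sub_add_sub_cancel] at h2
          have h3 : ω ‖w.2 - z.2‖ ≤ ω.phase (w - z) := by
            have := ω.nonneg _ (norm_nonneg (w.1 - z.1))
            simp only [Weight.phase, Prod.fst_sub, Prod.snd_sub]
            linarith
          have h4 : ω ‖w.2‖ ≤ ω.phase w := by
            have := ω.nonneg _ (norm_nonneg w.1)
            simp only [Weight.phase]
            linarith
          -- The Gaussians are centred at z.1 and at w.2, not both at z; the discrepancy is the loss
          -- e^{lω(w-z)}. Oscillation plays no role here.
          have h5 : R ≤ ω ‖x - z.1‖ + ω ‖ξ - w.2‖ + ω.phase (w - z) := by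
            simp only [Weight.phase, Prod.fst_sub, Prod.snd_sub] at h1 h3 ⊢
            linarith
          have h6 := mul_le_mul_of_nonneg_left h5 hl
          have h7 := mul_le_mul_of_nonneg_left h4 (abs_nonneg m)
          linarith
      _ = _ := by rw [hP]; ring
  have hin : ∀ x, ‖∫ ξ, wave (x - w.1) ξ * a (x, ξ) * gauss (ξ - w.2) *
      (star (wave z.2 x) * gauss (x - z.1))‖ ≤ P * I * Real.exp (-ω ‖x - z.1‖) := fun x => by
    refine (norm_integral_le_of_norm_le ((integrable_exp_neg_weight_sub ω w.2).const_mul _)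
      (Eventually.of_forall (hpt x))).trans (le_of_eq ?_)
    rw [integral_const_mul, integral_exp_neg_weight_sub, ← hI]
    ring
  have hout : ‖∫ x, ∫ ξ, wave (x - w.1) ξ * a (x, ξ) * gauss (ξ - w.2) *
      (star (wave z.2 x) * gauss (x - z.1))‖ ≤ P * (I * I) := by
    refine (norm_integral_le_of_norm_le ((integrable_exp_neg_weight_sub ω z.1).const_mul _)
      (Eventually.of_forall hin)).trans (le_of_eq ?_)
    rw [integral_const_mul, integral_exp_neg_weight_sub, ← hI]
    ring
  rw [hκ, norm_mul, norm_mul, norm_wave, mul_one]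
  calc _ ≤ (‖κ‖ + 1) * (P * (I * I + 1)) := by
        gcongr
        · linarith
        · refine hout.trans ?_
          gcongr
          linarith
    _ = _ := by rw [hP]; ring

end OmegaWF

namespace OmegaWF

/-! ### The operator on ultradistributions -/

variable {ω : Weight} {d : ℕ} {m : ℝ} {a : Rd d × Rd d → ℂ}

/-- The pairing `⟨a(x,D)Π(w)γ, g⟩` with the Gaussian `γ`. -/
noncomputable def knPairing (a : Rd d × Rd d → ℂ) (g : Rd d → ℂ) (w : Rd d × Rd d) : ℂ :=
  ∫ x, kohnNirenberg a (packet w) x * star (g x)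

theorem stronglyMeasurable_kn_packet_right (ω : Weight) (ha : Continuous a) (w : Rd d × Rd d) :
    StronglyMeasurable fun x => kohnNirenberg a (packet w) x :=
  (stronglyMeasurable_kohnNirenberg_packet ω ha).comp_measurable
    (g := fun x : Rd d => (w, x)) measurable_prodMk_left

theorem IsSymbol.exists_norm_kn_packet_le_const (ha : IsSymbol ω m a) :
    ∃ C : ℝ, 0 < C ∧ ∀ (w : Rd d × Rd d) (x : Rd d), ‖kohnNirenberg a (packet w) x‖ ≤
      C * Real.exp (|m| * ω.phase w) := by
  obtain ⟨C, hC, h⟩ := ha.exists_norm_kn_packet_le one_pos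
  refine ⟨C, hC, fun w x => (h w x).trans ?_⟩
  rw [mul_assoc, ← Real.exp_add]
  refine mul_le_mul_of_nonneg_left (Real.exp_le_exp.2 ?_) hC.le
  have h1 := ω.nonneg _ (norm_nonneg (x - w.1))
  have h2 := mul_nonneg (abs_nonneg m) (ω.nonneg _ (norm_nonneg w.1))
  simp only [Weight.phase]
  linarith

theorem IsSymbol.gaborConst_mul_knPairing (ha : IsSymbol ω m a) (g : Somega ω d)
    (w : Rd d × Rd d) :
    gaborConst d * knPairing a g w = ∫ z, knMatrix a w z * star (gabor g z) := by
  obtain ⟨C, -, h⟩ := ha.exists_norm_kn_packet_le_const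
  exact moyal_bounded
    (stronglyMeasurable_kn_packet_right ω ha.continuous w).aestronglyMeasurable (h w) g

theorem IsSymbol.stronglyMeasurable_knPairing (ha : IsSymbol ω m a) (g : Somega ω d) :
    StronglyMeasurable (knPairing a g) :=
  StronglyMeasurable.integral_prod_right
    (f := fun (w : Rd d × Rd d) x => kohnNirenberg a (packet w) x * star (g x))
    ((stronglyMeasurable_kohnNirenberg_packet ω ha.continuous).mul
      (g.continuous.comp continuous_snd).star.stronglyMeasurable)

theorem knPairing_gaussS_shift (a : Rd d × Rd d → ℂ) (w z : Rd d × Rd d) :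
    knPairing a ((gaussS ω d).shift z) w = knMatrix a w z := by
  simp only [knPairing, gaussS_shift_coe]
  rfl

/-- By Moyal's formula the pairing is the matrix integrated against the transform of g. A decay rate
of l + |m| off the diagonal absorbs the growth in w, and g enters through one seminorm only. This
decay makes the pairing integrable against the transform of any ultradistribution. -/
theorem IsSymbol.exists_norm_knPairing_le (ha : IsSymbol ω m a) {l : ℝ} (hl : 0 < l) :
    ∃ (C : ℝ) (L : {l : ℝ // 0 < l}), 0 < C ∧ ∀ (g : Somega ω d) (w : Rd d × Rd d),
      ‖knPairing a g w‖ ≤ C * seminormZero ω d L g * Real.exp (-(l * ω.phase w)) := by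
  have hM := abs_nonneg m
  obtain ⟨C₁, hC₁, h₁⟩ := ha.exists_norm_knMatrix_le (l := l + |m|) (by positivity)
  obtain ⟨C₂, hC₂, h₂⟩ := exists_norm_gabor_le ω d (l := l + |m| + 1) (by positivity)
  set I := ∫ z : Rd d × Rd d, Real.exp (-ω.phase z) with hI
  have hI0 : 0 ≤ I := integral_nonneg fun v => (Real.exp_pos _).le
  have hc := gaborConst_pos d
  refine ⟨(gaborConst d)⁻¹ * (C₁ * C₂ * (I + 1)), ⟨2 * (l + |m| + 1), by positivity⟩, by positivity, fun g w => ?_⟩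
  set p := seminormZero ω d ⟨2 * (l + |m| + 1), by positivity⟩ g with hp
  have hp0 : 0 ≤ p := apply_nonneg _ _
  have hb : ‖∫ z, knMatrix a w z * star (gabor g z)‖ ≤
      C₁ * C₂ * p * Real.exp (-(l * ω.phase w)) * I := by
    rw [hI, ← integral_const_mul]
    refine norm_integral_le_of_norm_le ((ω.integrable_exp_neg_phase d).const_mul _)
      (Eventually.of_forall fun z => ?_)
    rw [norm_mul, norm_star]
    calc _ ≤ (C₁ * Real.exp (|m| * ω.phase w) * Real.exp (-((l + |m|) * ω.phase (w - z)))) *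
          (C₂ * p * Real.exp (-((l + |m| + 1) * ω.phase z))) := by
          gcongr
          · exact h₁ w z
          · exact h₂ g z
      _ = C₁ * C₂ * p * (Real.exp (|m| * ω.phase w) * Real.exp (-((l + |m|) * ω.phase (w - z))) *
          Real.exp (-((l + |m| + 1) * ω.phase z))) := by ring
      _ ≤ C₁ * C₂ * p * (Real.exp (-(l * ω.phase w)) * Real.exp (-ω.phase z)) := by
          simp only [← Real.exp_add]
          refine mul_le_mul_of_nonneg_left (Real.exp_le_exp.2 ?_) (by positivity)
          have := mul_le_mul_of_nonneg_left (ω.phase_le_sub_add w z)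
            (by positivity : 0 ≤ l + |m|)
          linarith
      _ = _ := by ring
  have e : knPairing a g w = (gaborConst d : ℂ)⁻¹ * ∫ z, knMatrix a w z * star (gabor g z) := by
    rw [← ha.gaborConst_mul_knPairing, inv_mul_cancel_left₀ (gaborConst_ne_zero d)]
  rw [e, norm_mul, norm_inv, Complex.norm_real, Real.norm_of_nonneg hc.le]
  calc _ ≤ (gaborConst d)⁻¹ * (C₁ * C₂ * p * Real.exp (-(l * ω.phase w)) * (I + 1)) := by
        refine mul_le_mul_of_nonneg_left (hb.trans ?_) (by positivity)
        gcongr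
        linarith
    _ = _ := by ring

theorem IsSymbol.gaborConst_mul_kohnNirenberg (ha : IsSymbol ω m a) (f : Somega ω d) (x : Rd d) :
    gaborConst d * kohnNirenberg a f x = ∫ w, gabor f w * kohnNirenberg a (packet w) x := by
  obtain ⟨κ, -, hκ⟩ := ft_packet ω (d := d)
  obtain ⟨A, hA, hs⟩ := ha.norm_le
  obtain ⟨C, hC, hg⟩ := exists_norm_gauss_le ω d (|m| + 1)
  have hint : Integrable (Function.uncurry fun (w : Rd d × Rd d) (ξ : Rd d) =>
      gabor f w * (Complex.exp (Complex.I * (inner ℝ x ξ : ℝ)) * a (x, ξ) * ft (packet w) ξ)) := by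
    have h0 : Integrable fun p : (Rd d × Rd d) × Rd d =>
        (A * ‖κ‖ * C * (‖gabor f p.1‖ * Real.exp ((|m| + 1) * ω.phase p.1))) *
          Real.exp (-ω ‖p.2‖) :=
      ((f.integrable_gabor_mul_exp _).const_mul _).mul_prod (integrable_exp_neg_weight ω d)
    refine h0.mono' ?_ (Eventually.of_forall fun p => ?_)
    · simp only [hκ]
      refine Continuous.aestronglyMeasurable ?_
      refine (f.continuous_gabor.comp continuous_fst).mul (Continuous.mul (Continuous.mul ?_ ?_)
        (Continuous.mul ?_ ?_))
      · exact continuous_wave.comp (continuous_snd.prodMk continuous_const)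
      · exact ha.continuous.comp (continuous_const.prodMk continuous_snd)
      · exact continuous_const.mul (continuous_wave.comp
          (continuous_fst.snd.prodMk continuous_fst.fst))
      · exact (continuous_wave.comp (continuous_fst.fst.neg.prodMk continuous_snd)).mul
          (continuous_gauss.comp (continuous_snd.sub continuous_fst.snd))
    · obtain ⟨w, ξ⟩ := p
      have hw : ‖Complex.exp (Complex.I * (inner ℝ x ξ : ℝ))‖ = 1 := norm_wave ξ x
      simp only [Function.uncurry_apply_pair, hκ, norm_mul, norm_packet, norm_wave, mul_one, hw,
        one_mul]
      calc _ ≤ ‖gabor f w‖ * ((A * Real.exp (|m| * ω ‖ξ‖)) *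
            (‖κ‖ * (C * Real.exp (-((|m| + 1) * ω ‖ξ - w.2‖))))) := by
            gcongr
            · exact hs x ξ
            · exact hg _
        _ = A * ‖κ‖ * C * ‖gabor f w‖ * (Real.exp (|m| * ω ‖ξ‖) *
            Real.exp (-((|m| + 1) * ω ‖ξ - w.2‖))) := by ring
        _ ≤ A * ‖κ‖ * C * ‖gabor f w‖ * (Real.exp ((|m| + 1) * ω.phase w) *
            Real.exp (-ω ‖ξ‖)) := by
            simp only [← Real.exp_add]
            refine mul_le_mul_of_nonneg_left (Real.exp_le_exp.2 ?_) (by positivity)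
            have h1 := ω.norm_add_le (ξ - w.2) w.2
            rw [sub_add_cancel] at h1
            have h2 := ω.nonneg _ (norm_nonneg w.1)
            have hM : 0 ≤ |m| + 1 := by positivity
            have h3 := mul_le_mul_of_nonneg_left h1 hM
            have h4 := mul_nonneg hM h2
            simp only [Weight.phase]
            linarith
        _ = _ := by ring
  simp only [kohnNirenberg]
  rw [mul_left_comm, ← integral_const_mul]
  have e1 : ∀ ξ, gaborConst d * (Complex.exp (Complex.I * (inner ℝ x ξ : ℝ)) * a (x, ξ) * ft f ξ) =
      ∫ w, gabor f w * (Complex.exp (Complex.I * (inner ℝ x ξ : ℝ)) * a (x, ξ) *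
        ft (packet w) ξ) := fun ξ => by
    rw [mul_left_comm, f.ft_eq_integral, ← integral_const_mul]
    congr 1
    funext w
    ring
  simp only [e1]
  rw [← integral_integral_swap hint, ← integral_const_mul]
  congr 1
  funext w
  rw [integral_const_mul, mul_left_comm]

/-- Expanding f into packets reduces the pairing to a double integral that converges absolutely;
Fubini yields both integrability in x and the formula by which the operator is defined on the dual.
-/
theorem IsSymbol.integrable_kn_pairing (ha : IsSymbol ω m a) (f g : Somega ω d) :
    Integrable (fun x => kohnNirenberg a f x * star (g x)) ∧
      gaborConst d * ∫ x, kohnNirenberg a f x * star (g x) =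
        ∫ w, gabor f w * knPairing a g w := by
  obtain ⟨C, hC, hk⟩ := ha.exists_norm_kn_packet_le_const
  have hint : Integrable (Function.uncurry fun (x : Rd d) (w : Rd d × Rd d) =>
      gabor f w * (kohnNirenberg a (packet w) x * star (g x))) := by
    have h0 : Integrable fun p : Rd d × (Rd d × Rd d) =>
        (C * ‖g p.1‖) * (‖gabor f p.2‖ * Real.exp (|m| * ω.phase p.2)) :=
      (g.integrable.norm.const_mul C).mul_prod (f.integrable_gabor_mul_exp |m|)
    refine h0.mono' ?_ (Eventually.of_forall fun p => ?_)
    · exact ((f.continuous_gabor.comp continuous_snd).stronglyMeasurable.mul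
        (((stronglyMeasurable_kohnNirenberg_packet ω ha.continuous).comp_measurable
          (g := fun p : Rd d × (Rd d × Rd d) => (p.2, p.1)) measurable_swap).mul
          (g.continuous.comp continuous_fst).star.stronglyMeasurable)).aestronglyMeasurable
    · obtain ⟨x, w⟩ := p
      simp only [Function.uncurry_apply_pair, norm_mul, norm_star]
      calc _ ≤ ‖gabor f w‖ * ((C * Real.exp (|m| * ω.phase w)) * ‖g x‖) := by
            gcongr
            exact hk w x
        _ = _ := by ring
  have e : ∀ x, ∫ w, gabor f w * (kohnNirenberg a (packet w) x * star (g x)) =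
      gaborConst d * (kohnNirenberg a f x * star (g x)) := fun x => by
    rw [← mul_assoc, ha.gaborConst_mul_kohnNirenberg, ← integral_mul_const]
    simp only [mul_assoc]
  constructor
  · have h1 := hint.integral_prod_left
    simp only [Function.uncurry_apply_pair, e] at h1
    refine (h1.const_mul (gaborConst d : ℂ)⁻¹).congr (Eventually.of_forall fun x => ?_)
    exact inv_mul_cancel_left₀ (gaborConst_ne_zero d) _
  · rw [← integral_const_mul]
    simp only [← e]
    rw [integral_integral_swap hint]
    congr 1
    funext w
    rw [integral_const_mul, knPairing]

theorem IsSymbol.exists_norm_gaborT_mul_knPairing_le (ha : IsSymbol ω m a) (u : SomegaDual ω d) :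
    ∃ (C : ℝ) (L : {l : ℝ // 0 < l}), 0 < C ∧ ∀ (g : Somega ω d) (w : Rd d × Rd d),
      ‖u.gaborT w * knPairing a g w‖ ≤ C * seminormZero ω d L g * Real.exp (-ω.phase w) := by
  obtain ⟨C, k, hC, hk, hu⟩ := u.exists_norm_gaborT_le
  obtain ⟨C', L, hC', h⟩ := ha.exists_norm_knPairing_le (l := k + 1) (by positivity)
  refine ⟨C * C', L, by positivity, fun g w => ?_⟩
  have hp0 : 0 ≤ seminormZero ω d L g := apply_nonneg _ _
  rw [norm_mul]
  calc _ ≤ (C * Real.exp (k * ω.phase w)) *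
        (C' * seminormZero ω d L g * Real.exp (-((k + 1) * ω.phase w))) := by
        gcongr
        · exact hu w
        · exact h g w
    _ = C * C' * seminormZero ω d L g * (Real.exp (k * ω.phase w) *
        Real.exp (-((k + 1) * ω.phase w))) := by ring
    _ = _ := by
        rw [← Real.exp_add]
        congr 2
        ring

theorem IsSymbol.integrable_gaborT_mul_knPairing (ha : IsSymbol ω m a) (u : SomegaDual ω d)
    (g : Somega ω d) : Integrable fun w => u.gaborT w * knPairing a g w := by
  obtain ⟨C, L, -, h⟩ := ha.exists_norm_gaborT_mul_knPairing_le u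
  exact ((ω.integrable_exp_neg_phase d).const_mul _).mono'
    (u.stronglyMeasurable_gaborT.mul (ha.stronglyMeasurable_knPairing g)).aestronglyMeasurable
    (Eventually.of_forall (h g))

theorem IsSymbol.integrable_kn_packet_mul_star (ha : IsSymbol ω m a) (g : Somega ω d)
    (w : Rd d × Rd d) : Integrable fun x => kohnNirenberg a (packet w) x * star (g x) := by
  obtain ⟨C, -, h⟩ := ha.exists_norm_kn_packet_le_const
  have hg : Integrable fun x => star (g x) :=
    g.integrable.norm.mono' g.continuous.star.aestronglyMeasurable
      (Eventually.of_forall fun x => (norm_star _).le)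
  exact hg.bdd_mul (
    stronglyMeasurable_kn_packet_right ω ha.continuous w).aestronglyMeasurable
    (Eventually.of_forall (h w))

theorem seminormZero_le_finset_sup (L : {l : ℝ // 0 < l}) (g : Somega ω d) :
    seminormZero ω d L g ≤ 2 * ({Sum.inl (L, 0), Sum.inr (L, 0)} :
      Finset (({l : ℝ // 0 < l} × ℕ) ⊕ ({l : ℝ // 0 < l} × ℕ))).sup (somegaSeminorms ω d) g := by
  have h : ∀ i ∈ ({Sum.inl (L, 0), Sum.inr (L, 0)} :
      Finset (({l : ℝ // 0 < l} × ℕ) ⊕ ({l : ℝ // 0 < l} × ℕ))), somegaSeminorms ω d i g ≤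
      ({Sum.inl (L, 0), Sum.inr (L, 0)} :
      Finset (({l : ℝ // 0 < l} × ℕ) ⊕ ({l : ℝ // 0 < l} × ℕ))).sup (somegaSeminorms ω d) g :=
    fun i hi => Seminorm.le_def.1 (Finset.le_sup (f := somegaSeminorms ω d) hi) g
  have h1 := h (Sum.inl (L, 0)) (by simp)
  have h2 := h (Sum.inr (L, 0)) (by simp)
  change somegaSeminorms ω d _ g + somegaSeminorms ω d _ g ≤ _
  linarith

/-- The conjugate-linear functional `g ↦ ⟨a(x,D)u, g⟩`. -/
noncomputable def IsSymbol.applyLinear (ha : IsSymbol ω m a) (u : SomegaDual ω d) :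
    Somega ω d →ₗ⋆[ℂ] ℂ where
  toFun g := (gaborConst d : ℂ)⁻¹ * ∫ w, u.gaborT w * knPairing a g w
  map_add' g h := by
    rw [← mul_add, ← integral_add (ha.integrable_gaborT_mul_knPairing u g)
      (ha.integrable_gaborT_mul_knPairing u h)]
    congr 2
    funext w
    rw [← mul_add, knPairing, knPairing, knPairing, ← integral_add
      (ha.integrable_kn_packet_mul_star g w) (ha.integrable_kn_packet_mul_star h w)]
    simp only [Somega.coe_add, Pi.add_apply, star_add, mul_add]
  map_smul' c g := by
    have e : ∀ w, knPairing a (c • g : Somega ω d) w = star c * knPairing a g w := fun w => by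
      rw [knPairing, knPairing, ← integral_const_mul]
      congr 1
      funext x
      rw [Somega.coe_smul, Pi.smul_apply, smul_eq_mul, star_mul']
      ring
    simp only [e, smul_eq_mul, starRingEnd_apply, mul_left_comm _ (star c), integral_const_mul]

/-- The value of the operator with symbol `a` at an ultradistribution. -/
noncomputable def IsSymbol.applyDual (ha : IsSymbol ω m a) (u : SomegaDual ω d) :
    SomegaDual ω d where
  toLinearMap := ha.applyLinear u
  cont := by
    obtain ⟨C, L, hC, h⟩ := ha.exists_norm_gaborT_mul_knPairing_le u
    set I := ∫ z : Rd d × Rd d, Real.exp (-ω.phase z) with hI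
    have hI0 : 0 ≤ I := integral_nonneg fun v => (Real.exp_pos _).le
    have hc := gaborConst_pos d
    refine WithSeminorms.continuous_normedSpace_rng ℂ (somega_withSeminorms ω d) (ha.applyLinear u)
      ⟨{Sum.inl (L, 0), Sum.inr (L, 0)}, ⟨(gaborConst d)⁻¹ * (C * 2 * I), by positivity⟩,
        fun g => ?_⟩
    change ‖(gaborConst d : ℂ)⁻¹ * ∫ w, u.gaborT w * knPairing a g w‖ ≤
      (gaborConst d)⁻¹ * (C * 2 * I) * Finset.sup _ (somegaSeminorms ω d) g
    have h1 : ‖∫ w, u.gaborT w * knPairing a g w‖ ≤ C * seminormZero ω d L g * I := by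
      rw [hI, ← integral_const_mul]
      exact norm_integral_le_of_norm_le ((ω.integrable_exp_neg_phase d).const_mul _)
        (Eventually.of_forall (h g))
    rw [norm_mul, norm_inv, Complex.norm_real, Real.norm_of_nonneg hc.le, mul_assoc]
    refine mul_le_mul_of_nonneg_left (h1.trans ?_) (by positivity)
    have := mul_le_mul_of_nonneg_left (seminormZero_le_finset_sup L g)
      (mul_nonneg hC.le hI0)
    linarith

theorem IsSymbol.applyDual_apply (ha : IsSymbol ω m a) (u : SomegaDual ω d) (g : Somega ω d) :
    ha.applyDual u g = (gaborConst d : ℂ)⁻¹ * ∫ w, u.gaborT w * knPairing a g w := rfl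

end OmegaWF

namespace OmegaWF

/-! ### Continuity of the operator for the strong topology -/

variable {ω : Weight} {d : ℕ} {m : ℝ} {a : Rd d × Rd d → ℂ}

theorem exists_seminormZero_le_of_isVonNBounded {B : Set (Somega ω d)}
    (hB : Bornology.IsVonNBounded ℂ B) (L : {l : ℝ // 0 < l}) :
    ∃ r : ℝ, 0 < r ∧ ∀ g ∈ B, seminormZero ω d L g ≤ r := by
  have h := (somega_withSeminorms ω d).isVonNBounded_iff_seminorm_bounded.1 hB
  obtain ⟨r₁, hr₁, h₁⟩ := h (Sum.inl (L, 0))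
  obtain ⟨r₂, hr₂, h₂⟩ := h (Sum.inr (L, 0))
  exact ⟨r₁ + r₂, by positivity, fun g hg => add_le_add (h₁ g hg).le (h₂ g hg).le⟩

theorem exists_norm_gabor_le_of_isVonNBounded {B : Set (Somega ω d)}
    (hB : Bornology.IsVonNBounded ℂ B) {l : ℝ} (hl : 0 < l) :
    ∃ C : ℝ, 0 < C ∧ ∀ g ∈ B, ∀ z, ‖gabor g z‖ ≤ C * Real.exp (-(l * ω.phase z)) := by
  obtain ⟨C, hC, h⟩ := exists_norm_gabor_le ω d hl
  obtain ⟨r, hr, h'⟩ := exists_seminormZero_le_of_isVonNBounded hB ⟨2 * l, by positivity⟩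
  refine ⟨C * r, by positivity, fun g hg z => (h g z).trans ?_⟩
  have := h' g hg
  gcongr

theorem IsSymbol.exists_norm_knPairing_le_of_isVonNBounded (ha : IsSymbol ω m a)
    {B : Set (Somega ω d)} (hB : Bornology.IsVonNBounded ℂ B) {l : ℝ} (hl : 0 < l) :
    ∃ C : ℝ, 0 < C ∧ ∀ g ∈ B, ∀ w, ‖knPairing a g w‖ ≤ C * Real.exp (-(l * ω.phase w)) := by
  obtain ⟨C, L, hC, h⟩ := ha.exists_norm_knPairing_le hl
  obtain ⟨r, hr, h'⟩ := exists_seminormZero_le_of_isVonNBounded hB L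
  refine ⟨C * r, by positivity, fun g hg z => (h g z).trans ?_⟩
  have := h' g hg
  gcongr

/-- Phase-space shifts of the Gaussian, multiplied by rapidly decreasing factors, form a bounded
subset of `S_ω`. -/
theorem isVonNBounded_range_smul_shift {τ : Rd d × Rd d → ℝ} (hτ : ∀ w, 0 ≤ τ w)
    (h : ∀ l : ℝ, 0 < l → ∃ C : ℝ, 0 < C ∧ ∀ w, τ w ≤ C * Real.exp (-(l * ω.phase w))) :
    Bornology.IsVonNBounded ℂ
      (range fun w => ((τ w : ℝ) : ℂ) • (gaussS ω d).shift w) := by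
  refine (somega_withSeminorms ω d).isVonNBounded_iff_finset_seminorm_bounded.2 fun s => ?_
  obtain ⟨C, k, hC, hk, h1⟩ := (gaussS ω d).exists_seminorm_shift_le s
  obtain ⟨C', hC', h2⟩ := h k hk
  refine ⟨C' * C + 1, by positivity, ?_⟩
  rintro _ ⟨w, rfl⟩
  refine lt_of_le_of_lt ?_ (lt_add_one _)
  rw [map_smul_eq_mul, Complex.norm_real, Real.norm_of_nonneg (hτ w)]
  calc _ ≤ (C' * Real.exp (-(k * ω.phase w))) * (C * Real.exp (k * ω.phase w)) := by
        gcongr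
        · exact h2 w
        · exact h1 w
    _ = C' * C * (Real.exp (-(k * ω.phase w)) * Real.exp (k * ω.phase w)) := by ring
    _ = C' * C := by rw [← Real.exp_add, neg_add_cancel, Real.exp_zero, mul_one]

theorem le_ciSup_norm_subtype {ι Z : Type*} {B : Set ι} {F : ι → Z → ℂ} {b : Z → ℝ}
    (h : ∀ g ∈ B, ∀ z, ‖F g z‖ ≤ b z) (g : ι) (hg : g ∈ B) (z : Z) :
    ‖F g z‖ ≤ ⨆ g : B, ‖F g z‖ := by
  refine le_ciSup (f := fun g : B => ‖F g z‖) ⟨b z, ?_⟩ ⟨g, hg⟩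
  rintro _ ⟨g, rfl⟩
  exact h g g.2 z

/-- The operator with symbol `a` on `S'_ω`, as a linear map. -/
noncomputable def IsSymbol.dualLinear (ha : IsSymbol ω m a) :
    SomegaDual ω d →ₗ[ℂ] SomegaDual ω d where
  toFun := ha.applyDual
  map_add' u v := by
    ext g
    rw [add_apply, ha.applyDual_apply, ha.applyDual_apply, ha.applyDual_apply,
      ← mul_add, ← integral_add (ha.integrable_gaborT_mul_knPairing u g)
        (ha.integrable_gaborT_mul_knPairing v g)]
    congr 2
    funext w
    rw [← add_mul]
    rfl
  map_smul' c u := by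
    ext g
    have e : ∀ w, (c • u).gaborT w * knPairing a g w = c * (u.gaborT w * knPairing a g w) :=
      fun w => mul_assoc c (u.gaborT w) (knPairing a g w)
    rw [smul_apply, ha.applyDual_apply, ha.applyDual_apply, smul_eq_mul, mul_left_comm,
      RingHom.id_apply]
    simp only [e, integral_const_mul]

/-- For bounded B, the supremum τ(w) of |⟨a(x,D)Π(w)γ, g⟩| over g in B decays rapidly, so the
packets scaled by τ(w)e^{ω(w)} form a bounded set. If u is small on it, then |V u|τ is at most a
small multiple of e^{-ω}, and integration makes a(x,D)u uniformly small on B. -/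
theorem IsSymbol.continuous_dualLinear (ha : IsSymbol ω m a) : Continuous ha.dualLinear := by
  refine continuous_of_continuousAt_zero ha.dualLinear ?_
  rw [ContinuousAt, map_zero]
  refine (ContinuousLinearMap.hasBasis_nhds_zero_of_basis
    Metric.nhds_basis_closedBall).tendsto_right_iff.2 ?_
  rintro ⟨B, r⟩ ⟨hB, hr⟩
  simp only at hB hr
  set τ : Rd d × Rd d → ℝ := fun w => ⨆ g : B, ‖knPairing a (g : Somega ω d) w‖ with hτ
  obtain ⟨C₀, hC₀, hB₀⟩ := ha.exists_norm_knPairing_le_of_isVonNBounded hB one_pos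
  have hle := le_ciSup_norm_subtype (F := fun (g : Somega ω d) w => knPairing a g w) hB₀
  have hτ0 : ∀ w, 0 ≤ τ w := fun w => Real.iSup_nonneg fun g => norm_nonneg _
  have hbdd := isVonNBounded_range_smul_shift (ω := ω) (d := d)
    (τ := fun w => τ w * Real.exp (ω.phase w)) (fun w => mul_nonneg (hτ0 w) (Real.exp_pos _).le)
    fun l hl => by
      obtain ⟨C, hC, h⟩ := ha.exists_norm_knPairing_le_of_isVonNBounded hB
        (l := l + 1) (by positivity)
      refine ⟨C, hC, fun w => ?_⟩
      have h1 : τ w ≤ C * Real.exp (-((l + 1) * ω.phase w)) :=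
        Real.iSup_le (fun g => h g g.2 w) (by positivity)
      calc _ ≤ (C * Real.exp (-((l + 1) * ω.phase w))) * Real.exp (ω.phase w) := by gcongr
        _ = _ := by
          rw [mul_assoc, ← Real.exp_add]
          congr 2
          ring
  set I := ∫ z : Rd d × Rd d, Real.exp (-ω.phase z) with hI
  have hI0 : 0 ≤ I := integral_nonneg fun v => (Real.exp_pos _).le
  have hc := gaborConst_pos d
  have hr' : 0 < r * gaborConst d / (I + 1) := by positivity
  filter_upwards [ContinuousLinearMap.eventually_nhds_zero_mapsTo hbdd
    (Metric.closedBall_mem_nhds (0 : ℂ) hr')] with u hu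
  intro g hg
  rw [mem_closedBall_zero_iff]
  change ‖(gaborConst d : ℂ)⁻¹ * ∫ w, u.gaborT w * knPairing a g w‖ ≤ r
  have h1 : ‖∫ w, u.gaborT w * knPairing a g w‖ ≤ r * gaborConst d / (I + 1) * I := by
    rw [hI, ← integral_const_mul]
    refine norm_integral_le_of_norm_le ((ω.integrable_exp_neg_phase d).const_mul _)
      (Eventually.of_forall fun w => ?_)
    have h2 := hu (mem_range_self w)
    rw [mem_closedBall_zero_iff, map_smulₛₗ, smul_eq_mul, norm_mul, Complex.conj_ofReal,
      Complex.norm_real, Real.norm_of_nonneg (mul_nonneg (hτ0 w) (Real.exp_pos _).le)] at h2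
    have h3 : Real.exp (ω.phase w) * Real.exp (-ω.phase w) = 1 := by
      rw [← Real.exp_add, add_neg_cancel, Real.exp_zero]
    rw [norm_mul]
    calc _ ≤ ‖u.gaborT w‖ * τ w := mul_le_mul_of_nonneg_left (hle g hg w) (norm_nonneg _)
      _ = (τ w * Real.exp (ω.phase w) * ‖u.gaborT w‖) * Real.exp (-ω.phase w) := by
          linear_combination (-(τ w * ‖u.gaborT w‖)) * h3
      _ ≤ _ := mul_le_mul_of_nonneg_right h2 (Real.exp_pos _).le
  rw [norm_mul, norm_inv, Complex.norm_real, Real.norm_of_nonneg hc.le,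
    inv_mul_le_iff₀ hc]
  refine h1.trans ?_
  rw [div_mul_eq_mul_div, div_le_iff₀ (by positivity)]
  nlinarith [mul_pos hr hc]

/-- The operator with symbol `a` on `S'_ω`. -/
noncomputable def IsSymbol.dualOperator (ha : IsSymbol ω m a) :
    SomegaDual ω d →L[ℂ] SomegaDual ω d := ⟨ha.dualLinear, ha.continuous_dualLinear⟩

theorem IsSymbol.dualOperator_apply (ha : IsSymbol ω m a) (u : SomegaDual ω d) (g : Somega ω d) :
    ha.dualOperator u g = (gaborConst d : ℂ)⁻¹ * ∫ w, u.gaborT w * knPairing a g w := rfl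

theorem IsSymbol.extendsKohnNirenberg_dualOperator (ha : IsSymbol ω m a) :
    ExtendsKohnNirenberg a ha.dualOperator := by
  intro f g
  obtain ⟨h1, h2⟩ := ha.integrable_kn_pairing f g
  refine ⟨h1, ?_⟩
  rw [ha.dualOperator_apply, f.gaborT_toDual, ← h2, inv_mul_cancel_left₀ (gaborConst_ne_zero d)]

/-! ### Uniqueness of the extension -/

/-- A continuous functional on `S'_ω` is bounded by the supremum over a bounded set. -/
theorem exists_norm_le_of_continuous (ℓ : SomegaDual ω d →ₗ[ℂ] ℂ) (hℓ : Continuous ℓ) :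
    ∃ (K : Set (Somega ω d)) (C : ℝ), Bornology.IsVonNBounded ℂ K ∧ 0 < C ∧
      ∀ (u : SomegaDual ω d) (M : ℝ), 0 ≤ M → (∀ h ∈ K, ‖u h‖ ≤ M) → ‖ℓ u‖ ≤ C * M := by
  have h0 : ∀ᶠ u in nhds (0 : SomegaDual ω d), ‖ℓ u‖ < 1 := by
    have := (continuous_norm.comp hℓ).tendsto 0
    simp only [Function.comp_apply, map_zero, norm_zero] at this
    exact this.eventually (gt_mem_nhds one_pos)
  obtain ⟨⟨K, ε⟩, ⟨hK, hε⟩, h⟩ := (ContinuousLinearMap.hasBasis_nhds_zero_of_basis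
    Metric.nhds_basis_closedBall).eventually_iff.1 h0
  simp only at hK hε
  refine ⟨K, ε⁻¹, hK, by positivity, fun u M hM hu => ?_⟩
  -- M may be 0, so u is scaled by 1/b for every b > M/ε instead of by ε/M.
  refine le_of_forall_gt_imp_ge_of_dense fun b hb => ?_
  have hM' : M < ε * b := by rwa [← inv_mul_lt_iff₀ hε]
  have hb0 : 0 < ε * b := hM.trans_lt hM'
  have hb1 : 0 < b := by
    rcases (mul_pos_iff.1 hb0) with h | h
    · exact h.2
    · exact absurd hε h.1.not_gt
  have h1 := h (show ((b⁻¹ : ℝ) : ℂ) • u ∈ _ from fun g hg => by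
    rw [mem_closedBall_zero_iff, smul_apply, smul_eq_mul, norm_mul,
      Complex.norm_real, Real.norm_of_nonneg (by positivity), inv_mul_le_iff₀ hb1, mul_comm b]
    exact (hu g hg).trans hM'.le)
  rw [map_smul, smul_eq_mul, norm_mul, Complex.norm_real, Real.norm_of_nonneg (by positivity),
    inv_mul_lt_iff₀ hb1, mul_one] at h1
  exact h1.le

theorem star_gabor_gaussS_shift (w z : Rd d × Rd d) :
    star (gabor ((gaussS ω d).shift z) w) = gabor ((gaussS ω d).shift w) z := by
  simp only [gabor, gaussS_shift_coe]
  rw [← starRingEnd_apply, ← integral_conj]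
  congr 1
  funext y
  simp [mul_comm]

/-- K may be uncountable; a supremum of continuous functions is still lower semicontinuous. -/
theorem measurable_iSup_norm_gabor {K : Set (Somega ω d)} {C : ℝ}
    (h : ∀ g ∈ K, ∀ z, ‖gabor g z‖ ≤ C * Real.exp (-(1 * ω.phase z))) :
    Measurable fun z => ⨆ g : K, ‖gabor (g : Somega ω d) z‖ := by
  refine LowerSemicontinuous.measurable ?_
  refine lowerSemicontinuous_ciSup (fun z => ⟨C * Real.exp (-(1 * ω.phase z)), ?_⟩) fun g =>
    (g : Somega ω d).continuous_gabor.norm.lowerSemicontinuous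
  rintro _ ⟨g, rfl⟩
  exact h g g.2 z

/-- A continuous functional on `S'_ω` that vanishes on `S_ω` is zero. -/
theorem eq_zero_of_forall_toDual (ℓ : SomegaDual ω d →ₗ[ℂ] ℂ) (hℓ : Continuous ℓ)
    (h0 : ∀ f : Somega ω d, ℓ f.toDual = 0) (u : SomegaDual ω d) : ℓ u = 0 := by
  obtain ⟨K, C, hK, hC, hKb⟩ := exists_norm_le_of_continuous ℓ hℓ
  set κ : Rd d × Rd d → ℝ := fun z => ⨆ g : K, ‖gabor (g : Somega ω d) z‖ with hκ
  obtain ⟨C₁, hC₁, hK₁⟩ := exists_norm_gabor_le_of_isVonNBounded hK one_pos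
  have hle := le_ciSup_norm_subtype (F := fun (g : Somega ω d) w => gabor g w) hK₁
  have hκm : Measurable κ := measurable_iSup_norm_gabor hK₁
  have hκ0 : ∀ w, 0 ≤ κ w := fun w => Real.iSup_nonneg fun g => norm_nonneg _
  have hκd : ∀ l : ℝ, 0 < l → ∃ C : ℝ, 0 < C ∧ ∀ w, κ w ≤ C * Real.exp (-(l * ω.phase w)) :=
    fun l hl => by
      obtain ⟨C, hC, h⟩ := exists_norm_gabor_le_of_isVonNBounded hK hl
      exact ⟨C, hC, fun w => Real.iSup_le (fun g => h g g.2 w) (by positivity)⟩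
  -- By inversion |v(g)| is at most c⁻¹ ∫ |V v| κ for g in K. Writing κ = W e^{-ω} puts this bound
  -- on ℓ into the form required by the L² representation.
  let W : Rd d × Rd d → ℂ := fun z => ((κ z * Real.exp (ω.phase z) : ℝ) : ℂ)
  have hWm : StronglyMeasurable W := (Complex.measurable_ofReal.comp
    (hκm.mul (Real.continuous_exp.comp ω.continuous_phase).measurable)).stronglyMeasurable
  have hWn : ∀ z, ‖W z‖ = κ z * Real.exp (ω.phase z) := fun z => by
    rw [Complex.norm_real, Real.norm_of_nonneg (mul_nonneg (hκ0 z) (Real.exp_pos _).le)]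
  have hWd : ∀ l : ℝ, 0 < l → ∃ C : ℝ, 0 < C ∧ ∀ w, ‖W w‖ ≤ C * Real.exp (-(l * ω.phase w)) :=
    fun l hl => by
      obtain ⟨C, hC, h⟩ := hκd (l + 1) (by positivity)
      refine ⟨C, hC, fun w => ?_⟩
      rw [hWn]
      calc _ ≤ (C * Real.exp (-((l + 1) * ω.phase w))) * Real.exp (ω.phase w) := by
            gcongr
            exact h w
        _ = _ := by
            rw [mul_assoc, ← Real.exp_add]
            congr 2
            ring
  let Φ : SomegaDual ω d →ₗ[ℂ] (Rd d × Rd d → ℂ) :=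
    { toFun := fun v z => W z * v.gaborT z
      map_add' := fun v v' => by
        funext z
        exact mul_add (W z) (v.gaborT z) (v'.gaborT z)
      map_smul' := fun c v => by
        funext z
        exact mul_left_comm (W z) c (v.gaborT z) }
  have hΦ : ∀ v z, Φ v z = W z * v.gaborT z := fun v z => rfl
  have hmem : ∀ v, MemLp (Φ v) 2 := fun v => by
    obtain ⟨A, k, hA, hk, hv⟩ := v.exists_norm_gaborT_le
    obtain ⟨A', hA', hW⟩ := hWd (k + 1) (by positivity)
    refine memLp_two_of_le_exp_neg_phase (ω := ω) (C := A' * A)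
      (hWm.mul v.stronglyMeasurable_gaborT).aestronglyMeasurable fun z => ?_
    rw [hΦ, norm_mul]
    calc _ ≤ (A' * Real.exp (-((k + 1) * ω.phase z))) * (A * Real.exp (k * ω.phase z)) := by
          gcongr
          · exact hW z
          · exact hv z
      _ = A' * A * (Real.exp (-((k + 1) * ω.phase z)) * Real.exp (k * ω.phase z)) := by ring
      _ = _ := by rw [← Real.exp_add]; congr 2; ring
  have hc := gaborConst_pos d
  obtain ⟨q, hqm, hq2, hq⟩ := exists_integral_repr Φ hmem (memLp_exp_neg_phase ω d) ℓ
    (C := C * (gaborConst d)⁻¹) (by positivity) fun v => by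
      rw [mul_assoc]
      have hnn : 0 ≤ ∫ z, ‖Φ v z‖ * Real.exp (-ω.phase z) :=
        integral_nonneg fun z => by positivity
      refine hKb v _ (by positivity) fun g hg => ?_
      have e : v g = (gaborConst d : ℂ)⁻¹ * ∫ z, v.gaborT z * star (gabor g z) := by
        rw [← v.inversion, inv_mul_cancel_left₀ (gaborConst_ne_zero d)]
      rw [e, norm_mul, norm_inv, Complex.norm_real, Real.norm_of_nonneg hc.le]
      refine mul_le_mul_of_nonneg_left (norm_integral_le_of_norm_le
        ((hmem v).norm.integrable_mul (memLp_exp_neg_phase ω d))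
        (Eventually.of_forall fun z => ?_)) (by positivity)
      have h3 : Real.exp (ω.phase z) * Real.exp (-ω.phase z) = 1 := by
        rw [← Real.exp_add, add_neg_cancel, Real.exp_zero]
      change _ ≤ ‖Φ v z‖ * Real.exp (-ω.phase z)
      rw [norm_mul, norm_star, hΦ, norm_mul, hWn]
      calc _ ≤ ‖v.gaborT z‖ * κ z := mul_le_mul_of_nonneg_left (hle g hg z) (norm_nonneg _)
        _ = _ := by linear_combination (-(κ z * ‖v.gaborT z‖)) * h3
  obtain ⟨A, k, hA, hk, hu⟩ := u.exists_norm_gaborT_le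
  obtain ⟨A', hA', hW⟩ := hWd (k + 2) (by positivity)
  obtain ⟨A'', hA'', hγ⟩ := (gaussS ω d).exists_norm_gabor_le (k + 1)
  have hint : Integrable (Function.uncurry fun (z w : Rd d × Rd d) =>
      u.gaborT w * (q z * (W z * gabor ((gaussS ω d).shift w) z))) := by
    have hb : Integrable fun p : (Rd d × Rd d) × (Rd d × Rd d) =>
        (A * A' * A'' * (‖q p.1‖ * Real.exp (-ω.phase p.1))) * Real.exp (-ω.phase p.2) :=
      ((hq2.norm.integrable_mul (memLp_exp_neg_phase ω d)).const_mul (A * A' * A'')).mul_prod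
        (ω.integrable_exp_neg_phase d)
    refine hb.mono' ?_ (Eventually.of_forall fun p => ?_)
    · exact ((u.stronglyMeasurable_gaborT.comp_measurable measurable_snd).mul
        ((hqm.comp_measurable measurable_fst).mul ((hWm.comp_measurable measurable_fst).mul
          ((continuous_gabor_shift (gaussS ω d)).comp
            continuous_swap).stronglyMeasurable))).aestronglyMeasurable
    · obtain ⟨z, w⟩ := p
      simp only [Function.uncurry_apply_pair, norm_mul, norm_gabor_shift]
      calc _ ≤ (A * Real.exp (k * ω.phase w)) * (‖q z‖ * ((A' * Real.exp (-((k + 2) * ω.phase z))) *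
            (A'' * Real.exp (-((k + 1) * ω.phase (z - w)))))) := by
            gcongr
            · exact hu w
            · exact hW z
            · exact hγ _
        _ = A * A' * A'' * ‖q z‖ * (Real.exp (k * ω.phase w) * Real.exp (-((k + 2) * ω.phase z)) *
            Real.exp (-((k + 1) * ω.phase (z - w)))) := by ring
        _ ≤ A * A' * A'' * ‖q z‖ * (Real.exp (-ω.phase z) * Real.exp (-ω.phase w)) := by
            simp only [← Real.exp_add]
            refine mul_le_mul_of_nonneg_left (Real.exp_le_exp.2 ?_) (by positivity)
            have h1 := ω.phase_le_sub_add w z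
            rw [ω.phase_sub_comm] at h1
            have h2 := mul_le_mul_of_nonneg_left h1 (by positivity : 0 ≤ k + 1)
            linarith
        _ = _ := by ring
  -- V u is itself replaced by its superposition over packets. After Fubini the inner integral is ℓ
  -- of the packet at w, which lies in S_ω.
  have e1 : ∀ z, gaborConst d * (q z * Φ u z) =
      ∫ w, u.gaborT w * (q z * (W z * gabor ((gaussS ω d).shift w) z)) := fun z => by
    have h1 := u.inversion ((gaussS ω d).shift z)
    simp only [star_gabor_gaussS_shift] at h1
    have h2 : gaborConst d * (q z * Φ u z) =
        q z * W z * (gaborConst d * u ((gaussS ω d).shift z)) := by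
      rw [hΦ, SomegaDual.gaborT]
      ring
    rw [h2, h1, ← integral_const_mul]
    congr 1
    funext w
    ring
  have e2 : gaborConst d * ℓ u = 0 := by
    rw [hq, ← integral_const_mul]
    simp only [e1]
    rw [integral_integral_swap hint]
    refine integral_eq_zero_of_ae (Eventually.of_forall fun w => ?_)
    simp only
    rw [integral_const_mul, Pi.zero_apply]
    have h1 := hq ((gaussS ω d).shift w).toDual
    rw [h0] at h1
    simp only [hΦ, Somega.gaborT_toDual] at h1
    rw [← h1, mul_zero]
  exact (mul_eq_zero.1 e2).resolve_left (gaborConst_ne_zero d)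

theorem eq_of_extendsKohnNirenberg {A A' : SomegaDual ω d →L[ℂ] SomegaDual ω d}
    (hA : ExtendsKohnNirenberg a A) (hA' : ExtendsKohnNirenberg a A') : A = A' := by
  ext u g
  let ℓ : SomegaDual ω d →ₗ[ℂ] ℂ :=
    { toFun := fun v => A v g - A' v g
      map_add' := fun v w => by
        rw [map_add, map_add, add_apply, add_apply]
        ring
      map_smul' := fun c v => by
        rw [map_smul, map_smul, smul_apply, smul_apply,
          RingHom.id_apply, smul_sub] }
  have hℓ : Continuous ℓ := ((continuous_eval_const g).comp A.continuous).sub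
    ((continuous_eval_const g).comp A'.continuous)
  have h := eq_zero_of_forall_toDual ℓ hℓ (fun f => by
    change A f.toDual g - A' f.toDual g = 0
    rw [(hA f g).2, (hA' f g).2, sub_self]) u
  exact sub_eq_zero.1 h

end OmegaWF

namespace OmegaWF

/-! ### Cones and the wave front set -/

variable {ω : Weight} {d : ℕ} {m : ℝ} {a : Rd d × Rd d → ℂ}

theorem isOpenConic_of_ball {z₀ : Rd d × Rd d} {ε : ℝ} (h0 : ε ≤ ‖z₀‖) :
    IsOpenConic {z : Rd d × Rd d | ∃ t : ℝ, 0 < t ∧ ‖t • z - z₀‖ < ε} := by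
  refine ⟨?_, ?_, ?_⟩
  · have e : {z : Rd d × Rd d | ∃ t : ℝ, 0 < t ∧ ‖t • z - z₀‖ < ε} =
        ⋃ t ∈ Ioi (0 : ℝ), {z | ‖t • z - z₀‖ < ε} := by
      ext z
      simp
    rw [e]
    exact isOpen_biUnion fun t _ =>
      isOpen_lt ((continuous_const_smul t).sub continuous_const).norm continuous_const
  · rintro ⟨t, -, h⟩
    rw [smul_zero, zero_sub, norm_neg] at h
    exact absurd h0 h.not_ge
  · rintro z ⟨t, ht, h⟩ s hs
    refine ⟨t * s⁻¹, by positivity, ?_⟩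
    rwa [smul_smul, mul_assoc, inv_mul_cancel₀ hs.ne', mul_one]

/-- Every open cone around `z₀` contains the relative neighbourhoods of the points of a smaller
open cone around `z₀`. -/
theorem IsOpenConic.exists_margin {Γ : Set (Rd d × Rd d)} (hΓ : IsOpenConic Γ) {z₀ : Rd d × Rd d}
    (hz₀ : z₀ ∈ Γ) : ∃ (Γ' : Set (Rd d × Rd d)) (δ : ℝ), IsOpenConic Γ' ∧ z₀ ∈ Γ' ∧ 0 < δ ∧ δ ≤ 1 ∧
      ∀ z ∈ Γ', ∀ w, ‖w - z‖ ≤ δ * ‖z‖ → w ∈ Γ := by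
  obtain ⟨ε, hε, hball⟩ := Metric.isOpen_iff.1 hΓ.1 z₀ hz₀
  -- As 0 is not in Γ, the ball is no larger than the distance to 0; this keeps 0 out of the smaller
  -- cone.
  have hle : ε ≤ ‖z₀‖ := by
    by_contra h
    refine hΓ.2.1 (hball ?_)
    rw [mem_ball_iff_norm, zero_sub, norm_neg]
    exact not_le.1 h
  -- Half of ε is for z and half for w. Since |tz| ≤ |z₀| + ε/2, this δ gives |t(w - z)| ≤ ε/2.
  refine ⟨{z | ∃ t : ℝ, 0 < t ∧ ‖t • z - z₀‖ < ε / 2}, ε / 2 / (‖z₀‖ + ε / 2),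
    isOpenConic_of_ball (by linarith), ⟨1, one_pos, by simpa using hε⟩, by positivity, ?_, ?_⟩
  · rw [div_le_one (by positivity)]
    linarith [norm_nonneg z₀]
  · rintro z ⟨t, ht, h⟩ w hw
    have h1 : t • w ∈ Γ := by
      refine hball ?_
      rw [mem_ball_iff_norm]
      have e : t • w - z₀ = t • (w - z) + (t • z - z₀) := by
        rw [smul_sub]
        abel
      have h2 : ‖t • z‖ ≤ ‖z₀‖ + ε / 2 := by
        have := norm_add_le (t • z - z₀) z₀
        rw [sub_add_cancel] at this
        linarith
      have h3 : ‖t • (w - z)‖ ≤ ε / 2 := by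
        rw [norm_smul, Real.norm_of_nonneg ht.le] at h2 ⊢
        calc t * ‖w - z‖ ≤ t * (ε / 2 / (‖z₀‖ + ε / 2) * ‖z‖) := by gcongr
          _ = ε / 2 / (‖z₀‖ + ε / 2) * (t * ‖z‖) := by ring
          _ ≤ ε / 2 / (‖z₀‖ + ε / 2) * (‖z₀‖ + ε / 2) := by gcongr
          _ = ε / 2 := div_mul_cancel₀ _ (by positivity)
      rw [e]
      exact (norm_add_le _ _).trans_lt (by linarith)
    have := hΓ.2.2 _ h1 t⁻¹ (inv_pos.2 ht)
    rwa [smul_smul, inv_mul_cancel₀ ht.ne', one_smul] at this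

theorem Weight.exists_phase_le (ω : Weight) (d : ℕ) {δ : ℝ} (hδ : 0 < δ) :
    ∃ N K : ℝ, 0 < N ∧ 0 ≤ K ∧ ∀ (z : Rd d × Rd d) (T : ℝ), δ * ‖z‖ ≤ T →
      ω.phase z ≤ N * ω T + K := by
  have hN : (0 : ℝ) < ⌈δ⁻¹⌉₊ := by
    exact_mod_cast Nat.ceil_pos.2 (inv_pos.2 hδ)
  refine ⟨2 * ⌈δ⁻¹⌉₊, 2 * ω 0, by positivity, by linarith [ω.nonneg 0 le_rfl],
    fun z T hT => ?_⟩
  have h0 : 0 ≤ δ * ‖z‖ := by positivity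
  have h1 := ω.phase_le_norm z
  have h2 := ω.mono h0 (h0.trans hT) hT
  have h3 : ω ‖z‖ ≤ ⌈δ⁻¹⌉₊ * ω (δ * ‖z‖) + ω 0 := by
    rcases ω.le_mul_ceil (D := δ⁻¹) h0 with h | h
    · rwa [inv_mul_cancel_left₀ hδ.ne'] at h
    · exact absurd h (inv_pos.2 hδ).le.not_gt
  have h4 := mul_le_mul_of_nonneg_left h2 hN.le
  linarith

/-- The smaller of two exponents is at most their mean. It combines smallness far from the support,
which has a loss off the diagonal, with off-diagonal decay. -/
theorem le_add_mul_exp_of_le {x A B α β : ℝ} (hA : 0 ≤ A) (hB : 0 ≤ B)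
    (h₁ : x ≤ A * Real.exp α) (h₂ : x ≤ B * Real.exp β) :
    x ≤ (A + B) * Real.exp ((α + β) / 2) := by
  rcases le_total α β with h | h
  · exact h₁.trans (mul_le_mul (by linarith) (Real.exp_le_exp.2 (by linarith))
      (Real.exp_pos _).le (by positivity))
  · exact h₂.trans (mul_le_mul (by linarith) (Real.exp_le_exp.2 (by linarith))
      (Real.exp_pos _).le (by positivity))

theorem integrable_exp_neg_phase_sub (ω : Weight) (z : Rd d × Rd d) :
    Integrable fun w : Rd d × Rd d => Real.exp (-ω.phase (w - z)) :=
  (ω.integrable_exp_neg_phase d).comp_sub_right z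

theorem integral_exp_neg_phase_sub (ω : Weight) (z : Rd d × Rd d) :
    ∫ w : Rd d × Rd d, Real.exp (-ω.phase (w - z)) = ∫ w : Rd d × Rd d, Real.exp (-ω.phase w) :=
  integral_sub_right_eq_self (fun w : Rd d × Rd d => Real.exp (-ω.phase w)) z

/-! ### Rapid decrease in cones and the inclusion of the wave front set -/

theorem IsSymbol.gaborT_dualOperator (ha : IsSymbol ω m a) (u : SomegaDual ω d)
    (z : Rd d × Rd d) : (ha.dualOperator u).gaborT z =
      (gaborConst d : ℂ)⁻¹ * ∫ w, u.gaborT w * knMatrix a w z := by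
  rw [SomegaDual.gaborT, ha.dualOperator_apply]
  simp only [knPairing_gaussS_shift]

/-- If the symbol vanishes at the large points of a cone, then the Gabor transform of `a(x,D)u`
decreases rapidly in each smaller cone. -/
theorem IsSymbol.exists_norm_gaborT_dualOperator_le (ha : IsSymbol ω m a)
    {Γ Γ' : Set (Rd d × Rd d)} {δ R₀ : ℝ} (hδ : 0 < δ) (hδ1 : δ ≤ 1) (hR₀ : 0 ≤ R₀)
    (hΓ : ∀ z ∈ Γ', ∀ w, ‖w - z‖ ≤ δ * ‖z‖ → w ∈ Γ) (hs : ∀ p ∈ Γ, a p ≠ 0 → ‖p‖ ≤ R₀)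
    (u : SomegaDual ω d) {l : ℝ} (hl : 0 < l) :
    ∃ C : ℝ, 0 < C ∧ ∀ z ∈ Γ', ‖(ha.dualOperator u).gaborT z‖ ≤ C * Real.exp (-(l * ω.phase z)) := by
  obtain ⟨N, K, hN, hK, hph⟩ := ω.exists_phase_le d hδ
  obtain ⟨A, k, hA, hk, hu⟩ := u.exists_norm_gaborT_le
  have hM := abs_nonneg m
  set q : ℝ := |m| + k + l with hq
  have hq0 : 0 < q := by positivity
  -- The rates are doubled because exponents are averaged. In the mean the terms 2Nq·ω(w - z) cancel
  -- and decay (|m| + k + 1)ω(w - z) remains: |m| + k to move the growth from w to z and 1 to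
  -- integrate. The gain Nq·ω(δ|z|), at least q(ω(z) - K), covers (|m| + k)ω(z) and leaves l·ω(z).
  obtain ⟨C₁, hC₁, h₁⟩ := ha.exists_norm_knMatrix_le_of_support (l := 2 * N * q) (by positivity)
  obtain ⟨C₂, hC₂, h₂⟩ := ha.exists_norm_knMatrix_le (l := 2 * N * q + 2 * (|m| + k + 1))
    (by positivity)
  set I := ∫ z : Rd d × Rd d, Real.exp (-ω.phase z) with hI
  have hI0 : 0 ≤ I := integral_nonneg fun v => (Real.exp_pos _).le
  have hc := gaborConst_pos d
  set P := A * (C₁ + C₂) * Real.exp (q * (K + N * (2 * ω R₀))) with hP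
  have hP0 : 0 < P := by positivity
  refine ⟨(gaborConst d)⁻¹ * (P * (I + 1)), by positivity, fun z hz => ?_⟩
  -- A support point is either in Γ, hence bounded by R₀, or outside Γ, hence at distance at least
  -- δ|z| from z.
  have hR : ∀ p, a p ≠ 0 → ω (δ * ‖z‖) - 2 * ω R₀ ≤ ω.phase (p - z) := by
    intro p hp
    have h0 : 0 ≤ δ * ‖z‖ := by positivity
    by_cases hpΓ : p ∈ Γ
    · have h1 := ω.mono (norm_nonneg p) hR₀ (hs p hpΓ hp)
      have h2 := ω.phase_le_norm p
      have h3 := ω.phase_le_sub_add z p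
      rw [ω.phase_sub_comm] at h3
      have h4 := ω.norm_le_phase z
      have h5 := ω.mono h0 (norm_nonneg z) (mul_le_of_le_one_left (norm_nonneg z) hδ1)
      linarith
    · have h1 : δ * ‖z‖ ≤ ‖p - z‖ := le_of_not_ge fun h => hpΓ (hΓ z hz p h)
      have h2 := ω.mono h0 (norm_nonneg _) h1
      have h3 := ω.norm_le_phase (p - z)
      have h4 := ω.nonneg R₀ hR₀
      linarith
  have hpt : ∀ w, ‖u.gaborT w * knMatrix a w z‖ ≤
      P * Real.exp (-(l * ω.phase z)) * Real.exp (-ω.phase (w - z)) := by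
    intro w
    have h3 := h₁ w z _ hR
    have h4 := h₂ w z
    rw [mul_assoc, mul_assoc, ← Real.exp_add, ← Real.exp_add] at h3
    rw [mul_assoc, ← Real.exp_add] at h4
    have h5 := le_add_mul_exp_of_le hC₁.le hC₂.le h3 h4
    rw [norm_mul]
    calc _ ≤ (A * Real.exp (k * ω.phase w)) * _ :=
          mul_le_mul (hu w) h5 (norm_nonneg _) (by positivity)
      _ = A * (C₁ + C₂) * (Real.exp (k * ω.phase w) * _) := by rw [mul_mul_mul_comm]
      _ ≤ A * (C₁ + C₂) * (Real.exp (q * (K + N * (2 * ω R₀))) *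
          (Real.exp (-(l * ω.phase z)) * Real.exp (-ω.phase (w - z)))) := by
          simp only [← Real.exp_add]
          refine mul_le_mul_of_nonneg_left (Real.exp_le_exp.2 ?_) (by positivity)
          have h6 := mul_le_mul_of_nonneg_left (ω.phase_le_sub_add w z)
            (by positivity : 0 ≤ |m| + k)
          have h7 := mul_le_mul_of_nonneg_left (hph z (δ * ‖z‖) le_rfl) hq0.le
          rw [hq] at h7 ⊢
          ring_nf at h6 h7 ⊢
          linarith
      _ = _ := by rw [hP]; ring
  rw [ha.gaborT_dualOperator, norm_mul, norm_inv, Complex.norm_real, Real.norm_of_nonneg hc.le,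
    mul_assoc]
  refine mul_le_mul_of_nonneg_left ?_ (by positivity)
  refine (norm_integral_le_of_norm_le ((integrable_exp_neg_phase_sub ω z).const_mul _)
    (Eventually.of_forall hpt)).trans ?_
  rw [integral_const_mul, integral_exp_neg_phase_sub, ← hI]
  calc _ ≤ P * Real.exp (-(l * ω.phase z)) * (I + 1) := by gcongr; linarith
    _ = _ := by ring

/-- Rapid decrease in a cone of the Gabor transform implies rapid decrease in each smaller cone of
the short-time Fourier transform with an arbitrary window. -/
theorem exists_norm_stft_le (φ : Somega ω d) (v : SomegaDual ω d) {Γ Γ' : Set (Rd d × Rd d)}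
    {δ : ℝ} (hδ : 0 < δ) (hΓ : ∀ z ∈ Γ', ∀ w, ‖w - z‖ ≤ δ * ‖z‖ → w ∈ Γ) {l : ℝ} (hl : 0 < l)
    (hv : ∃ C : ℝ, 0 < C ∧ ∀ z ∈ Γ, ‖v.gaborT z‖ ≤ C * Real.exp (-(l * ω.phase z))) :
    ∃ C : ℝ, 0 < C ∧ ∀ ζ ∈ Γ', ‖stft φ v ζ‖ ≤ C * Real.exp (-(l * ω.phase ζ)) := by
  obtain ⟨N, K, hN, hK, hph⟩ := ω.exists_phase_le d hδ
  obtain ⟨A, k, hA, hk, hu⟩ := v.exists_norm_gaborT_le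
  obtain ⟨B, hB, hvB⟩ := hv
  -- This rate covers both cases. For z in Γ, moving the decay from z to ζ costs lω(z - ζ). Outside
  -- Γ one has |z - ζ| ≥ δ|ζ|, so the growth kω(z) together with the desired lω(ζ) is at most (k +
  -- (k + l)N)ω(z - ζ) up to a constant.
  set q : ℝ := l + k + (k + l) * N with hq
  obtain ⟨C, hC, hφ⟩ := φ.exists_norm_gabor_le (q + 1)
  set I := ∫ z : Rd d × Rd d, Real.exp (-ω.phase z) with hI
  have hI0 : 0 ≤ I := integral_nonneg fun v => (Real.exp_pos _).le
  have hc := gaborConst_pos d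
  set P := A * Real.exp ((k + l) * K) + B with hP
  have hP0 : 0 < P := by positivity
  refine ⟨(gaborConst d)⁻¹ * (P * C * (I + 1)), by positivity, fun ζ hζ => ?_⟩
  have hb : ∀ z, ‖v.gaborT z‖ ≤ P * Real.exp (-(l * ω.phase ζ) + q * ω.phase (z - ζ)) := by
    intro z
    have hq1 : 0 ≤ ω.phase (z - ζ) := ω.phase_nonneg _
    by_cases hz : z ∈ Γ
    · refine (hvB z hz).trans (mul_le_mul (by rw [hP]; linarith [mul_pos hA (Real.exp_pos ((k + l) * K))])
        (Real.exp_le_exp.2 ?_) (Real.exp_pos _).le hP0.le)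
      have h1 := ω.phase_le_sub_add ζ z
      rw [ω.phase_sub_comm] at h1
      have h2 := mul_le_mul_of_nonneg_left h1 hl.le
      have h3 : 0 ≤ (k + (k + l) * N) * ω.phase (z - ζ) := by positivity
      rw [hq]
      linarith
    · have h1 : δ * ‖ζ‖ ≤ ‖z - ζ‖ := le_of_not_ge fun h => hz (hΓ ζ hζ z h)
      have h2 := hph ζ _ h1
      have h3 := mul_le_mul_of_nonneg_left (ω.norm_le_phase (z - ζ)) hN.le
      have h4 := mul_le_mul_of_nonneg_left (h2.trans (add_le_add_left h3 K))
        (by positivity : 0 ≤ k + l)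
      have h5 := mul_le_mul_of_nonneg_left (ω.phase_le_sub_add z ζ) hk.le
      have h6 : 0 ≤ l * ω.phase (z - ζ) := by positivity
      calc _ ≤ A * Real.exp (k * ω.phase z) := hu z
        _ ≤ A * (Real.exp ((k + l) * K) * Real.exp (-(l * ω.phase ζ) + q * ω.phase (z - ζ))) := by
            rw [← Real.exp_add]
            refine mul_le_mul_of_nonneg_left (Real.exp_le_exp.2 ?_) hA.le
            rw [hq]
            linarith
        _ ≤ _ := by
            rw [← mul_assoc]
            refine mul_le_mul_of_nonneg_right ?_ (Real.exp_pos _).le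
            rw [hP]
            linarith
  have hpt : ∀ z, ‖v.gaborT z * star (gabor (φ.shift ζ) z)‖ ≤
      P * C * Real.exp (-(l * ω.phase ζ)) * Real.exp (-ω.phase (z - ζ)) := by
    intro z
    rw [norm_mul, norm_star, norm_gabor_shift]
    calc _ ≤ (P * Real.exp (-(l * ω.phase ζ) + q * ω.phase (z - ζ))) *
          (C * Real.exp (-((q + 1) * ω.phase (z - ζ)))) :=
          mul_le_mul (hb z) (hφ _) (norm_nonneg _) (by positivity)
      _ = P * C * (Real.exp (-(l * ω.phase ζ) + q * ω.phase (z - ζ)) *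
          Real.exp (-((q + 1) * ω.phase (z - ζ)))) := by ring
      _ = P * C * (Real.exp (-(l * ω.phase ζ)) * Real.exp (-ω.phase (z - ζ))) := by
          rw [← Real.exp_add, ← Real.exp_add]
          congr 2
          ring
      _ = _ := by ring
  have e : stft φ v ζ = (gaborConst d : ℂ)⁻¹ *
      ∫ z, v.gaborT z * star (gabor (φ.shift ζ) z) := by
    rw [← v.inversion, inv_mul_cancel_left₀ (gaborConst_ne_zero d), stft]
  rw [e, norm_mul, norm_inv, Complex.norm_real, Real.norm_of_nonneg hc.le, mul_assoc]
  refine mul_le_mul_of_nonneg_left ?_ (by positivity)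
  refine (norm_integral_le_of_norm_le ((integrable_exp_neg_phase_sub ω ζ).const_mul _)
    (Eventually.of_forall hpt)).trans ?_
  rw [integral_const_mul, integral_exp_neg_phase_sub, ← hI]
  calc _ ≤ P * C * Real.exp (-(l * ω.phase ζ)) * (I + 1) := by gcongr; linarith
    _ = _ := by ring

/-- The cone is shrunk twice: once for the action of the operator, and once for the passage from the
Gaussian to the window φ. -/
theorem IsSymbol.waveFrontSet_subset_conesupp (ha : IsSymbol ω m a) (φ : Somega ω d)
    (u : SomegaDual ω d) : waveFrontSet φ (ha.dualOperator u) ⊆ conesupp a := by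
  rintro z₀ ⟨hz₀, hWF⟩
  refine ⟨hz₀, fun Γ hΓ hmem hcpt => hWF ?_⟩
  obtain ⟨R, hR⟩ := hcpt.isBounded.exists_norm_le
  have hs : ∀ p ∈ Γ, a p ≠ 0 → ‖p‖ ≤ max R 0 := fun p hp h0 =>
    (hR p (subset_closure ⟨subset_tsupport a h0, hp⟩)).trans (le_max_left _ _)
  obtain ⟨Γ₁, δ₁, hΓ₁, hz₁, hδ₁, hδ₁', h₁⟩ := hΓ.exists_margin hmem
  obtain ⟨Γ₂, δ₂, hΓ₂, hz₂, hδ₂, -, h₂⟩ := hΓ₁.exists_margin hz₁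
  refine ⟨Γ₂, hΓ₂, hz₂, fun l hl => ?_⟩
  obtain ⟨C, hC, h⟩ := exists_norm_stft_le φ (ha.dualOperator u) hδ₂ h₂ hl
    (ha.exists_norm_gaborT_dualOperator_le hδ₁ hδ₁' (le_max_right R 0) h₁ hs u hl)
  refine ⟨C, ?_⟩
  rintro _ ⟨z, hz, rfl⟩
  calc _ ≤ Real.exp (l * ω.phase z) * (C * Real.exp (-(l * ω.phase z))) := by
        refine mul_le_mul (Real.exp_le_exp.2 ?_) (h z hz) (norm_nonneg _) (Real.exp_pos _).le
        exact mul_le_mul_of_nonneg_left (ω.phaseNorm_le_phase z) hl.le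
    _ = C * (Real.exp (l * ω.phase z) * Real.exp (-(l * ω.phase z))) := by ring
    _ = C := by rw [← Real.exp_add, add_neg_cancel, Real.exp_zero, mul_one]

end OmegaWF

/-! ### The proposition -/

theorem mainTheorem5 (d : ℕ) (ω : OmegaWF.Weight) (m : ℝ)
    (a : OmegaWF.Rd d × OmegaWF.Rd d → ℂ) (ha : OmegaWF.IsSymbol ω m a) :
    (∃! A : OmegaWF.SomegaDual ω d →L[ℂ] OmegaWF.SomegaDual ω d,
      OmegaWF.ExtendsKohnNirenberg a A) ∧
    ∀ A : OmegaWF.SomegaDual ω d →L[ℂ] OmegaWF.SomegaDual ω d,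
      OmegaWF.ExtendsKohnNirenberg a A →
        ∀ φ : OmegaWF.Somega ω d, φ ≠ 0 → ∀ u : OmegaWF.SomegaDual ω d,
          OmegaWF.waveFrontSet φ (A u) ⊆ OmegaWF.conesupp a := by
  have h := ha.extendsKohnNirenberg_dualOperator
  refine ⟨⟨ha.dualOperator, h, fun A hA => OmegaWF.eq_of_extendsKohnNirenberg hA h⟩,
    fun A hA φ _ u => ?_⟩
  rw [OmegaWF.eq_of_extendsKohnNirenberg hA h]
  exact ha.waveFrontSet_subset_conesupp φ u
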